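/- Conventions. Let $M$ be a complex manifold of dimension $n$, with local coordinates $z$ on $M$ and $(z,\eta)$ on the holomorphic tangent bundle $T'M$; write $\dot\partial_k=\partial/\partial\eta^k$, $\dot\partial_{\bar k}=\partial/\partial\bar\eta^k$. For a metric function $F:T'M\to[0,\infty)$ put $g_{i\bar j}=\dot\partial_i\dot\partial_{\bar j}F^2$, $N^i_j=g^{\bar m i}\frac{\partial g_{l\bar m}}{\partial z^j}\eta^l$, $2G^i=N^i_j\eta^j$, $L^i_{jk}=\dot\partial_jN^i_k$, $\theta^{*k}=g^{\bar mk}g_{h\bar p}(L^{\bar p}_{\bar j\bar m}-L^{\bar p}_{\bar m\bar j})\eta^h\bar\eta^j$. All conditions below are imposed at the points $\eta\neq0$ of $T'M$ where the metrics involved are smooth (for the metric $F$ of the theorem these are the points with $h(\eta,\bar W)\ne 0$). $F$ is *generalized Berwald* if $\dot\partial_{\bar h}G^i=0$. Metrics $F,\tilde F$ are *projectively related* if there is a smooth complex valued function $P$ of $(z,\eta)$ with $\tilde G^i=G^i+\frac12(\tilde\theta^{*i}-\theta^{*i})+P\eta^i$. $F$ is *complex Douglas* if its three projective curvature invariants of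 Douglas type $\dot\partial_h\dot\partial_k\dot\partial_j D^i$, $\dot\partial_{\bar h}\dot\partial_k\dot\partial_jD^i$, $\dot\partial_{\bar h}\dot\partial_{\bar k}\dot\partial_jD^i$ vanish, where $$D^i=G^i-\tfrac1{n+1}(\dot\partial_mG^m)\eta^i-\tfrac12\bigl(\theta^{*i}-\tfrac1n(\dot\partial_m\theta^{*m})\eta^i\bigr).$$ Theorem 4.8. Let $M$ be a connected complex manifold of dimension $n\ge2$ with a smooth Hermitian metric $h$, let $\|u\|_h:M\to\mathbb R$ be a smooth function and let $W$ be a smooth section of $T'M$ with $0<\|W\|_h<\|u\|_h\le1$ everywhere. Put $\tilde\varepsilon=\|u\|_h^2-\|W\|_h^2$, let $\varphi$ be a constant with $\cos\varphi<0$ (for example $\cos\varphi=-1$), and let $$F(z,\eta)=\frac{\sqrt{|h(\eta,\bar W)|^2\cos^2\varphi+\|\eta\|_h^2\,\tilde\varepsilon}-|h(\eta,\bar W)|\cos\varphi}{\tilde\varepsilon}$$ be the complex Randers solution of the generalized Zermelo navigation problem. Thus $F=\alpha+|\beta|$ with $\alpha(z,\eta)=\|\eta\|_a$, $a_{i\bar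 j}=\frac{h_{i\bar j}}{\tilde\varepsilon}+\frac{W_i\bar W_j}{\tilde\varepsilon^2}\cos^2\varphi$, $\beta=-\frac{W_i\eta^i}{\tilde\varepsilon}\cos\varphi$, $W_i=h_{i\bar j}\bar W^j$. Suppose that $F$ is generalized Berwald and that $h$ and $a$ are projectively related. Then $F$ is a complex Douglas metric if and only if $\tilde\varepsilon$ is constant on $M$. -/

import Mathlib

open scoped Manifold ContDiff ComplexConjugate

noncomputable section

namespace ComplexFinsler

/-! ### Local calculus on an open set of `ℂⁿ` -/

/-- Coordinate space `ℂⁿ`. -/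
abbrev Cn (n : ℕ) : Type := Fin n → ℂ

/-- Wirtinger derivative `∂g/∂zᵏ = (∂g/∂xᵏ - i ∂g/∂yᵏ) / 2`. -/
def wirtinger {n : ℕ} (k : Fin n) (g : Cn n → ℂ) (z : Cn n) : ℂ :=
  (fderiv ℝ g z (Pi.single k 1) - Complex.I * fderiv ℝ g z (Pi.single k Complex.I)) / 2

/-- Wirtinger derivative `∂g/∂z̄ᵏ = (∂g/∂xᵏ + i ∂g/∂yᵏ) / 2`. -/
def wirtingerBar {n : ℕ} (k : Fin n) (g : Cn n → ℂ) (z : Cn n) : ℂ :=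
  (fderiv ℝ g z (Pi.single k 1) + Complex.I * fderiv ℝ g z (Pi.single k Complex.I)) / 2

/-- `∂/∂zᵏ` of a function of `(z, η)`. -/
def dz {n : ℕ} (k : Fin n) (g : Cn n → Cn n → ℂ) (z η : Cn n) : ℂ :=
  wirtinger k (fun z' => g z' η) z

/-- The vertical derivative `∂̇ₖ = ∂/∂ηᵏ` of a function of `(z, η)`. -/
def dEta {n : ℕ} (k : Fin n) (g : Cn n → Cn n → ℂ) (z η : Cn n) : ℂ :=
  wirtinger k (g z) η

/-- The vertical derivative `∂̇_k̄ = ∂/∂η̄ᵏ` of a function of `(z, η)`. -/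
def dEtaBar {n : ℕ} (k : Fin n) (g : Cn n → Cn n → ℂ) (z η : Cn n) : ℂ :=
  wirtingerBar k (g z) η

/-! In this section `Φ z η` is the expression of a complex Finsler metric in coordinates. -/

/-- The fundamental tensor `g_{i j̄} = ∂̇ᵢ ∂̇_j̄ F²`. -/
def fundTensor {n : ℕ} (Φ : Cn n → Cn n → ℝ) (z η : Cn n) : Matrix (Fin n) (Fin n) ℂ :=
  Matrix.of fun i j => dEta i (dEtaBar j fun z' η' => ((Φ z' η' ^ 2 : ℝ) : ℂ)) z η

/-- The inverse `g^{m̄ i}` of the fundamental tensor: `∑ₘ g_{j m̄} g^{m̄ i} = δⱼⁱ`. -/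
def fundTensorInv {n : ℕ} (Φ : Cn n → Cn n → ℝ) (z η : Cn n) : Matrix (Fin n) (Fin n) ℂ :=
  (fundTensor Φ z η)⁻¹

/-- The Chern-Finsler nonlinear connection `Nⁱⱼ = g^{m̄ i} (∂g_{l m̄}/∂zʲ) ηˡ`. -/
def connN {n : ℕ} (Φ : Cn n → Cn n → ℝ) (i j : Fin n) (z η : Cn n) : ℂ :=
  ∑ m, ∑ l, fundTensorInv Φ z η m i * dz j (fun z' η' => fundTensor Φ z' η' l m) z η * η l

/-- The spray coefficients `Gⁱ`, where `2 Gⁱ = Nⁱⱼ ηʲ`. -/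
def spray {n : ℕ} (Φ : Cn n → Cn n → ℝ) (i : Fin n) (z η : Cn n) : ℂ :=
  (∑ j, connN Φ i j z η * η j) / 2

/-- `Lⁱⱼₖ = ∂̇ⱼ Nⁱₖ`. -/
def connL {n : ℕ} (Φ : Cn n → Cn n → ℝ) (i j k : Fin n) (z η : Cn n) : ℂ :=
  dEta j (connN Φ i k) z η

/-- `θ*ᵏ = g^{m̄ k} g_{h p̄} (L^p̄_{j̄ m̄} - L^p̄_{m̄ j̄}) ηʰ η̄ʲ`. -/
def thetaStar {n : ℕ} (Φ : Cn n → Cn n → ℝ) (k : Fin n) (z η : Cn n) : ℂ :=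
  ∑ m, ∑ h, ∑ p, ∑ j, fundTensorInv Φ z η m k * fundTensor Φ z η h p *
    conj (connL Φ p j m z η - connL Φ p m j z η) * η h * conj (η j)

/-- The part of `Gⁱ - θ*ⁱ / 2` that is unchanged by every projective change
`G̃ⁱ - θ̃*ⁱ / 2 = Gⁱ - θ*ⁱ / 2 + P ηⁱ`. Since `Gⁱ` has bidegree `(2,0)` and `θ*ⁱ` bidegree `(1,1)`
in `(η, η̄)`, such a change is `G̃ⁱ = Gⁱ + S ηⁱ`, `θ̃*ⁱ = θ*ⁱ + 2 Q ηⁱ`, `P = S - Q`, with `S` of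
bidegree `(1,0)` and `Q` of bidegree `(0,1)`; so `∂̇ₘ(S ηᵐ) = (n+1) S`, `∂̇ₘ(Q ηᵐ) = n Q`, and
`S`, `Q` are eliminated by subtracting traces. -/
def projSpray {n : ℕ} (Φ : Cn n → Cn n → ℝ) (i : Fin n) (z η : Cn n) : ℂ :=
  (spray Φ i z η - (∑ m, dEta m (spray Φ m) z η) / ((n : ℂ) + 1) * η i)
    - (thetaStar Φ i z η - (∑ m, dEta m (thetaStar Φ m) z η) / (n : ℂ) * η i) / 2

/-- First projective curvature invariant of Douglas type, `Dⁱ_{j k h}`. -/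
def douglas₁ {n : ℕ} (Φ : Cn n → Cn n → ℝ) (i j k h : Fin n) : Cn n → Cn n → ℂ :=
  dEta h (dEta k (dEta j (projSpray Φ i)))

/-- Second projective curvature invariant of Douglas type, `Dⁱ_{j k h̄}`. -/
def douglas₂ {n : ℕ} (Φ : Cn n → Cn n → ℝ) (i j k h : Fin n) : Cn n → Cn n → ℂ :=
  dEtaBar h (dEta k (dEta j (projSpray Φ i)))

/-- Third projective curvature invariant of Douglas type, `Dⁱ_{j k̄ h̄}`. -/
def douglas₃ {n : ℕ} (Φ : Cn n → Cn n → ℝ) (i j k h : Fin n) : Cn n → Cn n → ℂ :=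
  dEtaBar h (dEtaBar k (dEta j (projSpray Φ i)))

/-- `(z, η)` is a point off the zero section at which the metric is (real-)smooth. For a metric
which is smooth off the zero section this only says `η ≠ 0`; for a complex Randers metric
`α + |β|` it says `β(z, η) ≠ 0`. -/
def RegularAt {n : ℕ} (Φ : Cn n → Cn n → ℝ) (z η : Cn n) : Prop :=
  η ≠ 0 ∧ ContDiffAt ℝ ∞ (fun p : Cn n × Cn n => Φ p.1 p.2) (z, η)

/-! ### Metrics on a complex manifold

The fibre `T'ₓM` of the holomorphic tangent bundle is Mathlib's complex tangent space. -/

/-- The holomorphic tangent space `T'ₓM`. -/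
abbrev HTangent (n : ℕ) {M : Type*} [TopologicalSpace M] [ChartedSpace (Cn n) M] (x : M) : Type :=
  TangentSpace 𝓘(ℂ, Cn n) x

section Manifold

variable {n : ℕ} {M : Type*} [TopologicalSpace M] [ChartedSpace (Cn n) M]

/-- The tangent vector `ηⁱ ∂/∂zⁱ` at the point with coordinates `z` in the chart `φ`. -/
def tangentAt (φ : OpenPartialHomeomorph M (Cn n)) (z η : Cn n) : HTangent n (φ.symm z) :=
  mfderiv 𝓘(ℂ, Cn n) 𝓘(ℂ, Cn n) φ.symm z η

/-- The expression in the chart `φ` of a function on `T'M`. -/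
def localRep {R : Type*} (F : (x : M) → HTangent n x → R) (φ : OpenPartialHomeomorph M (Cn n))
    (z η : Cn n) : R :=
  F (φ.symm z) (tangentAt φ z η)

/-- `F` is generalized Berwald: the spray coefficients are holomorphic in `η`, `∂̇_h̄ Gⁱ = 0`. -/
def IsGeneralizedBerwald (F : (x : M) → HTangent n x → ℝ) : Prop :=
  ∀ φ ∈ atlas (Cn n) M, ∀ z ∈ φ.target, ∀ η : Cn n, RegularAt (localRep F φ) z η →
    ∀ i h : Fin n, dEtaBar h (spray (localRep F φ) i) z η = 0

/-- `F` is complex Douglas: its projective curvature invariants of Douglas type vanish. -/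
def IsComplexDouglas (F : (x : M) → HTangent n x → ℝ) : Prop :=
  ∀ φ ∈ atlas (Cn n) M, ∀ z ∈ φ.target, ∀ η : Cn n, RegularAt (localRep F φ) z η →
    ∀ i j k h : Fin n, douglas₁ (localRep F φ) i j k h z η = 0 ∧
      douglas₂ (localRep F φ) i j k h z η = 0 ∧ douglas₃ (localRep F φ) i j k h z η = 0

/-- `F` and `F'` are projectively related: there is a projective change
`G'ⁱ = Gⁱ + Bⁱ + P ηⁱ`, `Bⁱ = (θ'*ⁱ - θ*ⁱ) / 2`, with a smooth complex valued function `P`. -/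
def ProjectivelyRelated (F F' : (x : M) → HTangent n x → ℝ) : Prop :=
  ∃ P : (x : M) → HTangent n x → ℂ, ∀ φ ∈ atlas (Cn n) M,
    ContDiffOn ℝ ∞ (fun p : Cn n × Cn n => localRep P φ p.1 p.2)
      {p | p.1 ∈ φ.target ∧ RegularAt (localRep F φ) p.1 p.2 ∧
        RegularAt (localRep F' φ) p.1 p.2} ∧
    ∀ z ∈ φ.target, ∀ η : Cn n, RegularAt (localRep F φ) z η → RegularAt (localRep F' φ) z η →
      ∀ i : Fin n, spray (localRep F' φ) i z η = spray (localRep F φ) i z η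
        + (thetaStar (localRep F' φ) i z η - thetaStar (localRep F φ) i z η) / 2
        + localRep P φ z η * η i

variable (n M)

/-- A smooth Hermitian metric: `form x η ζ` is `h(η, ζ̄) = h_{i j̄} ηⁱ ζ̄ʲ`. -/
structure HermitianMetric where
  form : (x : M) → HTangent n x →ₗ[ℂ] HTangent n x →ₗ⋆[ℂ] ℂ
  conj_symm : ∀ (x : M) (η ζ : HTangent n x), conj (form x η ζ) = form x ζ η
  pos : ∀ (x : M) (η : HTangent n x), η ≠ 0 → 0 < (form x η η).re
  smooth : ∀ φ ∈ atlas (Cn n) M, ∀ i j : Fin n,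
    ContDiffOn ℝ ∞ (fun z => form (φ.symm z) (tangentAt φ z (Pi.single i 1))
      (tangentAt φ z (Pi.single j 1))) φ.target

variable {n M}

/-- The norm `‖η‖_h = √h(η, η̄)`. -/
def HermitianMetric.norm (h : HermitianMetric n M) (x : M) (η : HTangent n x) : ℝ :=
  Real.sqrt (h.form x η η).re

variable (n M)

/-- Generalized navigation data `(h, ‖u‖_h, W)`: a Hermitian metric, a smooth function
`speed = ‖u‖_h` and a smooth section `W` of `T'M`, with `‖W‖_h < ‖u‖_h ≤ 1`. -/
structure NavigationData where
  h : HermitianMetric n M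
  speed : M → ℝ
  W : (x : M) → HTangent n x
  smooth_speed : ∀ φ ∈ atlas (Cn n) M, ContDiffOn ℝ ∞ (fun z => speed (φ.symm z)) φ.target
  smooth_W : ∀ φ ∈ atlas (Cn n) M, ContDiffOn ℝ ∞
    (fun z => (mfderiv 𝓘(ℂ, Cn n) 𝓘(ℂ, Cn n) φ (φ.symm z) (W (φ.symm z)) : Cn n)) φ.target
  norm_W_lt : ∀ x, h.norm x (W x) < speed x
  speed_le : ∀ x, speed x ≤ 1

variable {n M}

namespace NavigationData

/-- `ε̃ = ‖u‖²_h - ‖W‖²_h`. -/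
def eps (D : NavigationData n M) (x : M) : ℝ :=
  D.speed x ^ 2 - D.h.norm x (D.W x) ^ 2

/-- The solution of the generalized Zermelo navigation problem with constant angle
`ϕ = arg h(η, W̄)`:
`F(z, η) = (√((|h(η, W̄)| cos ϕ)² + ‖η‖²_h ε̃) - |h(η, W̄)| cos ϕ) / ε̃`.
It is a complex Randers metric when `cos ϕ < 0` and `W ≠ 0`. -/
def solution (D : NavigationData n M) (ϕ : ℝ) (x : M) (η : HTangent n x) : ℝ :=
  (Real.sqrt ((‖D.h.form x η (D.W x)‖ * Real.cos ϕ) ^ 2 + D.h.norm x η ^ 2 * D.eps x)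
    - ‖D.h.form x η (D.W x)‖ * Real.cos ϕ) / D.eps x

/-- The new Hermitian metric `a_{i j̄} = h_{i j̄} / ε̃ + (Wᵢ / ε̃) (W̄ⱼ / ε̃) cos² ϕ`, where
`Wᵢ ηⁱ = h(η, W̄)`. -/
def aForm (D : NavigationData n M) (ϕ : ℝ) (x : M) (η ζ : HTangent n x) : ℂ :=
  D.h.form x η ζ / D.eps x
    + (D.h.form x η (D.W x) / D.eps x) * conj (D.h.form x ζ (D.W x) / D.eps x)
      * (Real.cos ϕ ^ 2 : ℝ)

/-- The norm `α = ‖η‖_a` of the new Hermitian metric `a`. -/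
def alpha (D : NavigationData n M) (ϕ : ℝ) (x : M) (η : HTangent n x) : ℝ :=
  Real.sqrt (D.aForm ϕ x η η).re

/-- The `(1,0)`-form `β = bᵢ ηⁱ`, `bᵢ = -(Wᵢ / ε̃) cos ϕ`. -/
def beta (D : NavigationData n M) (ϕ : ℝ) (x : M) (η : HTangent n x) : ℂ :=
  -(D.h.form x η (D.W x) / D.eps x) * Real.cos ϕ

theorem eps_pos (D : NavigationData n M) (x : M) : 0 < D.eps x := by
  have h0 : 0 ≤ D.h.norm x (D.W x) := Real.sqrt_nonneg _
  have h1 := D.norm_W_lt x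
  unfold eps
  nlinarith

/-- The solution is `F = α + |β|` when `cos ϕ ≤ 0`. -/
theorem solution_eq_randers (D : NavigationData n M) (ϕ : ℝ) (hϕ : Real.cos ϕ ≤ 0)
    (x : M) (η : HTangent n x) :
    D.solution ϕ x η = D.alpha ϕ x η + ‖D.beta ϕ x η‖ := by
  have he := D.eps_pos x
  have hpos : 0 ≤ (D.h.form x η η).re := by
    by_cases h0 : η = 0
    · subst h0; simp
    · exact (D.h.pos x η h0).le
  have ha : (D.aForm ϕ x η η).re =
      ((‖D.h.form x η (D.W x)‖ * Real.cos ϕ) ^ 2 + D.h.norm x η ^ 2 * D.eps x)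
        / D.eps x ^ 2 := by
    unfold aForm
    rw [Complex.mul_conj, Complex.normSq_eq_norm_sq, ← Complex.ofReal_mul, Complex.add_re,
      Complex.div_ofReal_re, Complex.ofReal_re, norm_div, Complex.norm_real,
      Real.norm_of_nonneg he.le, HermitianMetric.norm, Real.sq_sqrt hpos]
    field_simp
    ring
  have hb : ‖D.beta ϕ x η‖ = -(‖D.h.form x η (D.W x)‖ * Real.cos ϕ) / D.eps x := by
    unfold beta
    rw [norm_mul, norm_neg, norm_div, Complex.norm_real, Complex.norm_real,
      Real.norm_of_nonneg he.le, Real.norm_of_nonpos hϕ]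
    ring
  rw [alpha, ha, hb, Real.sqrt_div' _ (sq_nonneg _), Real.sqrt_sq he.le, solution]
  ring

end NavigationData

end Manifold

end ComplexFinsler

end

/-! Work in a chart and write e for `ε̃`, C = a - b⊗b̄, b♯ for the vector dual to β with respect to
a, and ν for the squared a-norm of b. Since a = h/e + b⊗b̄, the metric h is e·C, and positivity of h
forces 0 < ν < 1. The theorem thus becomes a local statement about (a, b, e): F = α + |β| is Douglas
exactly when ∂e = 0 (`IsNavigation.douglas_iff`). Connectedness of M then turns ∂e = 0 in all charts
into constancy (`eps_const_iff`).

Put L = F² and δ_q = ∂_q - (∂̇_q Gᵖ)∂̇_p. Homogeneity gives formulas free of inverse matrices: 2Gⁱ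
g_{i q̄} = ηʲ ∂_j ∂̇_q̄ L and θ*ᵏ g_{k q̄} = 2 conj(δ_q L) (`sum_spray_mul`, `sum_thetaStar_mul`).
For a Hermitian metric G is quadratic in η and θ* is sesquilinear.

The main device is polarization. An identity polynomial in η̄ whose coefficients are holomorphic in
η persists when η̄ is replaced by an independent vector. Applied to the generalized Berwald
condition, after squaring away α and |β|, it shows that F and α have the same spray
(`IsRanders.spray_eq`) and that β satisfies a first order equation (`sprayDeriv_beta_mul`), by which
|β|² is constant along this spray. The spray of h then differs from that of a by ∂e(η)/(2e)·η, so
projective relatedness says that the two θ* differ by a multiple of η. Polarizing this relation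
shows that b♯ annihilates the torsion of a (`sharpTorsion_eq_zero`), that δ_q|β|² is an explicit
expression in ∂e and C (`horizDeriv_beta_sq_eq`), and that ∂e(b♯) = 0 (`dzReal_sharp`).

If ∂e = 0, then δ_q|β|² = 0 and F has the same θ* as α. Its projective spray is a polynomial of
bidegrees (2,0) and (1,1), and all third derivatives in question vanish.

Conversely, the second and third Douglas invariants are the first fibre derivatives of ∂̇_k̄ ∂̇_j D.
If they vanish, the trace-free part of θ* is polynomial along real lines η = w + t b♯. The equation
g·θ* = 2 conj(δL) expresses the component of θ* transversal to η through √(A + νt²) and |t|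
(`linForm_thetaStar_mul`). If ∂e(w) ≠ 0 with β(w) = 0, comparing the expansions at t = 0 would force
ν = 2 (`not_polynomial_randers`), which contradicts ν < 1. -/

noncomputable section
namespace ComplexFinsler

/-! ### Derivations on smooth functions of `(z, η)` -/

/-- Smoothness of a function of `(z, η)` on a set. -/
def SmoothOn {n : ℕ} (Ω : Set (Cn n × Cn n)) (f : Cn n → Cn n → ℂ) : Prop :=
  ContDiffOn ℝ ∞ (fun p : Cn n × Cn n => f p.1 p.2) Ω

/-- A complexified directional derivative. -/
def complexDeriv {E : Type*} [NormedAddCommGroup E] [NormedSpace ℝ E] (v v' : E) (s : ℂ)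
    (f : E → ℂ) (x : E) : ℂ :=
  (fderiv ℝ f x v + s * fderiv ℝ f x v') / 2

section ComplexDeriv

variable {E : Type*} [NormedAddCommGroup E] [NormedSpace ℝ E] {v v' w w' : E} {s t : ℂ}
  {f g : E → ℂ} {x : E} {Ω : Set E}

theorem complexDeriv_add (hf : DifferentiableAt ℝ f x) (hg : DifferentiableAt ℝ g x) :
    complexDeriv v v' s (fun y => f y + g y) x
      = complexDeriv v v' s f x + complexDeriv v v' s g x := by
  simp only [complexDeriv, fderiv_fun_add hf hg, add_apply]
  ring

theorem complexDeriv_mul (hf : DifferentiableAt ℝ f x) (hg : DifferentiableAt ℝ g x) :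
    complexDeriv v v' s (fun y => f y * g y) x
      = complexDeriv v v' s f x * g x + f x * complexDeriv v v' s g x := by
  simp only [complexDeriv, fderiv_fun_mul hf hg, add_apply,
    smul_apply, smul_eq_mul]
  ring

theorem complexDeriv_congr (h : f =ᶠ[nhds x] g) :
    complexDeriv v v' s f x = complexDeriv v v' s g x := by
  simp only [complexDeriv, h.fderiv_eq]

theorem contDiffOn_complexDeriv (hΩ : IsOpen Ω) (hf : ContDiffOn ℝ ∞ f Ω) :
    ContDiffOn ℝ ∞ (complexDeriv v v' s f) Ω := by
  have h := hf.fderiv_of_isOpen hΩ (m := ∞) (by simp)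
  have h1 : ∀ u : E, ContDiffOn ℝ ∞ (fun y => fderiv ℝ f y u) Ω :=
    fun u => h.clm_apply contDiffOn_const
  exact ((h1 v).add (contDiffOn_const.mul (h1 v'))).div_const 2

/-- Both sides are the same combination of values of the real second derivative, which is symmetric.
-/
theorem complexDeriv_comm (hf : ContDiffAt ℝ ∞ f x) :
    complexDeriv v v' s (complexDeriv w w' t f) x
      = complexDeriv w w' t (complexDeriv v v' s f) x := by
  have hd : DifferentiableAt ℝ (fderiv ℝ f) x :=
    (hf.fderiv_right (m := 1) (by norm_cast)).differentiableAt (by simp)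
  have hsymm : IsSymmSndFDerivAt ℝ f x := hf.isSymmSndFDerivAt (by simp; norm_cast)
  have key : ∀ (u u' : E) (r : ℂ) (y : E), fderiv ℝ (complexDeriv u u' r f) x y
      = (fderiv ℝ (fderiv ℝ f) x y u + r * fderiv ℝ (fderiv ℝ f) x y u') / 2 := by
    intro u u' r y
    have hu : ∀ u : E, HasFDerivAt (fun z => fderiv ℝ f z u)
        ((ContinuousLinearMap.apply ℝ ℂ u).comp (fderiv ℝ (fderiv ℝ f) x)) x := fun u =>
      (ContinuousLinearMap.apply ℝ ℂ u).hasFDerivAt.comp x hd.hasFDerivAt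
    have h2 := (((hu u).add ((hu u').const_mul r)).mul_const (2⁻¹ : ℂ)).fderiv
    have h3 : complexDeriv u u' r f
        = fun z => (((fun z => fderiv ℝ f z u) + fun z => r * fderiv ℝ f z u') z) * 2⁻¹ := by
      funext z; simp [complexDeriv, div_eq_mul_inv]
    rw [h3, h2]
    simp
    ring
  have e1 := hsymm v w
  have e2 := hsymm v w'
  have e3 := hsymm v' w
  have e4 := hsymm v' w'
  rw [complexDeriv, complexDeriv, key, key, key, key, e1, e2, e3, e4]
  ring

end ComplexDeriv

/-! ### Wirtinger operators in z and η as directional derivatives on the product space. -/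

section Slices

variable {n : ℕ} {Ω : Set (Cn n × Cn n)} {f g : Cn n → Cn n → ℂ} {z η : Cn n}

theorem SmoothOn.differentiableAt (hΩ : IsOpen Ω) (hf : SmoothOn Ω f) (hp : (z, η) ∈ Ω) :
    DifferentiableAt ℝ (fun p : Cn n × Cn n => f p.1 p.2) (z, η) :=
  ((hf.contDiffAt (hΩ.mem_nhds hp)).differentiableAt (by simp))

theorem fderiv_slice_fst (hf : DifferentiableAt ℝ (fun p : Cn n × Cn n => f p.1 p.2) (z, η))
    (v : Cn n) : fderiv ℝ (fun z' => f z' η) z v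
      = fderiv ℝ (fun p : Cn n × Cn n => f p.1 p.2) (z, η) (v, 0) := by
  have h1 : HasFDerivAt (fun z' : Cn n => (z', η)) (ContinuousLinearMap.inl ℝ (Cn n) (Cn n)) z :=
    hasFDerivAt_prodMk_left z η
  have h2 := (hf.hasFDerivAt (x := (z, η))).comp z h1
  have h3 : (fun z' => f z' η) = (fun p : Cn n × Cn n => f p.1 p.2) ∘ fun z' => (z', η) := rfl
  rw [h3, h2.fderiv]
  simp

theorem fderiv_slice_snd (hf : DifferentiableAt ℝ (fun p : Cn n × Cn n => f p.1 p.2) (z, η))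
    (v : Cn n) : fderiv ℝ (f z) η v
      = fderiv ℝ (fun p : Cn n × Cn n => f p.1 p.2) (z, η) (0, v) := by
  have h1 : HasFDerivAt (fun η' : Cn n => (z, η')) (ContinuousLinearMap.inr ℝ (Cn n) (Cn n)) η :=
    hasFDerivAt_prodMk_right z η
  have h2 := (hf.hasFDerivAt (x := (z, η))).comp η h1
  have h3 : f z = (fun p : Cn n × Cn n => f p.1 p.2) ∘ fun η' => (z, η') := rfl
  rw [h3, h2.fderiv]
  simp

/-- An operator on functions of `(z, η)` that is a complexified directional derivative on
functions which are smooth on `Ω`. -/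
def IsDirectional (Ω : Set (Cn n × Cn n)) (X : (Cn n → Cn n → ℂ) → Cn n → Cn n → ℂ) : Prop :=
  (∃ v v' : Cn n × Cn n, ∃ s : ℂ, ∀ f, ∀ z η, (z, η) ∈ Ω →
    DifferentiableAt ℝ (fun p : Cn n × Cn n => f p.1 p.2) (z, η) →
    X f z η = complexDeriv v v' s (fun p : Cn n × Cn n => f p.1 p.2) (z, η)) ∧
  ∀ f g, ∀ z η, (z, η) ∈ Ω → (fun p : Cn n × Cn n => f p.1 p.2) =ᶠ[nhds (z, η)]
    (fun p : Cn n × Cn n => g p.1 p.2) → X f z η = X g z η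

theorem isDirectional_dz (Ω : Set (Cn n × Cn n)) (k : Fin n) : IsDirectional Ω (dz k) := by
  refine ⟨⟨(Pi.single k 1, 0), (Pi.single k Complex.I, 0), -Complex.I, ?_⟩, ?_⟩
  · intro f z η _ hf
    simp only [dz, wirtinger, complexDeriv, fderiv_slice_fst hf]
    ring
  · intro f g z η _ h
    have hc : Filter.Tendsto (fun z' : Cn n => (z', η)) (nhds z) (nhds (z, η)) :=
      (Continuous.prodMk_left η).tendsto z
    have h' : (fun z' => f z' η) =ᶠ[nhds z] (fun z' => g z' η) := hc.eventually h
    simp only [dz, wirtinger, h'.fderiv_eq]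

theorem isDirectional_dEta (Ω : Set (Cn n × Cn n)) (k : Fin n) : IsDirectional Ω (dEta k) := by
  refine ⟨⟨(0, Pi.single k 1), (0, Pi.single k Complex.I), -Complex.I, ?_⟩, ?_⟩
  · intro f z η _ hf
    simp only [dEta, wirtinger, complexDeriv, fderiv_slice_snd hf]
    ring
  · intro f g z η _ h
    have hc : Filter.Tendsto (fun η' : Cn n => (z, η')) (nhds η) (nhds (z, η)) :=
      (Continuous.prodMk_right z).tendsto η
    have h' : f z =ᶠ[nhds η] g z := hc.eventually h
    simp only [dEta, wirtinger, h'.fderiv_eq]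

theorem isDirectional_dEtaBar (Ω : Set (Cn n × Cn n)) (k : Fin n) :
    IsDirectional Ω (dEtaBar k) := by
  refine ⟨⟨(0, Pi.single k 1), (0, Pi.single k Complex.I), Complex.I, ?_⟩, ?_⟩
  · intro f z η _ hf
    simp only [dEtaBar, wirtingerBar, complexDeriv, fderiv_slice_snd hf]
  · intro f g z η _ h
    have hc : Filter.Tendsto (fun η' : Cn n => (z, η')) (nhds η) (nhds (z, η)) :=
      (Continuous.prodMk_right z).tendsto η
    have h' : f z =ᶠ[nhds η] g z := hc.eventually h
    simp only [dEtaBar, wirtingerBar, h'.fderiv_eq]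

variable {X Y : (Cn n → Cn n → ℂ) → Cn n → Cn n → ℂ}

theorem IsDirectional.congr (hX : IsDirectional Ω X) (hΩ : IsOpen Ω)
    (h : ∀ z η, (z, η) ∈ Ω → f z η = g z η) (hp : (z, η) ∈ Ω) : X f z η = X g z η :=
  hX.2 f g z η hp (Filter.eventuallyEq_of_mem (hΩ.mem_nhds hp) fun p hp => h p.1 p.2 hp)

theorem SmoothOn.congr (hf : SmoothOn Ω f) (h : ∀ z η, (z, η) ∈ Ω → g z η = f z η) :
    SmoothOn Ω g :=
  ContDiffOn.congr hf fun p hp => h p.1 p.2 hp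

theorem IsDirectional.smoothOn (hX : IsDirectional Ω X) (hΩ : IsOpen Ω) (hf : SmoothOn Ω f) :
    SmoothOn Ω (X f) := by
  obtain ⟨⟨v, v', s, h⟩, -⟩ := hX
  exact ContDiffOn.congr (contDiffOn_complexDeriv (v := v) (v' := v') (s := s) hΩ hf)
    fun p hp => h f p.1 p.2 hp (hf.differentiableAt hΩ hp)

theorem IsDirectional.comm (hX : IsDirectional Ω X) (hY : IsDirectional Ω Y) (hΩ : IsOpen Ω)
    (hf : SmoothOn Ω f) (hp : (z, η) ∈ Ω) : X (Y f) z η = Y (X f) z η := by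
  have hXf := hX.smoothOn hΩ hf
  have hYf := hY.smoothOn hΩ hf
  obtain ⟨⟨v, v', s, h⟩, -⟩ := hX
  obtain ⟨⟨w, w', t, k⟩, -⟩ := hY
  rw [h _ z η hp (hYf.differentiableAt hΩ hp), k _ z η hp (hXf.differentiableAt hΩ hp)]
  have e1 : (fun p : Cn n × Cn n => Y f p.1 p.2) =ᶠ[nhds (z, η)]
      complexDeriv w w' t (fun p : Cn n × Cn n => f p.1 p.2) :=
    Filter.eventuallyEq_of_mem (hΩ.mem_nhds hp) fun p hp =>
      k f p.1 p.2 hp (hf.differentiableAt hΩ hp)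
  have e2 : (fun p : Cn n × Cn n => X f p.1 p.2) =ᶠ[nhds (z, η)]
      complexDeriv v v' s (fun p : Cn n × Cn n => f p.1 p.2) :=
    Filter.eventuallyEq_of_mem (hΩ.mem_nhds hp) fun p hp =>
      h f p.1 p.2 hp (hf.differentiableAt hΩ hp)
  rw [complexDeriv_congr e1, complexDeriv_congr e2,
    complexDeriv_comm (ContDiffOn.contDiffAt hf (hΩ.mem_nhds hp))]

/-- A derivation at `(z, η)` on functions which are smooth on `Ω`. -/
structure IsDerivationAt (Ω : Set (Cn n × Cn n)) (z η : Cn n)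
    (X : (Cn n → Cn n → ℂ) → ℂ) : Prop where
  add : ∀ {f g}, SmoothOn Ω f → SmoothOn Ω g → X (fun z η => f z η + g z η) = X f + X g
  mul : ∀ {f g}, SmoothOn Ω f → SmoothOn Ω g →
    X (fun z η => f z η * g z η) = X f * g z η + f z η * X g
  const : ∀ c : ℂ, X (fun _ _ => c) = 0
  congr : ∀ {f g}, (∀ z η, (z, η) ∈ Ω → f z η = g z η) → X f = X g

theorem IsDirectional.derivationAt (hX : IsDirectional Ω X) (hΩ : IsOpen Ω) (hp : (z, η) ∈ Ω) :
    IsDerivationAt Ω z η (fun f => X f z η) := by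
  have hc := fun {f g} => hX.congr (f := f) (g := g) (z := z) (η := η) hΩ
  obtain ⟨⟨v, v', s, h⟩, -⟩ := hX
  refine ⟨?_, ?_, ?_, fun h => hc h hp⟩
  · intro f g hf hg
    have hf' := hf.differentiableAt hΩ hp
    have hg' := hg.differentiableAt hΩ hp
    rw [h _ z η hp (hf'.add hg'), h _ z η hp hf', h _ z η hp hg']
    exact complexDeriv_add hf' hg'
  · intro f g hf hg
    have hf' := hf.differentiableAt hΩ hp
    have hg' := hg.differentiableAt hΩ hp
    rw [h _ z η hp (hf'.mul hg'), h _ z η hp hf', h _ z η hp hg']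
    exact complexDeriv_mul hf' hg'
  · intro c
    rw [h _ z η hp (by fun_prop)]
    simp [complexDeriv]

namespace SmoothOn

theorem const (c : ℂ) : SmoothOn Ω (fun _ _ => c) := contDiffOn_const

theorem add (hf : SmoothOn Ω f) (hg : SmoothOn Ω g) : SmoothOn Ω (fun z η => f z η + g z η) :=
  ContDiffOn.add hf hg

theorem sub (hf : SmoothOn Ω f) (hg : SmoothOn Ω g) : SmoothOn Ω (fun z η => f z η - g z η) :=
  ContDiffOn.sub hf hg

theorem mul (hf : SmoothOn Ω f) (hg : SmoothOn Ω g) : SmoothOn Ω (fun z η => f z η * g z η) :=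
  ContDiffOn.mul hf hg

theorem div_const (hf : SmoothOn Ω f) (c : ℂ) : SmoothOn Ω (fun z η => f z η / c) :=
  ContDiffOn.div_const hf c

theorem inv (hf : SmoothOn Ω f) (h0 : ∀ z η, (z, η) ∈ Ω → f z η ≠ 0) :
    SmoothOn Ω (fun z η => (f z η)⁻¹) :=
  ContDiffOn.inv hf fun p hp => h0 p.1 p.2 hp

theorem sum {ι : Type*} {s : Finset ι} {F : ι → Cn n → Cn n → ℂ}
    (hF : ∀ i ∈ s, SmoothOn Ω (F i)) : SmoothOn Ω (fun z η => ∑ i ∈ s, F i z η) :=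
  ContDiffOn.sum hF

theorem prod {ι : Type*} {s : Finset ι} {F : ι → Cn n → Cn n → ℂ}
    (hF : ∀ i ∈ s, SmoothOn Ω (F i)) : SmoothOn Ω (fun z η => ∏ i ∈ s, F i z η) :=
  contDiffOn_prod hF

theorem conjugate (hf : SmoothOn Ω f) : SmoothOn Ω (fun z η => conj (f z η)) :=
  Complex.conjCLE.contDiff.comp_contDiffOn hf

theorem coord (i : Fin n) : SmoothOn Ω (fun _ η => η i) := by
  unfold SmoothOn; fun_prop

theorem base {U : Set (Cn n)} {c : Cn n → ℂ} (hc : ContDiffOn ℝ ∞ c U)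
    (hU : ∀ z η, (z, η) ∈ Ω → z ∈ U) : SmoothOn Ω (fun z _ => c z) :=
  hc.comp contDiffOn_fst fun p hp => hU p.1 p.2 hp

theorem dz (hΩ : IsOpen Ω) (hf : SmoothOn Ω f) (k : Fin n) : SmoothOn Ω (dz k f) :=
  (isDirectional_dz Ω k).smoothOn hΩ hf

theorem dEta (hΩ : IsOpen Ω) (hf : SmoothOn Ω f) (k : Fin n) : SmoothOn Ω (dEta k f) :=
  (isDirectional_dEta Ω k).smoothOn hΩ hf

theorem dEtaBar (hΩ : IsOpen Ω) (hf : SmoothOn Ω f) (k : Fin n) : SmoothOn Ω (dEtaBar k f) :=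
  (isDirectional_dEtaBar Ω k).smoothOn hΩ hf

/-- The entries of the inverse of a smooth invertible matrix function are smooth. -/
theorem matrix_inv {G : Cn n → Cn n → Matrix (Fin n) (Fin n) ℂ}
    (hG : ∀ i j, SmoothOn Ω (fun z η => G z η i j))
    (h0 : ∀ z η, (z, η) ∈ Ω → (G z η).det ≠ 0) (i j : Fin n) :
    SmoothOn Ω (fun z η => (G z η)⁻¹ i j) := by
  have hdet : ∀ G' : Cn n → Cn n → Matrix (Fin n) (Fin n) ℂ,
      (∀ i j, SmoothOn Ω (fun z η => G' z η i j)) → SmoothOn Ω (fun z η => (G' z η).det) := by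
    intro G' hG'
    simp only [Matrix.det_apply']
    exact SmoothOn.sum fun σ _ => (SmoothOn.const _).mul (SmoothOn.prod fun i _ => hG' _ _)
  have hadj : SmoothOn Ω (fun z η => (G z η).adjugate i j) := by
    simp only [Matrix.adjugate_apply]
    refine hdet _ fun k l => ?_
    by_cases hk : k = j
    · subst hk; simp only [Matrix.updateRow_self]; exact SmoothOn.const _
    · simp only [Matrix.updateRow_ne hk]; exact hG k l
  refine (((hdet G hG).inv h0).mul hadj).congr fun z η _ => ?_
  rw [Matrix.inv_def, Matrix.smul_apply, Ring.inverse_eq_inv', smul_eq_mul]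

end SmoothOn

namespace IsDerivationAt

variable {D D' : (Cn n → Cn n → ℂ) → ℂ}

theorem dz (hΩ : IsOpen Ω) (hp : (z, η) ∈ Ω) (k : Fin n) :
    IsDerivationAt Ω z η (fun f => dz k f z η) := (isDirectional_dz Ω k).derivationAt hΩ hp

theorem dEta (hΩ : IsOpen Ω) (hp : (z, η) ∈ Ω) (k : Fin n) :
    IsDerivationAt Ω z η (fun f => dEta k f z η) := (isDirectional_dEta Ω k).derivationAt hΩ hp

theorem dEtaBar (hΩ : IsOpen Ω) (hp : (z, η) ∈ Ω) (k : Fin n) :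
    IsDerivationAt Ω z η (fun f => dEtaBar k f z η) :=
  (isDirectional_dEtaBar Ω k).derivationAt hΩ hp

theorem sum (hD : IsDerivationAt Ω z η D) {ι : Type*} {s : Finset ι} {F : ι → Cn n → Cn n → ℂ}
    (hF : ∀ i ∈ s, SmoothOn Ω (F i)) :
    D (fun z η => ∑ i ∈ s, F i z η) = ∑ i ∈ s, D (F i) := by
  classical
  induction s using Finset.induction_on with
  | empty => simpa using hD.const 0
  | insert i s hi ih =>
    simp only [Finset.sum_insert hi]
    rw [hD.add (hF i (by simp)) (SmoothOn.sum fun j hj => hF j (by simp [hj])),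
      ih fun j hj => hF j (by simp [hj])]

theorem const_mul (hD : IsDerivationAt Ω z η D) (c : ℂ) (hf : SmoothOn Ω f) :
    D (fun z η => c * f z η) = c * D f := by
  rw [hD.mul (SmoothOn.const c) hf, hD.const]; ring

theorem sub (hD : IsDerivationAt Ω z η D) (hf : SmoothOn Ω f) (hg : SmoothOn Ω g) :
    D (fun z η => f z η - g z η) = D f - D g := by
  have h := hD.add hf ((SmoothOn.const (-1)).mul hg)
  rw [hD.const_mul _ hg] at h
  rw [hD.congr (g := fun z η => f z η + -1 * g z η) fun z η _ => by ring, h]; ring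

theorem div_const (hD : IsDerivationAt Ω z η D) (c : ℂ) (hf : SmoothOn Ω f) :
    D (fun z η => f z η / c) = D f / c := by
  rw [hD.congr (g := fun z η => c⁻¹ * f z η) fun z η _ => by ring, hD.const_mul _ hf]; ring

theorem smul (hD : IsDerivationAt Ω z η D) (c : ℂ) : IsDerivationAt Ω z η (fun f => c * D f) where
  add hf hg := by rw [hD.add hf hg]; ring
  mul hf hg := by rw [hD.mul hf hg]; ring
  const c' := by rw [hD.const]; ring
  congr h := by rw [hD.congr h]

theorem sub' (hD : IsDerivationAt Ω z η D) (hD' : IsDerivationAt Ω z η D') :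
    IsDerivationAt Ω z η (fun f => D f - D' f) where
  add hf hg := by rw [hD.add hf hg, hD'.add hf hg]; ring
  mul hf hg := by rw [hD.mul hf hg, hD'.mul hf hg]; ring
  const c' := by rw [hD.const, hD'.const]; ring
  congr h := by rw [hD.congr h, hD'.congr h]

theorem linComb {ι : Type*} [Fintype ι] {D : ι → (Cn n → Cn n → ℂ) → ℂ}
    (hD : ∀ i, IsDerivationAt Ω z η (D i)) (c : ι → ℂ) :
    IsDerivationAt Ω z η (fun f => ∑ i, c i * D i f) where
  add hf hg := by
    rw [← Finset.sum_add_distrib]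
    exact Finset.sum_congr rfl fun i _ => by rw [(hD i).add hf hg]; ring
  mul hf hg := by
    rw [Finset.sum_mul, Finset.mul_sum, ← Finset.sum_add_distrib]
    exact Finset.sum_congr rfl fun i _ => by rw [(hD i).mul hf hg]; ring
  const c' := Finset.sum_eq_zero fun i _ => by rw [(hD i).const]; ring
  congr h := Finset.sum_congr rfl fun i _ => by rw [(hD i).congr h]

end IsDerivationAt

/-! ### Derivatives of coordinates, of functions of `z`, and of conjugates -/

theorem dEta_coord (k j : Fin n) (z η : Cn n) :
    dEta k (fun _ η => η j) z η = if k = j then 1 else 0 := by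
  have h : fderiv ℝ (fun η : Cn n => η j) η
      = ContinuousLinearMap.proj (R := ℝ) (φ := fun _ : Fin n => ℂ) j :=
    (ContinuousLinearMap.proj (R := ℝ) (φ := fun _ : Fin n => ℂ) j).fderiv
  simp only [dEta, wirtinger, h, ContinuousLinearMap.proj_apply, Pi.single_apply]
  by_cases hkj : k = j
  · subst hkj; simp
  · simp [hkj, Ne.symm hkj]

theorem dEtaBar_coord (k j : Fin n) (z η : Cn n) : dEtaBar k (fun _ η => η j) z η = 0 := by
  have h : fderiv ℝ (fun η : Cn n => η j) η
      = ContinuousLinearMap.proj (R := ℝ) (φ := fun _ : Fin n => ℂ) j :=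
    (ContinuousLinearMap.proj (R := ℝ) (φ := fun _ : Fin n => ℂ) j).fderiv
  simp only [dEtaBar, wirtingerBar, h, ContinuousLinearMap.proj_apply, Pi.single_apply]
  by_cases hkj : k = j
  · subst hkj; simp
  · simp [Ne.symm hkj]

theorem dEta_conj (hf : DifferentiableAt ℝ (f z) η) (k : Fin n) :
    dEta k (fun z η => conj (f z η)) z η = conj (dEtaBar k f z η) := by
  have h : HasFDerivAt (fun η => conj (f z η))
      ((Complex.conjCLE : ℂ →L[ℝ] ℂ).comp (fderiv ℝ (f z) η)) η :=
    Complex.conjCLE.hasFDerivAt.comp η hf.hasFDerivAt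
  simp only [dEta, dEtaBar, wirtinger, wirtingerBar, h.fderiv, map_div₀, map_ofNat]
  simp
  ring

theorem dEtaBar_conj (hf : DifferentiableAt ℝ (f z) η) (k : Fin n) :
    dEtaBar k (fun z η => conj (f z η)) z η = conj (dEta k f z η) := by
  have h : HasFDerivAt (fun η => conj (f z η))
      ((Complex.conjCLE : ℂ →L[ℝ] ℂ).comp (fderiv ℝ (f z) η)) η :=
    Complex.conjCLE.hasFDerivAt.comp η hf.hasFDerivAt
  simp only [dEta, dEtaBar, wirtinger, wirtingerBar, h.fderiv, map_div₀, map_ofNat]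
  simp

theorem dEta_conj_coord (k j : Fin n) (z η : Cn n) :
    dEta k (fun _ η => conj (η j)) z η = 0 := by
  rw [dEta_conj (f := fun _ η => η j) (by fun_prop), dEtaBar_coord, map_zero]

theorem dEtaBar_conj_coord (k j : Fin n) (z η : Cn n) :
    dEtaBar k (fun _ η => conj (η j)) z η = if k = j then 1 else 0 := by
  rw [dEtaBar_conj (f := fun _ η => η j) (by fun_prop), dEta_coord]
  split_ifs <;> simp

theorem dz_base (c : Cn n → ℂ) (k : Fin n) (z η : Cn n) :
    dz k (fun z _ => c z) z η = wirtinger k c z := rfl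

theorem dEta_base (c : Cn n → ℂ) (k : Fin n) (z η : Cn n) : dEta k (fun z _ => c z) z η = 0 := by
  simp [dEta, wirtinger]

theorem dEtaBar_base (c : Cn n → ℂ) (k : Fin n) (z η : Cn n) :
    dEtaBar k (fun z _ => c z) z η = 0 := by
  simp [dEtaBar, wirtingerBar]

theorem dz_coord (k j : Fin n) (z η : Cn n) : dz k (fun _ η => η j) z η = 0 := by
  simp [dz, wirtinger]

theorem dz_conj_coord (k j : Fin n) (z η : Cn n) : dz k (fun _ η => conj (η j)) z η = 0 := by
  simp [dz, wirtinger]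

theorem SmoothOn.differentiableAt_snd (hΩ : IsOpen Ω) (hf : SmoothOn Ω f) (hp : (z, η) ∈ Ω) :
    DifferentiableAt ℝ (f z) η := by
  have h := hf.differentiableAt hΩ hp
  have h1 : DifferentiableAt ℝ (fun η' : Cn n => (z, η')) η := by fun_prop
  exact h.comp η h1

end Slices


/-! ### Infinitesimal homogeneity in η and in η̄. -/

section Euler

variable {n : ℕ} {Ω : Set (Cn n × Cn n)} {f g : Cn n → Cn n → ℂ} {z η : Cn n}

theorem IsDerivationAt.sum_mul {D : (Cn n → Cn n → ℂ) → ℂ} (hD : IsDerivationAt Ω z η D)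
    {ι : Type*} [Fintype ι] {F G : ι → Cn n → Cn n → ℂ} (hF : ∀ i, SmoothOn Ω (F i))
    (hG : ∀ i, SmoothOn Ω (G i)) :
    D (fun z η => ∑ i, F i z η * G i z η) = ∑ i, (D (F i) * G i z η + F i z η * D (G i)) := by
  rw [hD.sum (F := fun i z η => F i z η * G i z η) fun i _ => (hF i).mul (hG i)]
  exact Finset.sum_congr rfl fun i _ => hD.mul (hF i) (hG i)

/-- `f` is homogeneous of degree `c` in `η`, infinitesimally. -/
def EulerOn (Ω : Set (Cn n × Cn n)) (c : ℂ) (f : Cn n → Cn n → ℂ) : Prop :=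
  ∀ z η, (z, η) ∈ Ω → ∑ k, η k * dEta k f z η = c * f z η

/-- `f` is homogeneous of degree `c` in `η̄`, infinitesimally. -/
def EulerBarOn (Ω : Set (Cn n × Cn n)) (c : ℂ) (f : Cn n → Cn n → ℂ) : Prop :=
  ∀ z η, (z, η) ∈ Ω → ∑ k, conj (η k) * dEtaBar k f z η = c * f z η

theorem euler_derivation (hΩ : IsOpen Ω) (hp : (z, η) ∈ Ω) :
    IsDerivationAt Ω z η (fun f => ∑ k, η k * dEta k f z η) :=
  IsDerivationAt.linComb (fun k => IsDerivationAt.dEta hΩ hp k) _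

theorem eulerBar_derivation (hΩ : IsOpen Ω) (hp : (z, η) ∈ Ω) :
    IsDerivationAt Ω z η (fun f => ∑ k, conj (η k) * dEtaBar k f z η) :=
  IsDerivationAt.linComb (fun k => IsDerivationAt.dEtaBar hΩ hp k) _

/-- Differentiating Euler's identity, the coefficient ηᵏ contributes one extra copy of the
derivative, so the degree drops by one. For ∂̇_k̄ and ∂_k the coefficient has zero derivative and
the degree is unchanged. -/
theorem EulerOn.dEta (hΩ : IsOpen Ω) (hf : SmoothOn Ω f) {c : ℂ} (h : EulerOn Ω c f) (j : Fin n) :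
    EulerOn Ω (c - 1) (dEta j f) := by
  intro z η hp
  have hD := IsDerivationAt.dEta hΩ hp j
  have e := hD.congr (f := fun z η => ∑ k, η k * ComplexFinsler.dEta k f z η)
    (g := fun z η => c * f z η) h
  rw [hD.sum_mul (F := fun k _ η => η k) (fun k => SmoothOn.coord k) (fun k => hf.dEta hΩ k),
    hD.const_mul _ hf, Finset.sum_add_distrib] at e
  simp only [dEta_coord, ite_mul, one_mul, zero_mul, Finset.sum_ite_eq, Finset.mem_univ,
    if_true] at e
  rw [sub_mul, one_mul, ← e, add_sub_cancel_left]
  exact Finset.sum_congr rfl fun k _ => by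
    rw [(isDirectional_dEta Ω k).comm (isDirectional_dEta Ω j) hΩ hf hp]

theorem EulerOn.dEtaBar (hΩ : IsOpen Ω) (hf : SmoothOn Ω f) {c : ℂ} (h : EulerOn Ω c f)
    (j : Fin n) : EulerOn Ω c (dEtaBar j f) := by
  intro z η hp
  have hD := IsDerivationAt.dEtaBar hΩ hp j
  have e := hD.congr (f := fun z η => ∑ k, η k * ComplexFinsler.dEta k f z η)
    (g := fun z η => c * f z η) h
  rw [hD.sum_mul (F := fun k _ η => η k) (fun k => SmoothOn.coord k) (fun k => hf.dEta hΩ k),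
    hD.const_mul _ hf] at e
  simp only [dEtaBar_coord, zero_mul, zero_add] at e
  rw [← e]
  exact Finset.sum_congr rfl fun k _ => by
    rw [(isDirectional_dEta Ω k).comm (isDirectional_dEtaBar Ω j) hΩ hf hp]

theorem EulerOn.dz (hΩ : IsOpen Ω) (hf : SmoothOn Ω f) {c : ℂ} (h : EulerOn Ω c f)
    (j : Fin n) : EulerOn Ω c (dz j f) := by
  intro z η hp
  have hD := IsDerivationAt.dz hΩ hp j
  have e := hD.congr (f := fun z η => ∑ k, η k * ComplexFinsler.dEta k f z η)
    (g := fun z η => c * f z η) h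
  rw [hD.sum_mul (F := fun k _ η => η k) (fun k => SmoothOn.coord k) (fun k => hf.dEta hΩ k),
    hD.const_mul _ hf] at e
  simp only [dz_coord, zero_mul, zero_add] at e
  rw [← e]
  exact Finset.sum_congr rfl fun k _ => by
    rw [(isDirectional_dEta Ω k).comm (isDirectional_dz Ω j) hΩ hf hp]

theorem EulerBarOn.dEta (hΩ : IsOpen Ω) (hf : SmoothOn Ω f) {c : ℂ} (h : EulerBarOn Ω c f)
    (j : Fin n) : EulerBarOn Ω c (dEta j f) := by
  intro z η hp
  have hD := IsDerivationAt.dEta hΩ hp j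
  have e := hD.congr (f := fun z η => ∑ k, conj (η k) * ComplexFinsler.dEtaBar k f z η)
    (g := fun z η => c * f z η) h
  rw [hD.sum_mul (F := fun k _ η => conj (η k)) (fun k => (SmoothOn.coord k).conjugate)
    (fun k => hf.dEtaBar hΩ k), hD.const_mul _ hf] at e
  simp only [dEta_conj_coord, zero_mul, zero_add] at e
  rw [← e]
  exact Finset.sum_congr rfl fun k _ => by
    rw [(isDirectional_dEtaBar Ω k).comm (isDirectional_dEta Ω j) hΩ hf hp]

theorem EulerBarOn.dz (hΩ : IsOpen Ω) (hf : SmoothOn Ω f) {c : ℂ} (h : EulerBarOn Ω c f)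
    (j : Fin n) : EulerBarOn Ω c (dz j f) := by
  intro z η hp
  have hD := IsDerivationAt.dz hΩ hp j
  have e := hD.congr (f := fun z η => ∑ k, conj (η k) * ComplexFinsler.dEtaBar k f z η)
    (g := fun z η => c * f z η) h
  rw [hD.sum_mul (F := fun k _ η => conj (η k)) (fun k => (SmoothOn.coord k).conjugate)
    (fun k => hf.dEtaBar hΩ k), hD.const_mul _ hf] at e
  simp only [dz_conj_coord, zero_mul, zero_add] at e
  rw [← e]
  exact Finset.sum_congr rfl fun k _ => by
    rw [(isDirectional_dEtaBar Ω k).comm (isDirectional_dz Ω j) hΩ hf hp]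

theorem EulerOn.conjugate (hΩ : IsOpen Ω) (hf : SmoothOn Ω f) {c : ℂ} (h : EulerOn Ω c f) :
    EulerBarOn Ω (conj c) (fun z η => conj (f z η)) := by
  intro z η hp
  rw [← map_mul, ← h z η hp, map_sum]
  exact Finset.sum_congr rfl fun k _ => by
    rw [dEtaBar_conj (hf.differentiableAt_snd hΩ hp), map_mul]

theorem EulerBarOn.conjugate (hΩ : IsOpen Ω) (hf : SmoothOn Ω f) {c : ℂ} (h : EulerBarOn Ω c f) :
    EulerOn Ω (conj c) (fun z η => conj (f z η)) := by
  intro z η hp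
  rw [← map_mul, ← h z η hp, map_sum]
  exact Finset.sum_congr rfl fun k _ => by
    rw [dEta_conj (hf.differentiableAt_snd hΩ hp), map_mul, Complex.conj_conj]

theorem EulerOn.congr (hΩ : IsOpen Ω) {c : ℂ} (h : EulerOn Ω c f)
    (hfg : ∀ z η, (z, η) ∈ Ω → g z η = f z η) : EulerOn Ω c g := by
  intro z η hp
  rw [(euler_derivation hΩ hp).congr hfg, h z η hp, hfg z η hp]

theorem EulerBarOn.congr (hΩ : IsOpen Ω) {c : ℂ} (h : EulerBarOn Ω c f)
    (hfg : ∀ z η, (z, η) ∈ Ω → g z η = f z η) : EulerBarOn Ω c g := by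
  intro z η hp
  rw [(eulerBar_derivation hΩ hp).congr hfg, h z η hp, hfg z η hp]

theorem EulerOn.mul (hΩ : IsOpen Ω) (hf : SmoothOn Ω f) (hg : SmoothOn Ω g) {c d : ℂ}
    (h : EulerOn Ω c f) (k : EulerOn Ω d g) : EulerOn Ω (c + d) (fun z η => f z η * g z η) := by
  intro z η hp
  rw [(euler_derivation hΩ hp).mul hf hg, h z η hp, k z η hp]; ring

theorem EulerBarOn.mul (hΩ : IsOpen Ω) (hf : SmoothOn Ω f) (hg : SmoothOn Ω g) {c d : ℂ}
    (h : EulerBarOn Ω c f) (k : EulerBarOn Ω d g) :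
    EulerBarOn Ω (c + d) (fun z η => f z η * g z η) := by
  intro z η hp
  rw [(eulerBar_derivation hΩ hp).mul hf hg, h z η hp, k z η hp]; ring

theorem EulerOn.sub (hΩ : IsOpen Ω) (hf : SmoothOn Ω f) (hg : SmoothOn Ω g) {c : ℂ}
    (h : EulerOn Ω c f) (k : EulerOn Ω c g) : EulerOn Ω c (fun z η => f z η - g z η) := by
  intro z η hp
  rw [(euler_derivation hΩ hp).sub hf hg, h z η hp, k z η hp]; ring

theorem EulerBarOn.sub (hΩ : IsOpen Ω) (hf : SmoothOn Ω f) (hg : SmoothOn Ω g) {c : ℂ}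
    (h : EulerBarOn Ω c f) (k : EulerBarOn Ω c g) : EulerBarOn Ω c (fun z η => f z η - g z η) := by
  intro z η hp
  rw [(eulerBar_derivation hΩ hp).sub hf hg, h z η hp, k z η hp]; ring

theorem EulerOn.sum (hΩ : IsOpen Ω) {ι : Type*} {s : Finset ι} {F : ι → Cn n → Cn n → ℂ} {c : ℂ}
    (hF : ∀ i ∈ s, SmoothOn Ω (F i)) (h : ∀ i ∈ s, EulerOn Ω c (F i)) :
    EulerOn Ω c (fun z η => ∑ i ∈ s, F i z η) := by
  intro z η hp
  rw [(euler_derivation hΩ hp).sum hF, Finset.mul_sum]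
  exact Finset.sum_congr rfl fun i hi => h i hi z η hp

theorem EulerBarOn.sum (hΩ : IsOpen Ω) {ι : Type*} {s : Finset ι} {F : ι → Cn n → Cn n → ℂ}
    {c : ℂ} (hF : ∀ i ∈ s, SmoothOn Ω (F i)) (h : ∀ i ∈ s, EulerBarOn Ω c (F i)) :
    EulerBarOn Ω c (fun z η => ∑ i ∈ s, F i z η) := by
  intro z η hp
  rw [(eulerBar_derivation hΩ hp).sum hF, Finset.mul_sum]
  exact Finset.sum_congr rfl fun i hi => h i hi z η hp

theorem eulerOn_coord (i : Fin n) : EulerOn Ω 1 (fun _ η => η i) := by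
  intro z η _
  simp [dEta_coord]

theorem eulerBarOn_coord (i : Fin n) : EulerBarOn Ω 0 (fun _ η => η i) := by
  intro z η _
  simp [dEtaBar_coord]

end Euler

/-! ### Metrics which are smooth and nondegenerate on an open set -/

/-- The square of a metric, as a complex valued function. -/
def sqMetric {n : ℕ} (Φ : Cn n → Cn n → ℝ) (z η : Cn n) : ℂ := ((Φ z η ^ 2 : ℝ) : ℂ)

/-- `Φ` is a smooth nondegenerate complex Finsler metric on the open set `Ω`. -/
structure IsMetricOn {n : ℕ} (Ω : Set (Cn n × Cn n)) (Φ : Cn n → Cn n → ℝ) : Prop where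
  isOpen : IsOpen Ω
  smooth : SmoothOn Ω (sqMetric Φ)
  euler : EulerOn Ω 1 (sqMetric Φ)
  det_ne : ∀ z η, (z, η) ∈ Ω → (fundTensor Φ z η).det ≠ 0

namespace IsMetricOn

variable {n : ℕ} {Ω : Set (Cn n × Cn n)} {Φ : Cn n → Cn n → ℝ} {z η : Cn n}

theorem eulerBar (h : IsMetricOn Ω Φ) : EulerBarOn Ω 1 (sqMetric Φ) := by
  have := (h.euler.conjugate h.isOpen h.smooth).congr h.isOpen (g := sqMetric Φ)
    fun z η _ => by simp [sqMetric]
  simpa using this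

theorem dEtaBar_eq (h : IsMetricOn Ω Φ) (hp : (z, η) ∈ Ω) (k : Fin n) :
    dEtaBar k (sqMetric Φ) z η = conj (dEta k (sqMetric Φ) z η) := by
  rw [← dEtaBar_conj (h.smooth.differentiableAt_snd h.isOpen hp)]
  congr 1
  funext z η
  simp [sqMetric]

theorem smooth_fundTensor (h : IsMetricOn Ω Φ) (i j : Fin n) :
    SmoothOn Ω (fun z η => fundTensor Φ z η i j) :=
  (h.smooth.dEtaBar h.isOpen j).dEta h.isOpen i

theorem smooth_fundTensorInv (h : IsMetricOn Ω Φ) (i j : Fin n) :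
    SmoothOn Ω (fun z η => fundTensorInv Φ z η i j) :=
  SmoothOn.matrix_inv h.smooth_fundTensor h.det_ne i j

theorem smooth_connN (h : IsMetricOn Ω Φ) (i j : Fin n) : SmoothOn Ω (connN Φ i j) :=
  SmoothOn.sum fun _ _ => SmoothOn.sum fun _ _ => ((h.smooth_fundTensorInv _ _).mul
    ((h.smooth_fundTensor _ _).dz h.isOpen _)).mul (SmoothOn.coord _)

theorem smooth_spray (h : IsMetricOn Ω Φ) (i : Fin n) : SmoothOn Ω (spray Φ i) :=
  (SmoothOn.sum fun _ _ => (h.smooth_connN _ _).mul (SmoothOn.coord _)).div_const 2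

theorem smooth_thetaStar (h : IsMetricOn Ω Φ) (k : Fin n) : SmoothOn Ω (thetaStar Φ k) :=
  SmoothOn.sum fun _ _ => SmoothOn.sum fun _ _ => SmoothOn.sum fun _ _ => SmoothOn.sum fun _ _ =>
    ((((h.smooth_fundTensorInv _ _).mul (h.smooth_fundTensor _ _)).mul
      (((h.smooth_connN _ _).dEta h.isOpen _).sub
        ((h.smooth_connN _ _).dEta h.isOpen _)).conjugate).mul
      (SmoothOn.coord _)).mul (SmoothOn.coord _).conjugate

theorem smooth_projSpray (h : IsMetricOn Ω Φ) (i : Fin n) : SmoothOn Ω (projSpray Φ i) :=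
  ((h.smooth_spray i).sub (((SmoothOn.sum fun m _ =>
      (h.smooth_spray m).dEta h.isOpen m).div_const _).mul (SmoothOn.coord i))).sub
    (((h.smooth_thetaStar i).sub (((SmoothOn.sum fun m _ =>
      (h.smooth_thetaStar m).dEta h.isOpen m).div_const _).mul (SmoothOn.coord i))).div_const 2)

/-- Euler's identity for ∂̇_m̄ L, which still has degree 1 in η. -/
theorem sum_fundTensor_mul (h : IsMetricOn Ω Φ) (hp : (z, η) ∈ Ω) (m : Fin n) :
    ∑ l, η l * fundTensor Φ z η l m = dEtaBar m (sqMetric Φ) z η := by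
  have := h.euler.dEtaBar h.isOpen h.smooth m z η hp
  rw [one_mul] at this
  exact this

theorem sum_fundTensor_mul_conj (h : IsMetricOn Ω Φ) (hp : (z, η) ∈ Ω) (l : Fin n) :
    ∑ m, conj (η m) * fundTensor Φ z η l m = dEta l (sqMetric Φ) z η := by
  have := h.eulerBar.dEta h.isOpen h.smooth l z η hp
  rw [one_mul] at this
  rw [← this]
  exact Finset.sum_congr rfl fun m _ => by
    rw [(isDirectional_dEtaBar Ω m).comm (isDirectional_dEta Ω l) h.isOpen h.smooth hp]; rfl

/-- Allows identities for G, N and θ* to be checked after lowering the index, where the inverse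
matrix disappears. -/
theorem eq_of_sum_fundTensor (h : IsMetricOn Ω Φ) (hp : (z, η) ∈ Ω) {v w : Fin n → ℂ}
    (hvw : ∀ q, ∑ i, v i * fundTensor Φ z η i q = ∑ i, w i * fundTensor Φ z η i q) : v = w := by
  have : Matrix.vecMul (v - w) (fundTensor Φ z η) = 0 := by
    funext q
    simp only [Matrix.vecMul, dotProduct, Pi.sub_apply, sub_mul, Finset.sum_sub_distrib, hvw q,
      sub_self, Pi.zero_apply]
  exact sub_eq_zero.1 (Matrix.eq_zero_of_vecMul_eq_zero (h.det_ne z η hp) this)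

theorem sum_inv_mul (h : IsMetricOn Ω Φ) (hp : (z, η) ∈ Ω) (c : Fin n → ℂ) (q : Fin n) :
    ∑ i, (∑ m, fundTensorInv Φ z η m i * c m) * fundTensor Φ z η i q = c q := by
  have h1 := Matrix.nonsing_inv_mul (fundTensor Φ z η) (h.det_ne z η hp).isUnit
  have h2 : ∀ m, ∑ i, fundTensorInv Φ z η m i * fundTensor Φ z η i q
      = if m = q then 1 else 0 := fun m => by
    rw [← Matrix.one_apply, ← h1, Matrix.mul_apply]; rfl
  simp only [Finset.sum_mul]
  rw [Finset.sum_comm]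
  calc _ = ∑ m, c m * ∑ i, fundTensorInv Φ z η m i * fundTensor Φ z η i q :=
        Finset.sum_congr rfl fun m _ => by
          rw [Finset.mul_sum]; exact Finset.sum_congr rfl fun i _ => by ring
    _ = c q := by simp [h2]

/-- Lowering the index cancels the inverse of g, and ηˡ ∂_j g_{l q̄} is the ∂_j-derivative of ηˡ
g_{l q̄} = ∂̇_q̄ L. -/
theorem sum_connN_mul (h : IsMetricOn Ω Φ) (hp : (z, η) ∈ Ω) (j q : Fin n) :
    ∑ i, connN Φ i j z η * fundTensor Φ z η i q = dz j (dEtaBar q (sqMetric Φ)) z η := by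
  have e : ∀ i, connN Φ i j z η = ∑ m, fundTensorInv Φ z η m i *
      ∑ l, dz j (fun z' η' => fundTensor Φ z' η' l m) z η * η l := fun i => by
    simp only [connN, Finset.mul_sum, mul_assoc]
  simp only [e]
  rw [h.sum_inv_mul hp]
  have hD := IsDerivationAt.dz h.isOpen hp j
  have k := hD.congr (f := fun z η => ∑ l, η l * fundTensor Φ z η l q)
    (g := dEtaBar q (sqMetric Φ)) fun z η hp => h.sum_fundTensor_mul hp q
  rw [hD.sum_mul (F := fun k _ η => η k) (fun k => SmoothOn.coord k)
    (fun k => h.smooth_fundTensor k q)] at k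
  rw [← k]
  exact Finset.sum_congr rfl fun l _ => by rw [dz_coord]; ring

theorem sum_spray_mul (h : IsMetricOn Ω Φ) (hp : (z, η) ∈ Ω) (q : Fin n) :
    2 * ∑ i, spray Φ i z η * fundTensor Φ z η i q
      = ∑ j, η j * dz j (dEtaBar q (sqMetric Φ)) z η := by
  simp only [spray, Finset.mul_sum, ← h.sum_connN_mul hp]
  rw [Finset.sum_comm]
  refine Finset.sum_congr rfl fun i _ => ?_
  rw [Finset.sum_div, Finset.sum_mul, Finset.mul_sum]
  exact Finset.sum_congr rfl fun j _ => by ring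

theorem eulerOn_fundTensor (h : IsMetricOn Ω Φ) (i j : Fin n) :
    EulerOn Ω 0 (fun z η => fundTensor Φ z η i j) := by
  have := (h.euler.dEtaBar h.isOpen h.smooth j).dEta h.isOpen (h.smooth.dEtaBar h.isOpen j) i
  rwa [sub_self] at this

/-- ∂̇_i L has degree 1 in η̄ and ∂̇_j̄ lowers it to 0; the mixed derivatives have to be commuted
first. -/
theorem eulerBarOn_fundTensor (h : IsMetricOn Ω Φ) (i j : Fin n) :
    EulerBarOn Ω 0 (fun z η => fundTensor Φ z η i j) := by
  have h1 := h.eulerBar.dEta h.isOpen h.smooth i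
  intro z η hp
  have hD := IsDerivationAt.dEtaBar h.isOpen hp j
  have e := hD.congr h1
  rw [hD.sum_mul (F := fun k _ η => conj (η k)) (fun k => (SmoothOn.coord k).conjugate)
    (fun k => (h.smooth.dEta h.isOpen i).dEtaBar h.isOpen k),
    hD.const_mul _ (h.smooth.dEta h.isOpen i), Finset.sum_add_distrib] at e
  simp only [dEtaBar_conj_coord, ite_mul, one_mul, zero_mul, Finset.sum_ite_eq, Finset.mem_univ,
    if_true] at e
  rw [add_eq_left] at e
  rw [zero_mul, ← e]
  refine Finset.sum_congr rfl fun k _ => ?_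
  rw [(isDirectional_dEtaBar Ω j).comm (isDirectional_dEtaBar Ω k) h.isOpen
    (h.smooth.dEta h.isOpen i) hp]
  congr 1
  exact (isDirectional_dEtaBar Ω k).congr h.isOpen (fun z η hp =>
    (isDirectional_dEta Ω i).comm (isDirectional_dEtaBar Ω j) h.isOpen h.smooth hp) hp

/-- Apply the Euler operator to Nⁱₖ g_{i q̄} = ∂ₖ ∂̇_q̄ L: the right side has degree 1 and g has
degree 0. The same scheme gives the degrees of θ*. -/
theorem eulerOn_connN (h : IsMetricOn Ω Φ) (i k : Fin n) : EulerOn Ω 1 (connN Φ i k) := by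
  intro z η hp
  rw [one_mul]
  have hE := euler_derivation h.isOpen hp
  refine congrFun (h.eq_of_sum_fundTensor hp
    (v := fun i => ∑ j, η j * dEta j (connN Φ i k) z η) (w := fun i => connN Φ i k z η) ?_) i
  intro q
  have e := hE.congr (f := fun z η => ∑ i, connN Φ i k z η * fundTensor Φ z η i q)
    (g := dz k (dEtaBar q (sqMetric Φ))) fun z η hp => h.sum_connN_mul hp k q
  rw [hE.sum_mul (fun i => h.smooth_connN i k) (fun i => h.smooth_fundTensor i q),
    (h.euler.dEtaBar h.isOpen h.smooth q).dz h.isOpen (h.smooth.dEtaBar h.isOpen q) k z η hp,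
    one_mul, ← h.sum_connN_mul hp] at e
  rw [← e]
  refine Finset.sum_congr rfl fun i _ => ?_
  rw [h.eulerOn_fundTensor i q z η hp]; ring

theorem eulerOn_spray (h : IsMetricOn Ω Φ) (i : Fin n) : EulerOn Ω 2 (spray Φ i) := by
  have h1 : EulerOn Ω (1 + 1) (fun z η => ∑ j, connN Φ i j z η * η j) :=
    EulerOn.sum h.isOpen (fun j _ => (h.smooth_connN _ _).mul (SmoothOn.coord _)) fun j _ =>
      (h.eulerOn_connN i j).mul h.isOpen (h.smooth_connN _ _) (SmoothOn.coord _) (eulerOn_coord j)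
  intro z η hp
  have h2 := h1 z η hp
  simp only [spray]
  have h3 := (euler_derivation h.isOpen hp).div_const 2 (SmoothOn.sum (s := Finset.univ)
    fun j _ => (h.smooth_connN i j).mul (SmoothOn.coord j))
  have h4 : (∑ k, η k * dEta k (spray Φ i) z η)
      = ∑ k, η k * dEta k (fun z η => (∑ j, connN Φ i j z η * η j) / 2) z η := rfl
  rw [h4, h3, h2]; ring

/-- The horizontal derivative `∂ₘL - (∂̇ₘGᵖ) ∂̇ₚL` of `L = Φ²`. -/
def _root_.ComplexFinsler.horizontal {n : ℕ} (Φ : Cn n → Cn n → ℝ) (m : Fin n) (z η : Cn n) : ℂ :=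
  dz m (sqMetric Φ) z η - ∑ p, dEta m (spray Φ p) z η * dEta p (sqMetric Φ) z η

theorem smooth_horizontal (h : IsMetricOn Ω Φ) (m : Fin n) : SmoothOn Ω (horizontal Φ m) :=
  (h.smooth.dz h.isOpen m).sub (SmoothOn.sum fun p _ =>
    ((h.smooth_spray p).dEta h.isOpen m).mul (h.smooth.dEta h.isOpen p))

theorem eulerOn_horizontal (h : IsMetricOn Ω Φ) (m : Fin n) : EulerOn Ω 1 (horizontal Φ m) := by
  refine (h.euler.dz h.isOpen h.smooth m).sub h.isOpen (h.smooth.dz h.isOpen m)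
    (SmoothOn.sum fun p _ =>
      ((h.smooth_spray p).dEta h.isOpen m).mul (h.smooth.dEta h.isOpen p)) ?_
  refine EulerOn.sum h.isOpen (fun p _ =>
      ((h.smooth_spray p).dEta h.isOpen m).mul (h.smooth.dEta h.isOpen p)) fun p _ => ?_
  have := ((h.eulerOn_spray p).dEta h.isOpen (h.smooth_spray p) m).mul h.isOpen
    ((h.smooth_spray p).dEta h.isOpen m) (h.smooth.dEta h.isOpen p)
    (h.euler.dEta h.isOpen h.smooth p)
  norm_num at this
  exact this

/-- Degree 0 in η̄ of the spray, guaranteed for a generalized Berwald metric, makes both terms of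
the horizontal derivative have degree 1 in η̄. -/
theorem eulerBarOn_horizontal (h : IsMetricOn Ω Φ) (hB : ∀ i, EulerBarOn Ω 0 (spray Φ i))
    (m : Fin n) : EulerBarOn Ω 1 (horizontal Φ m) := by
  refine (h.eulerBar.dz h.isOpen h.smooth m).sub h.isOpen (h.smooth.dz h.isOpen m)
    (SmoothOn.sum fun p _ =>
      ((h.smooth_spray p).dEta h.isOpen m).mul (h.smooth.dEta h.isOpen p)) ?_
  refine EulerBarOn.sum h.isOpen (fun p _ =>
      ((h.smooth_spray p).dEta h.isOpen m).mul (h.smooth.dEta h.isOpen p)) fun p _ => ?_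
  have := ((hB p).dEta h.isOpen (h.smooth_spray p) m).mul h.isOpen
    ((h.smooth_spray p).dEta h.isOpen m) (h.smooth.dEta h.isOpen p)
    (h.eulerBar.dEta h.isOpen h.smooth p)
  norm_num at this
  exact this

/-- By homogeneity Lᵖ_{jq} ηʲ = Nᵖ_q, while differentiating 2Gᵖ = Nᵖ_j ηʲ gives Lᵖ_{qj} ηʲ = 2 ∂̇_q
Gᵖ - Nᵖ_q. The contracted torsion is therefore 2Nᵖ_q - 2 ∂̇_q Gᵖ, and pairing it with ∂̇_p L
produces the horizontal derivative. -/
theorem sum_thetaStar_mul (h : IsMetricOn Ω Φ) (hp : (z, η) ∈ Ω) (q : Fin n) :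
    ∑ k, thetaStar Φ k z η * fundTensor Φ z η k q = 2 * conj (horizontal Φ q z η) := by
  have e : ∀ k, thetaStar Φ k z η = ∑ m, fundTensorInv Φ z η m k *
      ∑ h, ∑ p, ∑ j, fundTensor Φ z η h p *
        conj (connL Φ p j m z η - connL Φ p m j z η) * η h * conj (η j) := fun k => by
    simp only [thetaStar, Finset.mul_sum, mul_assoc]
  simp only [e]
  rw [h.sum_inv_mul hp]
  have hN : ∀ p, ∑ j, connL Φ p j q z η * η j = connN Φ p q z η := fun p => by
    have := h.eulerOn_connN p q z η hp
    rw [one_mul] at this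
    rw [← this]
    exact Finset.sum_congr rfl fun j _ => mul_comm _ _
  have hG : ∀ p, ∑ j, connL Φ p q j z η * η j
      = 2 * dEta q (spray Φ p) z η - connN Φ p q z η := fun p => by
    have hD := IsDerivationAt.dEta h.isOpen hp q
    have h3 := hD.div_const 2 (SmoothOn.sum (s := Finset.univ)
      fun j _ => (h.smooth_connN p j).mul (SmoothOn.coord j))
    rw [hD.sum_mul (fun j => h.smooth_connN p j) (fun j => SmoothOn.coord j),
      Finset.sum_add_distrib] at h3
    simp only [dEta_coord, mul_ite, mul_one, mul_zero, Finset.sum_ite_eq, Finset.mem_univ,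
      if_true] at h3
    have h4 : dEta q (spray Φ p) z η = dEta q (fun z η => (∑ j, connN Φ p j z η * η j) / 2) z η :=
      rfl
    rw [h4, h3]
    simp only [connL]
    ring
  -- Euler's identity in η̄ for ∂_q L, rewritten with ∂̇_p L = g_{p m̄} η̄ᵐ and the lowered form of
  -- N.
  have hL : ∑ p, dEta p (sqMetric Φ) z η * connN Φ p q z η = dz q (sqMetric Φ) z η := by
    have := h.eulerBar.dz h.isOpen h.smooth q z η hp
    rw [one_mul] at this
    rw [← this]
    simp only [← h.sum_fundTensor_mul_conj hp, Finset.sum_mul]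
    rw [Finset.sum_comm]
    refine Finset.sum_congr rfl fun m _ => ?_
    rw [(isDirectional_dEtaBar Ω m).comm (isDirectional_dz Ω q) h.isOpen h.smooth hp,
      ← h.sum_connN_mul hp, Finset.mul_sum]
    exact Finset.sum_congr rfl fun i _ => by ring
  calc (∑ h, ∑ p, ∑ j, fundTensor Φ z η h p *
        conj (connL Φ p j q z η - connL Φ p q j z η) * η h * conj (η j))
      = ∑ p, (∑ h, η h * fundTensor Φ z η h p) *
        conj (∑ j, connL Φ p j q z η * η j - ∑ j, connL Φ p q j z η * η j) := by
        rw [Finset.sum_comm]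
        refine Finset.sum_congr rfl fun p _ => ?_
        rw [Finset.sum_mul]
        refine Finset.sum_congr rfl fun h _ => ?_
        rw [← Finset.sum_sub_distrib, map_sum, Finset.mul_sum]
        refine Finset.sum_congr rfl fun j _ => ?_
        rw [← sub_mul, map_mul]; ring
    _ = conj (∑ p, dEta p (sqMetric Φ) z η *
        (2 * connN Φ p q z η - 2 * dEta q (spray Φ p) z η)) := by
        rw [map_sum]
        refine Finset.sum_congr rfl fun p _ => ?_
        rw [h.sum_fundTensor_mul hp, h.dEtaBar_eq hp, hN, hG, map_mul]
        congr 2; ring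
    _ = 2 * conj (horizontal Φ q z η) := by
        rw [horizontal, ← hL, ← Finset.sum_sub_distrib, map_sum, map_sum, Finset.mul_sum]
        refine Finset.sum_congr rfl fun p _ => ?_
        simp only [map_mul, map_sub, map_ofNat]; ring

/-- The conjugation in `sum_thetaStar_mul` exchanges degrees: the η-degree of θ* is the η̄-degree of
the horizontal derivative. -/
theorem eulerOn_thetaStar (h : IsMetricOn Ω Φ) (hB : ∀ i, EulerBarOn Ω 0 (spray Φ i))
    (i : Fin n) : EulerOn Ω 1 (thetaStar Φ i) := by
  intro z η hp
  rw [one_mul]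
  have hE := euler_derivation h.isOpen hp
  refine congrFun (h.eq_of_sum_fundTensor hp
    (v := fun i => ∑ j, η j * dEta j (thetaStar Φ i) z η) (w := fun i => thetaStar Φ i z η) ?_) i
  intro q
  have e := hE.congr (f := fun z η => ∑ i, thetaStar Φ i z η * fundTensor Φ z η i q)
    (g := fun z η => 2 * conj (horizontal Φ q z η)) fun z η hp => h.sum_thetaStar_mul hp q
  have e2 := (h.eulerBarOn_horizontal hB q).conjugate h.isOpen (h.smooth_horizontal q) z η hp
  rw [map_one, one_mul] at e2
  rw [hE.sum_mul (fun i => h.smooth_thetaStar i) (fun i => h.smooth_fundTensor i q),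
    hE.const_mul _ (h.smooth_horizontal q).conjugate, e2, ← h.sum_thetaStar_mul hp] at e
  rw [← e]
  refine Finset.sum_congr rfl fun i _ => ?_
  rw [h.eulerOn_fundTensor i q z η hp]; ring

theorem eulerBarOn_thetaStar (h : IsMetricOn Ω Φ) (i : Fin n) :
    EulerBarOn Ω 1 (thetaStar Φ i) := by
  intro z η hp
  rw [one_mul]
  have hE := eulerBar_derivation h.isOpen hp
  refine congrFun (h.eq_of_sum_fundTensor hp
    (v := fun i => ∑ j, conj (η j) * dEtaBar j (thetaStar Φ i) z η)
    (w := fun i => thetaStar Φ i z η) ?_) i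
  intro q
  have e := hE.congr (f := fun z η => ∑ i, thetaStar Φ i z η * fundTensor Φ z η i q)
    (g := fun z η => 2 * conj (horizontal Φ q z η)) fun z η hp => h.sum_thetaStar_mul hp q
  have e2 := (h.eulerOn_horizontal q).conjugate h.isOpen (h.smooth_horizontal q) z η hp
  rw [map_one, one_mul] at e2
  rw [hE.sum_mul (fun i => h.smooth_thetaStar i) (fun i => h.smooth_fundTensor i q),
    hE.const_mul _ (h.smooth_horizontal q).conjugate, e2, ← h.sum_thetaStar_mul hp] at e
  rw [← e]
  refine Finset.sum_congr rfl fun i _ => ?_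
  rw [h.eulerBarOn_fundTensor i q z η hp]; ring

end IsMetricOn


/-! ### Hermitian metrics in coordinates -/

/-- The linear form with coefficients `c`. -/
def linForm {n : ℕ} (c η : Fin n → ℂ) : ℂ := ∑ i, c i * η i

/-- The sesquilinear form with matrix `m`. -/
def sesqForm {n : ℕ} (m : Fin n → Fin n → ℂ) (η ζ : Fin n → ℂ) : ℂ :=
  ∑ i, ∑ j, m i j * η i * conj (ζ j)

/-- `m_{i j̄} ηⁱ`, the coefficients of `m(η, ·)`. -/
def lowerBar {n : ℕ} (m : Fin n → Fin n → ℂ) (η : Fin n → ℂ) (j : Fin n) : ℂ :=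
  ∑ i, m i j * η i

/-- `m_{i j̄} η̄ʲ`, the coefficients of `m(·, η)`. -/
def lower {n : ℕ} (m : Fin n → Fin n → ℂ) (η : Fin n → ℂ) (i : Fin n) : ℂ :=
  ∑ j, m i j * conj (η j)

section Algebra

variable {n : ℕ} (m : Fin n → Fin n → ℂ) (c η ζ ξ : Fin n → ℂ) (s : ℂ)

theorem linForm_add : linForm c (η + ζ) = linForm c η + linForm c ζ := by
  simp [linForm, mul_add, Finset.sum_add_distrib]

theorem linForm_smul : linForm c (s • η) = s * linForm c η := by
  simp only [linForm, Pi.smul_apply, smul_eq_mul, Finset.mul_sum]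
  exact Finset.sum_congr rfl fun i _ => by ring

theorem sesqForm_eq_sum_lowerBar : sesqForm m η ζ = ∑ j, lowerBar m η j * conj (ζ j) := by
  simp only [sesqForm, lowerBar, Finset.sum_mul]
  exact Finset.sum_comm

theorem sesqForm_eq_sum_lower : sesqForm m η ζ = ∑ i, lower m ζ i * η i := by
  simp only [sesqForm, lower, Finset.sum_mul]
  exact Finset.sum_congr rfl fun i _ => Finset.sum_congr rfl fun j _ => by ring

theorem sesqForm_add_left : sesqForm m (η + ξ) ζ = sesqForm m η ζ + sesqForm m ξ ζ := by
  simp [sesqForm, mul_add, add_mul, Finset.sum_add_distrib]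

theorem sesqForm_add_right : sesqForm m η (ζ + ξ) = sesqForm m η ζ + sesqForm m η ξ := by
  simp [sesqForm, mul_add, Finset.sum_add_distrib]

theorem sesqForm_smul_left : sesqForm m (s • η) ζ = s * sesqForm m η ζ := by
  simp only [sesqForm, Pi.smul_apply, smul_eq_mul, Finset.mul_sum]
  exact Finset.sum_congr rfl fun i _ => Finset.sum_congr rfl fun j _ => by ring

theorem sesqForm_smul_right : sesqForm m η (s • ζ) = conj s * sesqForm m η ζ := by
  simp only [sesqForm, Pi.smul_apply, smul_eq_mul, Finset.mul_sum, map_mul]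
  exact Finset.sum_congr rfl fun i _ => Finset.sum_congr rfl fun j _ => by ring

variable {m} in
theorem conj_sesqForm (hm : ∀ i j, conj (m i j) = m j i) :
    conj (sesqForm m η ζ) = sesqForm m ζ η := by
  simp only [sesqForm, map_sum, map_mul, hm, Complex.conj_conj]
  rw [Finset.sum_comm]
  exact Finset.sum_congr rfl fun i _ => Finset.sum_congr rfl fun j _ => by ring

variable {m} in
theorem conj_lowerBar (hm : ∀ i j, conj (m i j) = m j i) (j : Fin n) :
    conj (lowerBar m η j) = lower m η j := by
  simp only [lowerBar, lower, map_sum, map_mul, hm]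

end Algebra

/-- A smooth Hermitian metric on an open subset of `ℂⁿ`. -/
structure IsHermOn {n : ℕ} (U : Set (Cn n)) (a : Cn n → Fin n → Fin n → ℂ) : Prop where
  isOpen : IsOpen U
  smooth : ∀ i j, ContDiffOn ℝ ∞ (fun z => a z i j) U
  herm : ∀ z ∈ U, ∀ i j, conj (a z i j) = a z j i
  pos : ∀ z ∈ U, ∀ η : Cn n, η ≠ 0 → 0 < (sesqForm (a z) η η).re

section Herm

variable {n : ℕ} {U : Set (Cn n)} {a : Cn n → Fin n → Fin n → ℂ} {b : Cn n → Fin n → ℂ}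
  {Ω : Set (Cn n × Cn n)} {z η : Cn n}

theorem smoothOn_linForm (hb : ∀ i, ContDiffOn ℝ ∞ (fun z => b z i) U)
    (hU : ∀ z η, (z, η) ∈ Ω → z ∈ U) : SmoothOn Ω (fun z η => linForm (b z) η) :=
  SmoothOn.sum fun i _ => (SmoothOn.base (hb i) hU).mul (SmoothOn.coord i)

theorem dEta_linForm (hΩ : IsOpen Ω) (hb : ∀ i, ContDiffOn ℝ ∞ (fun z => b z i) U)
    (hU : ∀ z η, (z, η) ∈ Ω → z ∈ U) (hp : (z, η) ∈ Ω) (k : Fin n) :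
    dEta k (fun z η => linForm (b z) η) z η = b z k := by
  simp only [linForm]
  rw [(IsDerivationAt.dEta hΩ hp k).sum_mul (F := fun i z _ => b z i)
    (fun i => SmoothOn.base (hb i) hU) (fun i => SmoothOn.coord i)]
  simp [dEta_base, dEta_coord]

theorem dEtaBar_linForm (hΩ : IsOpen Ω) (hb : ∀ i, ContDiffOn ℝ ∞ (fun z => b z i) U)
    (hU : ∀ z η, (z, η) ∈ Ω → z ∈ U) (hp : (z, η) ∈ Ω) (k : Fin n) :
    dEtaBar k (fun z η => linForm (b z) η) z η = 0 := by
  simp only [linForm]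
  rw [(IsDerivationAt.dEtaBar hΩ hp k).sum_mul (F := fun i z _ => b z i)
    (fun i => SmoothOn.base (hb i) hU) (fun i => SmoothOn.coord i)]
  simp [dEtaBar_base, dEtaBar_coord]

theorem dz_linForm (hΩ : IsOpen Ω) (hb : ∀ i, ContDiffOn ℝ ∞ (fun z => b z i) U)
    (hU : ∀ z η, (z, η) ∈ Ω → z ∈ U) (hp : (z, η) ∈ Ω) (k : Fin n) :
    dz k (fun z η => linForm (b z) η) z η
      = linForm (fun i => wirtinger k (fun z => b z i) z) η := by
  simp only [linForm]
  rw [(IsDerivationAt.dz hΩ hp k).sum_mul (F := fun i z _ => b z i)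
    (fun i => SmoothOn.base (hb i) hU) (fun i => SmoothOn.coord i)]
  simp [dz_base, dz_coord]

theorem dEta_conj_linForm (hΩ : IsOpen Ω) (hb : ∀ i, ContDiffOn ℝ ∞ (fun z => b z i) U)
    (hU : ∀ z η, (z, η) ∈ Ω → z ∈ U) (hp : (z, η) ∈ Ω) (k : Fin n) :
    dEta k (fun z η => conj (linForm (b z) η)) z η = 0 := by
  rw [dEta_conj ((smoothOn_linForm hb hU).differentiableAt_snd hΩ hp),
    dEtaBar_linForm hΩ hb hU hp, map_zero]

theorem dEtaBar_conj_linForm (hΩ : IsOpen Ω) (hb : ∀ i, ContDiffOn ℝ ∞ (fun z => b z i) U)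
    (hU : ∀ z η, (z, η) ∈ Ω → z ∈ U) (hp : (z, η) ∈ Ω) (k : Fin n) :
    dEtaBar k (fun z η => conj (linForm (b z) η)) z η = conj (b z k) := by
  rw [dEtaBar_conj ((smoothOn_linForm hb hU).differentiableAt_snd hΩ hp),
    dEta_linForm hΩ hb hU hp]

theorem dz_conj_linForm (hΩ : IsOpen Ω) (hb : ∀ i, ContDiffOn ℝ ∞ (fun z => b z i) U)
    (hU : ∀ z η, (z, η) ∈ Ω → z ∈ U) (hp : (z, η) ∈ Ω) (k : Fin n) :
    dz k (fun z η => conj (linForm (b z) η)) z η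
      = ∑ i, wirtinger k (fun z => conj (b z i)) z * conj (η i) := by
  simp only [linForm, map_sum, map_mul]
  rw [(IsDerivationAt.dz hΩ hp k).sum_mul (F := fun i z _ => conj (b z i))
    (fun i => (SmoothOn.base (hb i) hU).conjugate) (fun i => (SmoothOn.coord i).conjugate)]
  simp [dz_base, dz_conj_coord]

namespace IsHermOn

theorem smoothOn_lowerBar (h : IsHermOn U a) (hU : ∀ z η, (z, η) ∈ Ω → z ∈ U) (j : Fin n) :
    SmoothOn Ω (fun z η => lowerBar (a z) η j) :=
  smoothOn_linForm (b := fun z i => a z i j) (fun i => h.smooth i j) hU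

theorem smoothOn_sesqForm (h : IsHermOn U a) (hU : ∀ z η, (z, η) ∈ Ω → z ∈ U) :
    SmoothOn Ω (fun z η => sesqForm (a z) η η) := by
  simp only [sesqForm_eq_sum_lowerBar]
  exact SmoothOn.sum fun j _ => (h.smoothOn_lowerBar hU j).mul (SmoothOn.coord j).conjugate

theorem dEta_lowerBar (h : IsHermOn U a) (hΩ : IsOpen Ω) (hU : ∀ z η, (z, η) ∈ Ω → z ∈ U)
    (hp : (z, η) ∈ Ω) (i j : Fin n) :
    dEta i (fun z η => lowerBar (a z) η j) z η = a z i j :=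
  dEta_linForm hΩ (b := fun z i => a z i j) (fun i => h.smooth i j) hU hp i

theorem dEtaBar_lowerBar (h : IsHermOn U a) (hΩ : IsOpen Ω) (hU : ∀ z η, (z, η) ∈ Ω → z ∈ U)
    (hp : (z, η) ∈ Ω) (i j : Fin n) :
    dEtaBar i (fun z η => lowerBar (a z) η j) z η = 0 :=
  dEtaBar_linForm hΩ (b := fun z i => a z i j) (fun i => h.smooth i j) hU hp i

theorem dz_lowerBar (h : IsHermOn U a) (hΩ : IsOpen Ω) (hU : ∀ z η, (z, η) ∈ Ω → z ∈ U)
    (hp : (z, η) ∈ Ω) (k j : Fin n) :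
    dz k (fun z η => lowerBar (a z) η j) z η
      = lowerBar (fun i j => wirtinger k (fun z => a z i j) z) η j :=
  dz_linForm hΩ (b := fun z i => a z i j) (fun i => h.smooth i j) hU hp k

theorem derivation_sesqForm (h : IsHermOn U a) (hU : ∀ z η, (z, η) ∈ Ω → z ∈ U)
    {D : (Cn n → Cn n → ℂ) → ℂ} (hD : IsDerivationAt Ω z η D) :
    D (fun z η => sesqForm (a z) η η) = ∑ j, (D (fun z η => lowerBar (a z) η j) * conj (η j)
      + lowerBar (a z) η j * D (fun _ η => conj (η j))) := by
  simp only [sesqForm_eq_sum_lowerBar]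
  exact hD.sum_mul (F := fun j z η => lowerBar (a z) η j) (G := fun j _ η => conj (η j))
    (fun j => h.smoothOn_lowerBar hU j) (fun j => (SmoothOn.coord j).conjugate)

theorem dEtaBar_sesqForm (h : IsHermOn U a) (hΩ : IsOpen Ω) (hU : ∀ z η, (z, η) ∈ Ω → z ∈ U)
    (hp : (z, η) ∈ Ω) (k : Fin n) :
    dEtaBar k (fun z η => sesqForm (a z) η η) z η = lowerBar (a z) η k := by
  rw [h.derivation_sesqForm hU (IsDerivationAt.dEtaBar hΩ hp k)]
  simp [h.dEtaBar_lowerBar hΩ hU hp, dEtaBar_conj_coord]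

theorem dEta_sesqForm (h : IsHermOn U a) (hΩ : IsOpen Ω) (hU : ∀ z η, (z, η) ∈ Ω → z ∈ U)
    (hp : (z, η) ∈ Ω) (k : Fin n) :
    dEta k (fun z η => sesqForm (a z) η η) z η = lower (a z) η k := by
  rw [h.derivation_sesqForm hU (IsDerivationAt.dEta hΩ hp k)]
  simp [h.dEta_lowerBar hΩ hU hp, dEta_conj_coord, lower]

theorem dz_sesqForm (h : IsHermOn U a) (hΩ : IsOpen Ω) (hU : ∀ z η, (z, η) ∈ Ω → z ∈ U)
    (hp : (z, η) ∈ Ω) (k : Fin n) :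
    dz k (fun z η => sesqForm (a z) η η) z η
      = sesqForm (fun i j => wirtinger k (fun z => a z i j) z) η η := by
  rw [h.derivation_sesqForm hU (IsDerivationAt.dz hΩ hp k)]
  simp [h.dz_lowerBar hΩ hU hp, dz_conj_coord, sesqForm_eq_sum_lowerBar]

theorem sesqForm_im (h : IsHermOn U a) (hz : z ∈ U) (η : Cn n) : (sesqForm (a z) η η).im = 0 := by
  rw [← Complex.conj_eq_iff_im]
  exact conj_sesqForm η η (h.herm z hz)

theorem sesqForm_re (h : IsHermOn U a) (hz : z ∈ U) (η : Cn n) :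
    (((sesqForm (a z) η η).re : ℝ) : ℂ) = sesqForm (a z) η η :=
  Complex.ext (by simp) (by simp [h.sesqForm_im hz])

theorem sesqForm_ne (h : IsHermOn U a) (hz : z ∈ U) (hη : η ≠ 0) : sesqForm (a z) η η ≠ 0 := by
  intro h0
  have := h.pos z hz η hη
  rw [h0] at this
  simp at this

theorem nonneg (h : IsHermOn U a) (hz : z ∈ U) (η : Cn n) : 0 ≤ (sesqForm (a z) η η).re := by
  by_cases h0 : η = 0
  · subst h0; simp [sesqForm]
  · exact (h.pos z hz η h0).le

theorem det_ne (h : IsHermOn U a) (hz : z ∈ U) : (Matrix.of (a z)).det ≠ 0 := by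
  intro h0
  obtain ⟨v, hv, h1⟩ := Matrix.exists_vecMul_eq_zero_iff.2 h0
  refine h.sesqForm_ne hz hv ?_
  rw [sesqForm_eq_sum_lowerBar]
  refine Finset.sum_eq_zero fun j _ => ?_
  have := congrFun h1 j
  simp only [Matrix.vecMul, dotProduct, Matrix.of_apply, Pi.zero_apply] at this
  have h2 : lowerBar (a z) v j = 0 := by
    rw [← this]; exact Finset.sum_congr rfl fun i _ => mul_comm _ _
  rw [h2, zero_mul]

variable {Φ : Cn n → Cn n → ℝ}

theorem sqMetric_eq (h : IsHermOn U a)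
    (hΦ : ∀ z ∈ U, ∀ η, Φ z η = Real.sqrt (sesqForm (a z) η η).re) (hz : z ∈ U) (η : Cn n) :
    sqMetric Φ z η = sesqForm (a z) η η := by
  rw [sqMetric, hΦ z hz, Real.sq_sqrt (h.nonneg hz η), h.sesqForm_re hz]

theorem dEtaBar_sqMetric (h : IsHermOn U a)
    (hΦ : ∀ z ∈ U, ∀ η, Φ z η = Real.sqrt (sesqForm (a z) η η).re) (hΩ : IsOpen Ω)
    (hU : ∀ z η, (z, η) ∈ Ω → z ∈ U) (hp : (z, η) ∈ Ω) (j : Fin n) :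
    dEtaBar j (sqMetric Φ) z η = lowerBar (a z) η j := by
  rw [(isDirectional_dEtaBar Ω j).congr hΩ (fun z η hp => h.sqMetric_eq hΦ (hU z η hp) η) hp,
    h.dEtaBar_sesqForm hΩ hU hp]

theorem fundTensor_eq (h : IsHermOn U a)
    (hΦ : ∀ z ∈ U, ∀ η, Φ z η = Real.sqrt (sesqForm (a z) η η).re) (hΩ : IsOpen Ω)
    (hU : ∀ z η, (z, η) ∈ Ω → z ∈ U) (hp : (z, η) ∈ Ω) :
    fundTensor Φ z η = Matrix.of (a z) := by
  ext i j
  have : fundTensor Φ z η i j = dEta i (dEtaBar j (sqMetric Φ)) z η := rfl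
  rw [this, (isDirectional_dEta Ω i).congr hΩ (fun z η hp => h.dEtaBar_sqMetric hΦ hΩ hU hp j) hp,
    h.dEta_lowerBar hΩ hU hp, Matrix.of_apply]

/-- The norm of a Hermitian metric is a complex Finsler metric. -/
theorem isMetricOn (h : IsHermOn U a)
    (hΦ : ∀ z ∈ U, ∀ η, Φ z η = Real.sqrt (sesqForm (a z) η η).re) (hΩ : IsOpen Ω)
    (hU : ∀ z η, (z, η) ∈ Ω → z ∈ U) : IsMetricOn Ω Φ where
  isOpen := hΩ
  smooth := (h.smoothOn_sesqForm hU).congr fun z η hp => h.sqMetric_eq hΦ (hU z η hp) η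
  euler := by
    refine EulerOn.congr (f := fun z η => sesqForm (a z) η η) hΩ ?_ fun z η hp =>
      h.sqMetric_eq hΦ (hU z η hp) η
    intro z η hp
    change _ = 1 * sesqForm (a z) η η
    rw [one_mul, sesqForm_eq_sum_lower]
    exact Finset.sum_congr rfl fun k _ => by rw [h.dEta_sesqForm hΩ hU hp]; ring
  det_ne z η hp := by
    rw [h.fundTensor_eq hΦ hΩ hU hp]
    exact h.det_ne (hU z η hp)

/-- The symmetrised derivative `Γⁱ_{lj}` with `2 a_{i q̄} Γⁱ_{lj} = ∂ⱼ a_{l q̄}`. -/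
def _root_.ComplexFinsler.hermGamma {n : ℕ} (a : Cn n → Fin n → Fin n → ℂ) (i l j : Fin n)
    (z : Cn n) : ℂ :=
  (∑ m, (Matrix.of (a z))⁻¹ m i * wirtinger j (fun z => a z l m) z) / 2

theorem sum_hermGamma (h : IsHermOn U a) (hz : z ∈ U) (l j q : Fin n) :
    2 * ∑ i, a z i q * hermGamma a i l j z = wirtinger j (fun z => a z l q) z := by
  have h1 := Matrix.nonsing_inv_mul (Matrix.of (a z)) (h.det_ne hz).isUnit
  have h2 : ∀ m, ∑ i, (Matrix.of (a z))⁻¹ m i * a z i q = if m = q then 1 else 0 := fun m => by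
    rw [← Matrix.one_apply, ← h1, Matrix.mul_apply]; rfl
  calc 2 * ∑ i, a z i q * hermGamma a i l j z
      = ∑ i, ∑ m, a z i q * ((Matrix.of (a z))⁻¹ m i * wirtinger j (fun z => a z l m) z) := by
        rw [Finset.mul_sum]
        refine Finset.sum_congr rfl fun i _ => ?_
        rw [hermGamma, ← Finset.mul_sum]; ring
    _ = ∑ m, wirtinger j (fun z => a z l m) z * ∑ i, (Matrix.of (a z))⁻¹ m i * a z i q := by
        rw [Finset.sum_comm]
        refine Finset.sum_congr rfl fun m _ => ?_
        rw [Finset.mul_sum]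
        exact Finset.sum_congr rfl fun i _ => by ring
    _ = _ := by simp [h2]

theorem eq_of_sum (h : IsHermOn U a) (hz : z ∈ U) {v w : Fin n → ℂ}
    (hvw : ∀ q, ∑ i, v i * a z i q = ∑ i, w i * a z i q) : v = w := by
  have : Matrix.vecMul (v - w) (Matrix.of (a z)) = 0 := by
    funext q
    simp only [Matrix.vecMul, dotProduct, Pi.sub_apply, sub_mul, Finset.sum_sub_distrib,
      Matrix.of_apply, hvw q, sub_self, Pi.zero_apply]
  exact sub_eq_zero.1 (Matrix.eq_zero_of_vecMul_eq_zero (h.det_ne hz) this)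

theorem spray_mul (h : IsHermOn U a)
    (hΦ : ∀ z ∈ U, ∀ η, Φ z η = Real.sqrt (sesqForm (a z) η η).re) (hΩ : IsOpen Ω)
    (hU : ∀ z η, (z, η) ∈ Ω → z ∈ U) (hp : (z, η) ∈ Ω) (q : Fin n) :
    2 * ∑ i, spray Φ i z η * a z i q
      = ∑ j, η j * lowerBar (fun l q => wirtinger j (fun z => a z l q) z) η q := by
  have h1 := (h.isMetricOn hΦ hΩ hU).sum_spray_mul hp q
  rw [h.fundTensor_eq hΦ hΩ hU hp] at h1
  simp only [Matrix.of_apply] at h1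
  rw [h1]
  refine Finset.sum_congr rfl fun j _ => ?_
  rw [(isDirectional_dz Ω j).congr hΩ (fun z η hp => h.dEtaBar_sqMetric hΦ hΩ hU hp q) hp,
    h.dz_lowerBar hΩ hU hp]

/-- For a Hermitian metric g does not depend on η, so the spray is a quadratic form in η; in
particular it is holomorphic in η. -/
theorem spray_eq (h : IsHermOn U a)
    (hΦ : ∀ z ∈ U, ∀ η, Φ z η = Real.sqrt (sesqForm (a z) η η).re) (hΩ : IsOpen Ω)
    (hU : ∀ z η, (z, η) ∈ Ω → z ∈ U) (hp : (z, η) ∈ Ω) (i : Fin n) :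
    spray Φ i z η = ∑ l, ∑ j, hermGamma a i l j z * η l * η j := by
  refine congrFun (h.eq_of_sum (hU z η hp) (v := fun i => spray Φ i z η)
    (w := fun i => ∑ l, ∑ j, hermGamma a i l j z * η l * η j) fun q => ?_) i
  have h1 := h.spray_mul hΦ hΩ hU hp q
  have h2 : 2 * ∑ i, (∑ l, ∑ j, hermGamma a i l j z * η l * η j) * a z i q
      = ∑ j, η j * lowerBar (fun l q => wirtinger j (fun z => a z l q) z) η q := by
    simp only [lowerBar, ← h.sum_hermGamma (hU z η hp), Finset.mul_sum, Finset.sum_mul]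
    rw [Finset.sum_comm, Finset.sum_comm' (t' := Finset.univ) (s' := fun _ => Finset.univ)
      (by simp)]
    rw [Finset.sum_comm]
    conv_rhs => rw [Finset.sum_comm]
    refine Finset.sum_congr rfl fun l _ => ?_
    rw [Finset.sum_comm]
    refine Finset.sum_congr rfl fun j _ => Finset.sum_congr rfl fun i _ => by ring
  exact mul_left_cancel₀ two_ne_zero (h1.trans h2.symm)

end IsHermOn

end Herm


/-! ### Fibrewise derivatives of polynomials -/

section Fibre

variable {n : ℕ} {f g : Cn n → Cn n → ℂ} {z η : Cn n}

theorem dEta_congr_fibre (h : ∀ᶠ ζ in nhds η, f z ζ = g z ζ) (k : Fin n) :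
    dEta k f z η = dEta k g z η := by
  have h' : f z =ᶠ[nhds η] g z := h
  simp only [dEta, wirtinger, h'.fderiv_eq]

theorem dEtaBar_congr_fibre (h : ∀ᶠ ζ in nhds η, f z ζ = g z ζ) (k : Fin n) :
    dEtaBar k f z η = dEtaBar k g z η := by
  have h' : f z =ᶠ[nhds η] g z := h
  simp only [dEtaBar, wirtingerBar, h'.fderiv_eq]

theorem eventually_fibre {Ω : Set (Cn n × Cn n)} (hΩ : IsOpen Ω) (hp : (z, η) ∈ Ω) :
    ∀ᶠ ζ in nhds η, (z, ζ) ∈ Ω :=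
  (Continuous.prodMk_right z).tendsto η (hΩ.mem_nhds hp)

theorem dEta_linForm_const (c : Fin n → ℂ) (k : Fin n) (z η : Cn n) :
    dEta k (fun _ η => linForm c η) z η = c k :=
  dEta_linForm (Ω := Set.univ) (U := Set.univ) (b := fun _ => c) isOpen_univ
    (fun _ => contDiffOn_const) (fun _ _ _ => trivial) trivial k

theorem dEtaBar_linForm_const (c : Fin n → ℂ) (k : Fin n) (z η : Cn n) :
    dEtaBar k (fun _ η => linForm c η) z η = 0 :=
  dEtaBar_linForm (Ω := Set.univ) (U := Set.univ) (b := fun _ => c) isOpen_univ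
    (fun _ => contDiffOn_const) (fun _ _ _ => trivial) trivial k

theorem dEta_conj_linForm_const (c : Fin n → ℂ) (k : Fin n) (z η : Cn n) :
    dEta k (fun _ η => conj (linForm c η)) z η = 0 :=
  dEta_conj_linForm (Ω := Set.univ) (U := Set.univ) (b := fun _ => c) isOpen_univ
    (fun _ => contDiffOn_const) (fun _ _ _ => trivial) trivial k

theorem dEtaBar_conj_linForm_const (c : Fin n → ℂ) (k : Fin n) (z η : Cn n) :
    dEtaBar k (fun _ η => conj (linForm c η)) z η = conj (c k) :=
  dEtaBar_conj_linForm (Ω := Set.univ) (U := Set.univ) (b := fun _ => c) isOpen_univ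
    (fun _ => contDiffOn_const) (fun _ _ _ => trivial) trivial k

/-- The quadratic form with matrix `c`. -/
def quadForm (c : Fin n → Fin n → ℂ) (η : Cn n) : ℂ := ∑ l, ∑ j, c l j * η l * η j

theorem quadForm_eq (c : Fin n → Fin n → ℂ) (η : Cn n) :
    quadForm c η = ∑ l, linForm (c l) η * η l := by
  simp only [quadForm, linForm, Finset.sum_mul]
  exact Finset.sum_congr rfl fun l _ => Finset.sum_congr rfl fun j _ => by ring

theorem sesqForm_eq_sum_linForm (c : Fin n → Fin n → ℂ) (η : Cn n) :
    sesqForm c η η = ∑ l, η l * conj (linForm (fun j => conj (c l j)) η) := by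
  simp only [sesqForm, linForm, map_sum, map_mul, Complex.conj_conj, Finset.mul_sum]
  exact Finset.sum_congr rfl fun l _ => Finset.sum_congr rfl fun j _ => by ring

theorem smoothOn_linForm_const {Ω : Set (Cn n × Cn n)} (c : Fin n → ℂ) :
    SmoothOn Ω (fun _ η => linForm c η) :=
  SmoothOn.sum fun _ _ => (SmoothOn.const _).mul (SmoothOn.coord _)

theorem dEta_quadForm (c : Fin n → Fin n → ℂ) (k : Fin n) (z η : Cn n) :
    dEta k (fun _ η => quadForm c η) z η = linForm (fun l => c k l + c l k) η := by
  simp only [quadForm_eq]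
  rw [(IsDerivationAt.dEta (Ω := Set.univ) isOpen_univ trivial k).sum_mul
    (F := fun l _ η => linForm (c l) η) (fun l => smoothOn_linForm_const _)
    (fun l => SmoothOn.coord l)]
  simp only [dEta_linForm_const, dEta_coord, Finset.sum_add_distrib, mul_ite, mul_one, mul_zero,
    Finset.sum_ite_eq, Finset.mem_univ, if_true]
  rw [linForm, linForm, ← Finset.sum_add_distrib]
  exact Finset.sum_congr rfl fun l _ => by ring

theorem dEtaBar_quadForm (c : Fin n → Fin n → ℂ) (k : Fin n) (z η : Cn n) :
    dEtaBar k (fun _ η => quadForm c η) z η = 0 := by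
  simp only [quadForm_eq]
  rw [(IsDerivationAt.dEtaBar (Ω := Set.univ) isOpen_univ trivial k).sum_mul
    (F := fun l _ η => linForm (c l) η) (fun l => smoothOn_linForm_const _)
    (fun l => SmoothOn.coord l)]
  simp [dEtaBar_linForm_const, dEtaBar_coord]

theorem smoothOn_sesqForm_const {Ω : Set (Cn n × Cn n)} (c : Fin n → Fin n → ℂ) :
    SmoothOn Ω (fun _ η => sesqForm c η η) :=
  SmoothOn.sum fun _ _ => SmoothOn.sum fun _ _ => ((SmoothOn.const _).mul (SmoothOn.coord _)).mul
    (SmoothOn.coord _).conjugate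

theorem smoothOn_quadForm_const {Ω : Set (Cn n × Cn n)} (c : Fin n → Fin n → ℂ) :
    SmoothOn Ω (fun _ η => quadForm c η) :=
  SmoothOn.sum fun _ _ => SmoothOn.sum fun _ _ => ((SmoothOn.const _).mul (SmoothOn.coord _)).mul
    (SmoothOn.coord _)

theorem dEta_sesqForm_const (c : Fin n → Fin n → ℂ) (k : Fin n) (z η : Cn n) :
    dEta k (fun _ η => sesqForm c η η) z η = conj (linForm (fun j => conj (c k j)) η) := by
  simp only [sesqForm_eq_sum_linForm]
  rw [(IsDerivationAt.dEta (Ω := Set.univ) isOpen_univ trivial k).sum_mul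
    (F := fun l _ η => η l) (fun l => SmoothOn.coord l)
    (fun l => (smoothOn_linForm_const _).conjugate)]
  simp [dEta_conj_linForm_const, dEta_coord]

end Fibre

/-! ### Horizontal derivative and torsion of a Hermitian metric. -/

section Herm

variable {n : ℕ} {U : Set (Cn n)} {a : Cn n → Fin n → Fin n → ℂ} {Ω : Set (Cn n × Cn n)}
  {z η : Cn n} {Φ : Cn n → Cn n → ℝ}

/-- The torsion `(∂ₘ a_{l q̄} - ∂ₗ a_{m q̄}) / 2`. -/
def hermTorsion (a : Cn n → Fin n → Fin n → ℂ) (z : Cn n) (m l q : Fin n) : ℂ :=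
  (wirtinger m (fun z => a z l q) z - wirtinger l (fun z => a z m q) z) / 2

namespace IsHermOn

theorem dEta_spray (h : IsHermOn U a)
    (hΦ : ∀ z ∈ U, ∀ η, Φ z η = Real.sqrt (sesqForm (a z) η η).re) (hΩ : IsOpen Ω)
    (hU : ∀ z η, (z, η) ∈ Ω → z ∈ U) (hp : (z, η) ∈ Ω) (i m : Fin n) :
    dEta m (spray Φ i) z η
      = linForm (fun l => hermGamma a i m l z + hermGamma a i l m z) η := by
  rw [← dEta_quadForm (fun l j => hermGamma a i l j z) m z η]
  refine dEta_congr_fibre ?_ m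
  filter_upwards [eventually_fibre hΩ hp] with ζ hζ
  exact h.spray_eq hΦ hΩ hU hζ i

theorem dEtaBar_spray (h : IsHermOn U a)
    (hΦ : ∀ z ∈ U, ∀ η, Φ z η = Real.sqrt (sesqForm (a z) η η).re) (hΩ : IsOpen Ω)
    (hU : ∀ z η, (z, η) ∈ Ω → z ∈ U) (hp : (z, η) ∈ Ω) (i m : Fin n) :
    dEtaBar m (spray Φ i) z η = 0 := by
  rw [← dEtaBar_quadForm (fun l j => hermGamma a i l j z) m z η]
  refine dEtaBar_congr_fibre ?_ m
  filter_upwards [eventually_fibre hΩ hp] with ζ hζ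
  exact h.spray_eq hΦ hΩ hU hζ i

theorem horizontal_eq (h : IsHermOn U a)
    (hΦ : ∀ z ∈ U, ∀ η, Φ z η = Real.sqrt (sesqForm (a z) η η).re) (hΩ : IsOpen Ω)
    (hU : ∀ z η, (z, η) ∈ Ω → z ∈ U) (hp : (z, η) ∈ Ω) (m : Fin n) :
    horizontal Φ m z η = dz m (fun z η => sesqForm (a z) η η) z η
      - ∑ p, dEta m (spray Φ p) z η * dEta p (fun z η => sesqForm (a z) η η) z η := by
  have e := fun z η hp => h.sqMetric_eq hΦ (hU z η hp) η
  simp only [horizontal, (isDirectional_dz Ω m).congr hΩ e hp,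
    fun p => (isDirectional_dEta Ω p).congr hΩ e hp]

/-- The term (∂̇ₘGᵖ)∂̇ₚL removes the part of ∂ₘ a_{l q̄} symmetric in (m, l), which leaves half of
the antisymmetric part. -/
theorem horizontal_eq_torsion (h : IsHermOn U a)
    (hΦ : ∀ z ∈ U, ∀ η, Φ z η = Real.sqrt (sesqForm (a z) η η).re) (hΩ : IsOpen Ω)
    (hU : ∀ z η, (z, η) ∈ Ω → z ∈ U) (hp : (z, η) ∈ Ω) (m : Fin n) :
    horizontal Φ m z η = sesqForm (hermTorsion a z m) η η := by
  rw [h.horizontal_eq hΦ hΩ hU hp, h.dz_sesqForm hΩ hU hp]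
  simp only [h.dEta_spray hΦ hΩ hU hp, h.dEta_sesqForm hΩ hU hp]
  have e : ∑ p, linForm (fun l => hermGamma a p m l z + hermGamma a p l m z) η * lower (a z) η p
      = sesqForm (fun l q => (wirtinger m (fun z => a z l q) z
        + wirtinger l (fun z => a z m q) z) / 2) η η := by
    simp only [← h.sum_hermGamma (hU z η hp), linForm, lower, sesqForm, Finset.sum_mul_sum]
    rw [Finset.sum_comm]
    refine Finset.sum_congr rfl fun l _ => ?_
    rw [Finset.sum_comm]
    refine Finset.sum_congr rfl fun q _ => ?_
    rw [← mul_add, mul_div_cancel_left₀ _ (two_ne_zero' ℂ), ← Finset.sum_add_distrib,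
      Finset.sum_mul, Finset.sum_mul]
    exact Finset.sum_congr rfl fun p _ => by ring
  rw [e]
  simp only [sesqForm, hermTorsion, ← Finset.sum_sub_distrib]
  exact Finset.sum_congr rfl fun l _ => Finset.sum_congr rfl fun q _ => by ring

theorem hermTorsion_antisymm (m l q : Fin n) :
    hermTorsion a z m l q = - hermTorsion a z l m q := by
  simp only [hermTorsion]; ring

end IsHermOn

end Herm

/-! ### Randers metrics in coordinates -/

/-- Coordinate data of a complex Randers metric `α + |β|` with `β ≠ 0`. -/
structure IsRanders {n : ℕ} (U : Set (Cn n)) (a : Cn n → Fin n → Fin n → ℂ)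
    (b : Cn n → Fin n → ℂ) : Prop where
  herm : IsHermOn U a
  smooth_b : ∀ i, ContDiffOn ℝ ∞ (fun z => b z i) U
  b_ne : ∀ z ∈ U, b z ≠ 0

/-- The set of `(z, η)` with `β(z, η) ≠ 0`. -/
def randersDomain {n : ℕ} (U : Set (Cn n)) (b : Cn n → Fin n → ℂ) : Set (Cn n × Cn n) :=
  {p | p.1 ∈ U ∧ linForm (b p.1) p.2 ≠ 0}

/-- `α` as a complex valued function. -/
def alphaFn {n : ℕ} (a : Cn n → Fin n → Fin n → ℂ) (z η : Cn n) : ℂ :=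
  ((Real.sqrt (sesqForm (a z) η η).re : ℝ) : ℂ)

/-- `|β|` as a complex valued function. -/
def absBeta {n : ℕ} (b : Cn n → Fin n → ℂ) (z η : Cn n) : ℂ := ((‖linForm (b z) η‖ : ℝ) : ℂ)

/-- The vector dual to `β` with respect to `a`. -/
def sharp {n : ℕ} (a : Cn n → Fin n → Fin n → ℂ) (b : Cn n → Fin n → ℂ) (z : Cn n) : Cn n :=
  fun m => conj (∑ k, (Matrix.of (a z))⁻¹ m k * b z k)

theorem linForm_ne_zero {n : ℕ} {c η : Fin n → ℂ} (h : linForm c η ≠ 0) : η ≠ 0 := by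
  rintro rfl
  exact h (by simp [linForm])

namespace IsRanders

variable {n : ℕ} {U : Set (Cn n)} {a : Cn n → Fin n → Fin n → ℂ} {b : Cn n → Fin n → ℂ}
  {z η : Cn n}

theorem mem_base : ∀ z η, (z, η) ∈ randersDomain U b → z ∈ U := fun _ _ h => h.1

theorem isOpen_domain (h : IsRanders U a b) : IsOpen (randersDomain U b) := by
  have hc : ContinuousOn (fun p : Cn n × Cn n => linForm (b p.1) p.2) (Prod.fst ⁻¹' U) :=
    (smoothOn_linForm (Ω := Prod.fst ⁻¹' U) h.smooth_b fun _ _ h => h).continuousOn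
  exact hc.isOpen_inter_preimage (h.herm.isOpen.preimage continuous_fst) isOpen_compl_singleton

theorem alphaFn_mul_self (h : IsRanders U a b) (hz : z ∈ U) (η : Cn n) :
    alphaFn a z η * alphaFn a z η = sesqForm (a z) η η := by
  rw [alphaFn, ← Complex.ofReal_mul, Real.mul_self_sqrt (h.herm.nonneg hz η), h.herm.sesqForm_re hz]

theorem alphaFn_ne (h : IsRanders U a b) (hp : (z, η) ∈ randersDomain U b) :
    alphaFn a z η ≠ 0 := by
  intro h0
  refine h.herm.sesqForm_ne hp.1 (linForm_ne_zero hp.2) ?_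
  rw [← h.alphaFn_mul_self hp.1, h0, zero_mul]

theorem absBeta_mul_self (z η : Cn n) :
    absBeta b z η * absBeta b z η = linForm (b z) η * conj (linForm (b z) η) := by
  rw [absBeta, Complex.mul_conj, Complex.normSq_eq_norm_sq]; push_cast; ring

theorem absBeta_ne (hp : (z, η) ∈ randersDomain U b) : absBeta b z η ≠ 0 := by
  simpa [absBeta] using hp.2

theorem smoothOn_alphaFn (h : IsRanders U a b) : SmoothOn (randersDomain U b) (alphaFn a) := by
  have h1 := h.herm.smoothOn_sesqForm (Ω := randersDomain U b) mem_base
  have h2 : ContDiffOn ℝ ∞ (fun p : Cn n × Cn n => (sesqForm (a p.1) p.2 p.2).re)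
      (randersDomain U b) := Complex.reCLM.contDiff.comp_contDiffOn h1
  exact Complex.ofRealCLM.contDiff.comp_contDiffOn (h2.sqrt fun p hp =>
    (h.herm.pos p.1 hp.1 p.2 (linForm_ne_zero hp.2)).ne')

theorem smoothOn_beta (h : IsRanders U a b) :
    SmoothOn (randersDomain U b) (fun z η => linForm (b z) η) :=
  smoothOn_linForm h.smooth_b mem_base

theorem smoothOn_absBeta (h : IsRanders U a b) : SmoothOn (randersDomain U b) (absBeta b) :=
  Complex.ofRealCLM.contDiff.comp_contDiffOn
    (ContDiffOn.norm ℝ h.smoothOn_beta fun _ hp => hp.2)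

theorem lower_sharp (h : IsRanders U a b) (hz : z ∈ U) (k : Fin n) :
    lower (a z) (sharp a b z) k = b z k := by
  have h1 := Matrix.mul_nonsing_inv (Matrix.of (a z)) (h.herm.det_ne hz).isUnit
  have h2 : ∀ l, ∑ m, a z k m * (Matrix.of (a z))⁻¹ m l = if k = l then 1 else 0 := fun l => by
    rw [← Matrix.one_apply, ← h1, Matrix.mul_apply]; rfl
  simp only [lower, sharp, Complex.conj_conj, Finset.mul_sum]
  rw [Finset.sum_comm]
  calc _ = ∑ l, (∑ m, a z k m * (Matrix.of (a z))⁻¹ m l) * b z l :=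
        Finset.sum_congr rfl fun l _ => by
          rw [Finset.sum_mul]; exact Finset.sum_congr rfl fun m _ => by ring
    _ = b z k := by simp [h2]

theorem sesqForm_sharp (h : IsRanders U a b) (hz : z ∈ U) (η : Cn n) :
    sesqForm (a z) η (sharp a b z) = linForm (b z) η := by
  rw [sesqForm_eq_sum_lower]
  simp only [h.lower_sharp hz, linForm]

theorem sharp_sesqForm (h : IsRanders U a b) (hz : z ∈ U) (η : Cn n) :
    sesqForm (a z) (sharp a b z) η = conj (linForm (b z) η) := by
  rw [← h.sesqForm_sharp hz, conj_sesqForm _ _ (h.herm.herm z hz)]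

theorem sharp_ne (h : IsRanders U a b) (hz : z ∈ U) : sharp a b z ≠ 0 := by
  intro h0
  refine h.b_ne z hz (funext fun k => ?_)
  rw [← h.lower_sharp hz, h0]
  simp [lower]

/-- The squared norm `‖b‖²` with respect to `a`. -/
def _root_.ComplexFinsler.normB {n : ℕ} (a : Cn n → Fin n → Fin n → ℂ) (b : Cn n → Fin n → ℂ)
    (z : Cn n) : ℝ :=
  (sesqForm (a z) (sharp a b z) (sharp a b z)).re

theorem normB_pos (h : IsRanders U a b) (hz : z ∈ U) : 0 < normB a b z :=
  h.herm.pos z hz _ (h.sharp_ne hz)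

theorem linForm_sharp (h : IsRanders U a b) (hz : z ∈ U) :
    linForm (b z) (sharp a b z) = normB a b z := by
  rw [normB, h.herm.sesqForm_re hz, h.sesqForm_sharp hz]

theorem smoothOn_sharp (h : IsRanders U a b) (i : Fin n) :
    SmoothOn (randersDomain U b) (fun z _ => sharp a b z i) := by
  refine SmoothOn.conjugate (SmoothOn.sum fun k _ => SmoothOn.mul ?_
    (SmoothOn.base (h.smooth_b k) mem_base))
  exact SmoothOn.matrix_inv (G := fun z _ => Matrix.of (a z))
    (fun i j => SmoothOn.base (h.herm.smooth i j) mem_base)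
    (fun z η hp => h.herm.det_ne hp.1) i k

variable {D : (Cn n → Cn n → ℂ) → ℂ}

/-- Applying the derivation to α·α = a(η, η̄) replaces differentiation of a square root by an
algebraic identity; |β| is treated the same way through ββ̄. -/
theorem derivation_alphaFn (h : IsRanders U a b)
    (hD : IsDerivationAt (randersDomain U b) z η D) :
    2 * alphaFn a z η * D (alphaFn a) = D (fun z η => sesqForm (a z) η η) := by
  rw [hD.congr (g := fun z η => alphaFn a z η * alphaFn a z η) fun z η hp =>
    (h.alphaFn_mul_self hp.1 η).symm, hD.mul h.smoothOn_alphaFn h.smoothOn_alphaFn]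
  ring

theorem derivation_absBeta (h : IsRanders U a b)
    (hD : IsDerivationAt (randersDomain U b) z η D) :
    2 * absBeta b z η * D (absBeta b)
      = D (fun z η => linForm (b z) η) * conj (linForm (b z) η)
        + linForm (b z) η * D (fun z η => conj (linForm (b z) η)) := by
  rw [← hD.mul h.smoothOn_beta h.smoothOn_beta.conjugate,
    hD.congr (f := fun z η => linForm (b z) η * conj (linForm (b z) η))
      (g := fun z η => absBeta b z η * absBeta b z η) fun z η hp =>
        (absBeta_mul_self z η).symm, hD.mul h.smoothOn_absBeta h.smoothOn_absBeta]
  ring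

theorem dEtaBar_alphaFn (h : IsRanders U a b) (hp : (z, η) ∈ randersDomain U b) (m : Fin n) :
    2 * alphaFn a z η * dEtaBar m (alphaFn a) z η = lowerBar (a z) η m := by
  rw [h.derivation_alphaFn (IsDerivationAt.dEtaBar h.isOpen_domain hp m),
    h.herm.dEtaBar_sesqForm h.isOpen_domain mem_base hp]

theorem dEta_alphaFn (h : IsRanders U a b) (hp : (z, η) ∈ randersDomain U b) (m : Fin n) :
    2 * alphaFn a z η * dEta m (alphaFn a) z η = lower (a z) η m := by
  rw [h.derivation_alphaFn (IsDerivationAt.dEta h.isOpen_domain hp m),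
    h.herm.dEta_sesqForm h.isOpen_domain mem_base hp]

theorem dEtaBar_absBeta (h : IsRanders U a b) (hp : (z, η) ∈ randersDomain U b) (m : Fin n) :
    2 * absBeta b z η * dEtaBar m (absBeta b) z η = linForm (b z) η * conj (b z m) := by
  rw [h.derivation_absBeta (IsDerivationAt.dEtaBar h.isOpen_domain hp m),
    dEtaBar_linForm h.isOpen_domain h.smooth_b mem_base hp,
    dEtaBar_conj_linForm h.isOpen_domain h.smooth_b mem_base hp]
  ring

theorem dEta_absBeta (h : IsRanders U a b) (hp : (z, η) ∈ randersDomain U b) (m : Fin n) :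
    2 * absBeta b z η * dEta m (absBeta b) z η = conj (linForm (b z) η) * b z m := by
  rw [h.derivation_absBeta (IsDerivationAt.dEta h.isOpen_domain hp m),
    dEta_linForm h.isOpen_domain h.smooth_b mem_base hp,
    dEta_conj_linForm h.isOpen_domain h.smooth_b mem_base hp]
  ring

theorem dEta_dEtaBar_alphaFn (h : IsRanders U a b) (hp : (z, η) ∈ randersDomain U b)
    (i m : Fin n) : dEta i (dEtaBar m (alphaFn a)) z η = a z i m / (2 * alphaFn a z η)
      - lower (a z) η i * lowerBar (a z) η m / (4 * alphaFn a z η ^ 3) := by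
  have h0 := h.alphaFn_ne hp
  have hD := IsDerivationAt.dEta h.isOpen_domain hp i
  have e := hD.congr (f := fun z η => (2 * alphaFn a z η) * dEtaBar m (alphaFn a) z η)
    (g := fun z η => lowerBar (a z) η m) fun z η hp => h.dEtaBar_alphaFn hp m
  rw [hD.mul ((SmoothOn.const 2).mul h.smoothOn_alphaFn)
      (h.smoothOn_alphaFn.dEtaBar h.isOpen_domain m),
    hD.const_mul _ h.smoothOn_alphaFn, h.herm.dEta_lowerBar h.isOpen_domain mem_base hp] at e
  have e1 := h.dEtaBar_alphaFn hp m
  have e2 := h.dEta_alphaFn hp i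
  rw [← e, ← e1, ← e2]
  field_simp
  ring

theorem dEta_dEtaBar_absBeta (h : IsRanders U a b) (hp : (z, η) ∈ randersDomain U b)
    (i m : Fin n) : dEta i (dEtaBar m (absBeta b)) z η
      = b z i * conj (b z m) / (4 * absBeta b z η) := by
  have h0 := absBeta_ne hp
  have hD := IsDerivationAt.dEta h.isOpen_domain hp i
  have e := hD.congr (f := fun z η => (2 * absBeta b z η) * dEtaBar m (absBeta b) z η)
    (g := fun z η => linForm (b z) η * conj (b z m)) fun z η hp => h.dEtaBar_absBeta hp m
  rw [hD.mul ((SmoothOn.const 2).mul h.smoothOn_absBeta)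
      (h.smoothOn_absBeta.dEtaBar h.isOpen_domain m),
    hD.const_mul _ h.smoothOn_absBeta,
    hD.mul h.smoothOn_beta (SmoothOn.base (h.smooth_b m) mem_base).conjugate,
    dEta_linForm h.isOpen_domain h.smooth_b mem_base hp,
    dEta_base (fun z => conj (b z m)), mul_zero, add_zero] at e
  have e1 := h.dEtaBar_absBeta hp m
  have e2 := h.dEta_absBeta hp i
  have e3 := absBeta_mul_self (b := b) z η
  -- In the product of the two first derivatives the factor ββ̄ is |β|², so β drops out of their
  -- product.
  have e4 : (2 * absBeta b z η * dEta i (absBeta b) z η)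
      * (2 * absBeta b z η * dEtaBar m (absBeta b) z η)
      = absBeta b z η * absBeta b z η * (b z i * conj (b z m)) := by
    rw [e1, e2, e3]; ring
  have e5 : 4 * dEta i (absBeta b) z η * dEtaBar m (absBeta b) z η = b z i * conj (b z m) := by
    have : (absBeta b z η * absBeta b z η) ≠ 0 := mul_ne_zero h0 h0
    apply mul_left_cancel₀ this
    rw [← e4]; ring
  field_simp
  linear_combination 2 * e - e5

end IsRanders


/-! ### The fundamental tensor of α + |β| and its linear systems. -/

theorem sum_linComb₃_mul {ι : Type*} [Fintype ι] (A B C : ℂ) (u v w c : ι → ℂ) :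
    ∑ m, (A * u m + B * v m + C * w m) * c m
      = A * ∑ m, u m * c m + B * ∑ m, v m * c m + C * ∑ m, w m * c m := by
  simp only [Finset.mul_sum, ← Finset.sum_add_distrib]
  exact Finset.sum_congr rfl fun m _ => by ring

namespace IsRanders

variable {n : ℕ} {U : Set (Cn n)} {a : Cn n → Fin n → Fin n → ℂ} {b : Cn n → Fin n → ℂ}
  {z η : Cn n} {D : (Cn n → Cn n → ℂ) → ℂ} {F : Cn n → Cn n → ℝ}

theorem sqMetric_eq
    (hF : ∀ z ∈ U, ∀ η, F z η = Real.sqrt (sesqForm (a z) η η).re + ‖linForm (b z) η‖)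
    (hz : z ∈ U) (η : Cn n) :
    sqMetric F z η = (alphaFn a z η + absBeta b z η) * (alphaFn a z η + absBeta b z η) := by
  rw [sqMetric, hF z hz, alphaFn, absBeta]
  push_cast
  ring

theorem derivation_sqMetric (h : IsRanders U a b)
    (hF : ∀ z ∈ U, ∀ η, F z η = Real.sqrt (sesqForm (a z) η η).re + ‖linForm (b z) η‖)
    (hD : IsDerivationAt (randersDomain U b) z η D) :
    D (sqMetric F) = 2 * (alphaFn a z η + absBeta b z η) * (D (alphaFn a) + D (absBeta b)) := by
  have hs := h.smoothOn_alphaFn.add h.smoothOn_absBeta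
  rw [hD.congr fun z η hp => sqMetric_eq hF hp.1 η, hD.mul hs hs,
    hD.add h.smoothOn_alphaFn h.smoothOn_absBeta]
  ring

theorem fundTensor_eq (h : IsRanders U a b)
    (hF : ∀ z ∈ U, ∀ η, F z η = Real.sqrt (sesqForm (a z) η η).re + ‖linForm (b z) η‖)
    (hp : (z, η) ∈ randersDomain U b) (i m : Fin n) :
    fundTensor F z η i m =
      2 * (dEta i (alphaFn a) z η + dEta i (absBeta b) z η)
        * (dEtaBar m (alphaFn a) z η + dEtaBar m (absBeta b) z η)
      + 2 * (alphaFn a z η + absBeta b z η) * (a z i m / (2 * alphaFn a z η)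
        - lower (a z) η i * lowerBar (a z) η m / (4 * alphaFn a z η ^ 3)
        + b z i * conj (b z m) / (4 * absBeta b z η)) := by
  have hΩ := h.isOpen_domain
  have hD := IsDerivationAt.dEta hΩ hp i
  have e := hD.congr (f := dEtaBar m (sqMetric F))
    (g := fun z η => (2 * (alphaFn a z η + absBeta b z η))
      * (dEtaBar m (alphaFn a) z η + dEtaBar m (absBeta b) z η)) fun z η hp =>
    h.derivation_sqMetric hF (IsDerivationAt.dEtaBar hΩ hp m)
  have hs := h.smoothOn_alphaFn.add h.smoothOn_absBeta
  rw [hD.mul ((SmoothOn.const 2).mul hs) ((h.smoothOn_alphaFn.dEtaBar hΩ m).add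
      (h.smoothOn_absBeta.dEtaBar hΩ m)), hD.const_mul _ hs,
    hD.add h.smoothOn_alphaFn h.smoothOn_absBeta, hD.add (h.smoothOn_alphaFn.dEtaBar hΩ m)
      (h.smoothOn_absBeta.dEtaBar hΩ m), h.dEta_dEtaBar_alphaFn hp,
    h.dEta_dEtaBar_absBeta hp] at e
  exact e

/-- Solution of the linear system `g_{k m̄} θᵏ = 2 F Rₘ` with `Rₘ η̄ᵐ = 0`, where `g` is the
fundamental tensor of a Randers metric. -/
theorem solve_fundTensor (h : IsRanders U a b)
    (hF : ∀ z ∈ U, ∀ η, F z η = Real.sqrt (sesqForm (a z) η η).re + ‖linForm (b z) η‖)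
    (hp : (z, η) ∈ randersDomain U b) {θ R : Fin n → ℂ}
    (hθ : ∀ m, ∑ k, θ k * fundTensor F z η k m
      = 2 * (alphaFn a z η + absBeta b z η) * R m)
    (hR : ∑ m, R m * conj (η m) = 0) :
    absBeta b z η * sesqForm (a z) θ η
        + alphaFn a z η * conj (linForm (b z) η) * linForm (b z) θ = 0 ∧
    (∀ m, lowerBar (a z) θ m / (2 * alphaFn a z η)
      - sesqForm (a z) θ η * lowerBar (a z) η m / (4 * alphaFn a z η ^ 3)
      + linForm (b z) θ * conj (b z m) / (4 * absBeta b z η) = R m) ∧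
    linForm (b z) θ * (2 * alphaFn a z η * absBeta b z η + absBeta b z η ^ 2
      + normB a b z * alphaFn a z η ^ 2)
      = 4 * alphaFn a z η ^ 2 * absBeta b z η * ∑ m, R m * conj (sharp a b z m) := by
  have hα := h.alphaFn_ne hp
  have hγ := absBeta_ne hp
  have hα2 := h.alphaFn_mul_self hp.1 η
  have hγ2 := absBeta_mul_self (b := b) z η
  have hFne : alphaFn a z η + absBeta b z η ≠ 0 := by
    have h1 : 0 < ‖linForm (b z) η‖ := norm_pos_iff.2 hp.2
    have h2 : 0 ≤ Real.sqrt (sesqForm (a z) η η).re := Real.sqrt_nonneg _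
    rw [alphaFn, absBeta, ← Complex.ofReal_add, Complex.ofReal_ne_zero]
    positivity
  set α := alphaFn a z η with hαdef
  set γ := absBeta b z η with hγdef
  set x := linForm (b z) θ with hx
  set y := sesqForm (a z) θ η with hy
  set β := linForm (b z) η with hβ
  have hαm : ∀ m, dEtaBar m (alphaFn a) z η = lowerBar (a z) η m / (2 * α) := fun m => by
    rw [eq_div_iff (mul_ne_zero two_ne_zero hα), mul_comm]; exact h.dEtaBar_alphaFn hp m
  have hγm : ∀ m, dEtaBar m (absBeta b) z η = β * conj (b z m) / (2 * γ) := fun m => by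
    rw [eq_div_iff (mul_ne_zero two_ne_zero hγ), mul_comm]; exact h.dEtaBar_absBeta hp m
  have hαi : ∀ m, dEta m (alphaFn a) z η = lower (a z) η m / (2 * α) := fun m => by
    rw [eq_div_iff (mul_ne_zero two_ne_zero hα), mul_comm]; exact h.dEta_alphaFn hp m
  have hγi : ∀ m, dEta m (absBeta b) z η = conj β * b z m / (2 * γ) := fun m => by
    rw [eq_div_iff (mul_ne_zero two_ne_zero hγ), mul_comm]; exact h.dEta_absBeta hp m
  -- The derivative of F = α + |β| in the direction θ.
  set Fθ := y / (2 * α) + conj β * x / (2 * γ) with hFθ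
  have hsum : ∀ m, ∑ k, θ k * fundTensor F z η k m
      = 2 * Fθ * (lowerBar (a z) η m / (2 * α) + β * conj (b z m) / (2 * γ))
        + 2 * (α + γ) * (lowerBar (a z) θ m / (2 * α) - y * lowerBar (a z) η m / (4 * α ^ 3)
          + x * conj (b z m) / (4 * γ)) := by
    intro m
    have h1 : lowerBar (a z) θ m = ∑ k, θ k * a z k m :=
      Finset.sum_congr rfl fun k _ => mul_comm _ _
    have h2 : y = ∑ k, θ k * lower (a z) η k := by
      rw [hy, sesqForm_eq_sum_lower]; exact Finset.sum_congr rfl fun k _ => mul_comm _ _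
    have h3 : x = ∑ k, θ k * b z k := Finset.sum_congr rfl fun k _ => mul_comm _ _
    simp only [hFθ]
    rw [h1, h2, h3]
    simp only [Finset.mul_sum, Finset.sum_mul, Finset.sum_div, ← Finset.sum_add_distrib,
      ← Finset.sum_sub_distrib]
    refine Finset.sum_congr rfl fun k _ => ?_
    rw [h.fundTensor_eq hF hp, hαm, hγm, hαi, hγi]
    ring
  have c1 : ∑ m, lowerBar (a z) η m * conj (η m) = α * α := by
    rw [hα2, sesqForm_eq_sum_lowerBar]
  have c2 : ∑ m, conj (b z m) * conj (η m) = conj β := by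
    simp only [hβ, linForm, map_sum, map_mul]
  have c3 : ∑ m, lowerBar (a z) θ m * conj (η m) = y := by
    rw [hy, sesqForm_eq_sum_lowerBar]
  have hcontr : 2 * Fθ * (α * α / (2 * α) + β * conj β / (2 * γ))
        + 2 * (α + γ) * (y / (2 * α) - y * (α * α) / (4 * α ^ 3)
          + x * conj β / (4 * γ)) = 0 := by
    have e : ∑ m, (∑ k, θ k * fundTensor F z η k m) * conj (η m) = 0 := by
      simp only [hθ, mul_assoc]
      rw [← Finset.mul_sum, ← Finset.mul_sum, hR]; ring
    have e' : ∀ m, ∑ k, θ k * fundTensor F z η k m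
        = (2 * Fθ / (2 * α) - 2 * (α + γ) * y / (4 * α ^ 3)) * lowerBar (a z) η m
          + (2 * Fθ * β / (2 * γ) + 2 * (α + γ) * x / (4 * γ)) * conj (b z m)
          + 2 * (α + γ) / (2 * α) * lowerBar (a z) θ m := fun m => by rw [hsum m]; ring
    simp only [e'] at e
    rw [sum_linComb₃_mul, c1, c2, c3] at e
    linear_combination e
  -- By homogeneity, contracting g·θ with η̄ gives 2F times `Fθ`. Since R is orthogonal to η̄, θ is
  -- tangent to the level set of F, and the rank one part of g drops out of the system.
  have hFθ0 : Fθ = 0 := by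
    have e : 2 * Fθ * (α * α / (2 * α) + β * conj β / (2 * γ))
        + 2 * (α + γ) * (y / (2 * α) - y * (α * α) / (4 * α ^ 3)
          + x * conj β / (4 * γ)) = 2 * (α + γ) * Fθ := by
      rw [← hγ2, hFθ]; field_simp; ring
    rw [e] at hcontr
    simpa [hFne] using hcontr
  have hi : γ * y + α * conj β * x = 0 := by
    have : γ * y + α * conj β * x = 2 * α * γ * Fθ := by rw [hFθ]; field_simp
    rw [this, hFθ0, mul_zero]
  have hii : ∀ m, lowerBar (a z) θ m / (2 * α) - y * lowerBar (a z) η m / (4 * α ^ 3)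
          + x * conj (b z m) / (4 * γ) = R m := by
    intro m
    have e := (hsum m).symm.trans (hθ m)
    rw [hFθ0, mul_zero, zero_mul, zero_add] at e
    exact mul_left_cancel₀ (mul_ne_zero two_ne_zero hFne) e
  refine ⟨hi, hii, ?_⟩
  have d1 : ∑ m, lowerBar (a z) θ m * conj (sharp a b z m) = x := by
    rw [← sesqForm_eq_sum_lowerBar, h.sesqForm_sharp hp.1]
  have d2 : ∑ m, lowerBar (a z) η m * conj (sharp a b z m) = β := by
    rw [← sesqForm_eq_sum_lowerBar, h.sesqForm_sharp hp.1]
  have d3 : ∑ m, conj (b z m) * conj (sharp a b z m) = (normB a b z : ℂ) := by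
    rw [← Complex.conj_ofReal, ← h.linForm_sharp hp.1]
    simp only [linForm, map_sum, map_mul]
  -- Contraction with the conjugate of b♯ turns the vector equation into a scalar one for x and y; y
  -- is then eliminated through `hi`.
  have e : ∑ m, R m * conj (sharp a b z m)
      = x / (2 * α) - y * β / (4 * α ^ 3) + x * normB a b z / (4 * γ) := by
    have e' : ∀ m, R m = 1 / (2 * α) * lowerBar (a z) θ m
        + -y / (4 * α ^ 3) * lowerBar (a z) η m + x / (4 * γ) * conj (b z m) := fun m => by
      rw [← hii]; ring
    simp only [e']
    rw [sum_linComb₃_mul, d1, d2, d3]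
    ring
  rw [e]
  field_simp
  have hi2 : γ * y * β + α * x * (γ * γ) = 0 := by rw [hγ2]; linear_combination β * hi
  linear_combination 2 * hi2

end IsRanders


/-! ### Polarization in η̄ of identities with coefficients holomorphic in η. -/

section Polarization

variable {n : ℕ} {Ω : Set (Cn n × Cn n)} {f g : Cn n → Cn n → ℂ} {z η : Cn n}

/-- Contract `sum_spray_mul` with η̄. Equivalently, L is constant along its own spray. -/
theorem IsMetricOn.sum_spray_mul_dEta {Φ : Cn n → Cn n → ℝ} (h : IsMetricOn Ω Φ)
    (hp : (z, η) ∈ Ω) : 2 * ∑ i, spray Φ i z η * dEta i (sqMetric Φ) z η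
      = ∑ j, η j * dz j (sqMetric Φ) z η := by
  have e : ∀ j, dz j (sqMetric Φ) z η
      = ∑ q, conj (η q) * dz j (dEtaBar q (sqMetric Φ)) z η := fun j => by
    have := h.eulerBar.dz h.isOpen h.smooth j z η hp
    rw [one_mul] at this
    rw [← this]
    exact Finset.sum_congr rfl fun q _ => by
      rw [(isDirectional_dEtaBar Ω q).comm (isDirectional_dz Ω j) h.isOpen h.smooth hp]
  calc _ = ∑ q, conj (η q) * (2 * ∑ i, spray Φ i z η * fundTensor Φ z η i q) := by
        simp only [← h.sum_fundTensor_mul_conj hp, Finset.mul_sum]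
        rw [Finset.sum_comm]
        exact Finset.sum_congr rfl fun i _ => Finset.sum_congr rfl fun j _ => by ring
    _ = _ := by
        simp only [h.sum_spray_mul hp, e, Finset.mul_sum]
        rw [Finset.sum_comm]
        exact Finset.sum_congr rfl fun i _ => Finset.sum_congr rfl fun j _ => by ring

/-- Smooth functions which are holomorphic in `η`. -/
def HolOn (Ω : Set (Cn n × Cn n)) (f : Cn n → Cn n → ℂ) : Prop :=
  SmoothOn Ω f ∧ ∀ k z η, (z, η) ∈ Ω → dEtaBar k f z η = 0

namespace HolOn

theorem add (hΩ : IsOpen Ω) (hf : HolOn Ω f) (hg : HolOn Ω g) :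
    HolOn Ω (fun z η => f z η + g z η) :=
  ⟨hf.1.add hg.1, fun k z η hp => by
    rw [(IsDerivationAt.dEtaBar hΩ hp k).add hf.1 hg.1, hf.2 k z η hp, hg.2 k z η hp, add_zero]⟩

theorem sub (hΩ : IsOpen Ω) (hf : HolOn Ω f) (hg : HolOn Ω g) :
    HolOn Ω (fun z η => f z η - g z η) :=
  ⟨hf.1.sub hg.1, fun k z η hp => by
    rw [(IsDerivationAt.dEtaBar hΩ hp k).sub hf.1 hg.1, hf.2 k z η hp, hg.2 k z η hp, sub_zero]⟩

theorem mul (hΩ : IsOpen Ω) (hf : HolOn Ω f) (hg : HolOn Ω g) :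
    HolOn Ω (fun z η => f z η * g z η) :=
  ⟨hf.1.mul hg.1, fun k z η hp => by
    rw [(IsDerivationAt.dEtaBar hΩ hp k).mul hf.1 hg.1, hf.2 k z η hp, hg.2 k z η hp, zero_mul,
      mul_zero, add_zero]⟩

theorem sum (hΩ : IsOpen Ω) {ι : Type*} {s : Finset ι} {F : ι → Cn n → Cn n → ℂ}
    (hF : ∀ i ∈ s, HolOn Ω (F i)) : HolOn Ω (fun z η => ∑ i ∈ s, F i z η) :=
  ⟨SmoothOn.sum fun i hi => (hF i hi).1, fun k z η hp => by
    rw [(IsDerivationAt.dEtaBar hΩ hp k).sum fun i hi => (hF i hi).1]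
    exact Finset.sum_eq_zero fun i hi => (hF i hi).2 k z η hp⟩

theorem base {c : Cn n → ℂ} (hc : SmoothOn Ω (fun z _ => c z)) : HolOn Ω (fun z _ => c z) :=
  ⟨hc, fun k z η _ => dEtaBar_base c k z η⟩

theorem const (c : ℂ) : HolOn Ω (fun _ _ => c) := base (c := fun _ => c) (SmoothOn.const c)

theorem coord (i : Fin n) : HolOn Ω (fun _ η => η i) :=
  ⟨SmoothOn.coord i, fun k z η _ => dEtaBar_coord k i z η⟩

end HolOn

/-- The derivative in the direction `Σ ξ_q ∂/∂η̄^q`. -/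
def dBarDir (ξ : Fin n → ℂ) (f : Cn n → Cn n → ℂ) (z η : Cn n) : ℂ := ∑ q, ξ q * dEtaBar q f z η

theorem dBarDir_derivation (hΩ : IsOpen Ω) (ξ : Fin n → ℂ) (z η : Cn n) (hp : (z, η) ∈ Ω) :
    IsDerivationAt Ω z η (fun f => dBarDir ξ f z η) :=
  IsDerivationAt.linComb (fun q => IsDerivationAt.dEtaBar hΩ hp q) ξ

/-- `f` has constant derivative `f'` under `X`. -/
structure AffineFor (Ω : Set (Cn n × Cn n)) (X : (Cn n → Cn n → ℂ) → Cn n → Cn n → ℂ)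
    (f f' : Cn n → Cn n → ℂ) : Prop where
  smooth : SmoothOn Ω f
  smooth' : SmoothOn Ω f'
  deriv : ∀ z η, (z, η) ∈ Ω → X f z η = f' z η
  deriv' : ∀ z η, (z, η) ∈ Ω → X f' z η = 0

/-- A function `c_q η̄^q` with `c_q` holomorphic in `η`. -/
theorem affineFor_antilinear (hΩ : IsOpen Ω) {c : Fin n → Cn n → Cn n → ℂ}
    (hc : ∀ q, HolOn Ω (c q)) (ξ : Fin n → ℂ) :
    AffineFor Ω (dBarDir ξ) (fun z η => ∑ q, c q z η * conj (η q))
      (fun z η => ∑ q, c q z η * ξ q) where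
  smooth := SmoothOn.sum fun q _ => (hc q).1.mul (SmoothOn.coord q).conjugate
  smooth' := SmoothOn.sum fun q _ => (hc q).1.mul (SmoothOn.const _)
  deriv z η hp := by
    have hD := dBarDir_derivation hΩ ξ z η hp
    rw [hD.sum_mul (F := c) (G := fun q _ η => conj (η q)) (fun q => (hc q).1)
      (fun q => (SmoothOn.coord q).conjugate)]
    refine Finset.sum_congr rfl fun q _ => ?_
    simp only [dBarDir]
    simp [(hc q).2 _ z η hp, dEtaBar_conj_coord]
  deriv' z η hp := by
    have hD := dBarDir_derivation hΩ ξ z η hp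
    rw [hD.sum_mul (F := c) (G := fun q _ _ => ξ q) (fun q => (hc q).1)
      (fun q => SmoothOn.const _)]
    refine Finset.sum_eq_zero fun q _ => ?_
    rw [hD.const]
    simp [dBarDir, (hc q).2 _ z η hp]

variable {X : (Cn n → Cn n → ℂ) → Cn n → Cn n → ℂ}

/-- With X the derivative in the direction ξ̄ this replaces η̄ by ξ in an identity linear in η̄. -/
theorem AffineFor.eq_zero (hX : ∀ z η, (z, η) ∈ Ω → IsDerivationAt Ω z η (fun f => X f z η))
    {f f' : Cn n → Cn n → ℂ} (hf : AffineFor Ω X f f') (h0 : ∀ z η, (z, η) ∈ Ω → f z η = 0)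
    (hp : (z, η) ∈ Ω) : f' z η = 0 := by
  rw [← hf.deriv z η hp, (hX z η hp).congr h0]
  exact (hX z η hp).const 0

/-- The second derivative of a product of two affine functions is twice the product of their slopes;
this polarizes an identity quadratic in η̄. -/
theorem AffineFor.sum_two_mul (hX : ∀ z η, (z, η) ∈ Ω → IsDerivationAt Ω z η (fun f => X f z η))
    {f f' g g' k k' l l' : Cn n → Cn n → ℂ} (hf : AffineFor Ω X f f') (hg : AffineFor Ω X g g')
    (hk : AffineFor Ω X k k') (hl : AffineFor Ω X l l')
    (h0 : ∀ z η, (z, η) ∈ Ω → f z η * g z η + k z η * l z η = 0) (hp : (z, η) ∈ Ω) :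
    f' z η * g' z η + k' z η * l' z η = 0 := by
  have h1 : ∀ z η, (z, η) ∈ Ω → (f' z η * g z η + f z η * g' z η)
      + (k' z η * l z η + k z η * l' z η) = 0 := by
    intro z η hp
    have hD := hX z η hp
    rw [← hf.deriv z η hp, ← hg.deriv z η hp, ← hk.deriv z η hp, ← hl.deriv z η hp,
      ← hD.mul hf.smooth hg.smooth, ← hD.mul hk.smooth hl.smooth,
      ← hD.add (hf.smooth.mul hg.smooth) (hk.smooth.mul hl.smooth), hD.congr h0]
    exact hD.const 0
  have hD := hX z η hp
  have h2 := hD.congr h1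
  have s1 := hf.smooth'.mul hg.smooth
  have s2 := hf.smooth.mul hg.smooth'
  have s3 := hk.smooth'.mul hl.smooth
  have s4 := hk.smooth.mul hl.smooth'
  rw [hD.const, hD.add (s1.add s2) (s3.add s4), hD.add s1 s2, hD.add s3 s4,
    hD.mul hf.smooth' hg.smooth, hD.mul hf.smooth hg.smooth', hD.mul hk.smooth' hl.smooth,
    hD.mul hk.smooth hl.smooth', hf.deriv z η hp, hg.deriv z η hp, hk.deriv z η hp,
    hl.deriv z η hp, hf.deriv' z η hp, hg.deriv' z η hp, hk.deriv' z η hp, hl.deriv' z η hp] at h2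
  linear_combination h2 / 2

/-- The third derivative of `f g²` when `f` and `g` have constant derivatives. -/
theorem AffineFor.mul_sq_deriv
    (hX : ∀ z η, (z, η) ∈ Ω → IsDerivationAt Ω z η (fun f => X f z η))
    {f f' g g' : Cn n → Cn n → ℂ} (hf : AffineFor Ω X f f') (hg : AffineFor Ω X g g')
    (hp : (z, η) ∈ Ω) :
    X (X (X (fun z η => f z η * (g z η * g z η)))) z η = 6 * (f' z η * (g' z η * g' z η)) := by
  have sgg := hg.smooth.mul hg.smooth
  have sgg' := hg.smooth'.mul hg.smooth
  have sg'g' := hg.smooth'.mul hg.smooth'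
  have h1 : ∀ z η, (z, η) ∈ Ω → X (fun z η => f z η * (g z η * g z η)) z η
      = f' z η * (g z η * g z η) + 2 * (f z η * (g' z η * g z η)) := by
    intro z η hp
    have hD := hX z η hp
    rw [hD.mul hf.smooth sgg, hD.mul hg.smooth hg.smooth, hf.deriv z η hp, hg.deriv z η hp]
    ring
  have h2 : ∀ z η, (z, η) ∈ Ω → X (X (fun z η => f z η * (g z η * g z η))) z η
      = 4 * (f' z η * (g' z η * g z η)) + 2 * (f z η * (g' z η * g' z η)) := by
    intro z η hp
    have hD := hX z η hp
    rw [hD.congr h1, hD.add (hf.smooth'.mul sgg) ((SmoothOn.const 2).mul (hf.smooth.mul sgg')),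
      hD.const_mul _ (hf.smooth.mul sgg'), hD.mul hf.smooth' sgg, hD.mul hf.smooth sgg',
      hD.mul hg.smooth hg.smooth, hD.mul hg.smooth' hg.smooth, hf.deriv z η hp, hg.deriv z η hp,
      hf.deriv' z η hp, hg.deriv' z η hp]
    ring
  have hD := hX z η hp
  rw [hD.congr h2, hD.add ((SmoothOn.const 4).mul (hf.smooth'.mul sgg'))
      ((SmoothOn.const 2).mul (hf.smooth.mul sg'g')),
    hD.const_mul _ (hf.smooth'.mul sgg'), hD.const_mul _ (hf.smooth.mul sg'g'),
    hD.mul hf.smooth' sgg', hD.mul hf.smooth sg'g', hD.mul hg.smooth' hg.smooth,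
    hD.mul hg.smooth' hg.smooth', hf.deriv z η hp, hg.deriv z η hp, hf.deriv' z η hp,
    hg.deriv' z η hp]
  ring

/-- The cubic counterpart: the third derivative of each side is six times the same product of
slopes. -/
theorem AffineFor.mul_sq_eq (hX : ∀ z η, (z, η) ∈ Ω → IsDerivationAt Ω z η (fun f => X f z η))
    {f f' g g' k k' l l' : Cn n → Cn n → ℂ} (hf : AffineFor Ω X f f') (hg : AffineFor Ω X g g')
    (hk : AffineFor Ω X k k') (hl : AffineFor Ω X l l')
    (h0 : ∀ z η, (z, η) ∈ Ω → f z η * (g z η * g z η) = k z η * (l z η * l z η))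
    (hp : (z, η) ∈ Ω) :
    f' z η * (g' z η * g' z η) = k' z η * (l' z η * l' z η) := by
  have e1 : ∀ z η, (z, η) ∈ Ω → X (fun z η => f z η * (g z η * g z η)) z η
      = X (fun z η => k z η * (l z η * l z η)) z η := fun z η hp => (hX z η hp).congr h0
  have e2 : ∀ z η, (z, η) ∈ Ω → X (X (fun z η => f z η * (g z η * g z η))) z η
      = X (X (fun z η => k z η * (l z η * l z η))) z η := fun z η hp => (hX z η hp).congr e1
  have e3 := (hX z η hp).congr e2
  rw [hf.mul_sq_deriv hX hg hp, hk.mul_sq_deriv hX hl hp] at e3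
  exact mul_left_cancel₀ (by norm_num) e3

end Polarization

/-! ### Linear algebra of linear forms -/

section LinForm

variable {n : ℕ}

/-- A linear form has nonzero kernel vectors because n ≥ 2; this is where the dimension enters. -/
theorem exists_ker_ne_zero (hn : 2 ≤ n) (c : Fin n → ℂ) : ∃ w : Cn n, w ≠ 0 ∧ linForm c w = 0 := by
  have hs : ∀ i : Fin n, linForm c (Pi.single i 1) = c i := fun i => by
    simp [linForm, Pi.single_apply]
  let i0 : Fin n := ⟨0, by omega⟩
  let i1 : Fin n := ⟨1, by omega⟩
  have hne : i0 ≠ i1 := by simp [i0, i1, Fin.ext_iff]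
  by_cases h0 : c i1 = 0
  · exact ⟨Pi.single i1 1, by simp, by rw [hs, h0]⟩
  · refine ⟨c i1 • Pi.single i0 1 + (-c i0) • Pi.single i1 1, fun h => h0 ?_, ?_⟩
    · have := congrFun h i0
      simpa [Pi.single_apply, hne] using this
    · rw [linForm_add, linForm_smul, linForm_smul, hs, hs]; ring

theorem eq_zero_of_linForm {c : Fin n → ℂ} (h : ∀ ξ, linForm c ξ = 0) : c = 0 := by
  funext i
  have := h (Pi.single i 1)
  simpa [linForm, Pi.single_apply] using this

theorem exists_linForm_ne {c : Fin n → ℂ} (h : c ≠ 0) : ∃ ξ, linForm c ξ ≠ 0 := by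
  by_contra! h0
  exact h (eq_zero_of_linForm h0)

/-- If `l x² = k b y²` for linear forms with `l`, `b` independent, then `y = 0`. -/
theorem linForm_eq_zero_of_mul_sq {l x b y : Fin n → ℂ} {k : ℂ} (hk : k ≠ 0) (hb : b ≠ 0)
    (hw : ∃ w, linForm b w = 0 ∧ linForm l w ≠ 0)
    (h : ∀ ξ, linForm l ξ * (linForm x ξ * linForm x ξ)
      = k * linForm b ξ * (linForm y ξ * linForm y ξ)) : y = 0 := by
  obtain ⟨w, hbw, hlw⟩ := hw
  obtain ⟨v0, hv0⟩ := exists_linForm_ne hb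
  -- The pair (v, w) is dual to (l, b) up to scaling: l(v) = 0 and b(w) = 0, with b(v) and l(w)
  -- nonzero.
  set v := v0 + (-(linForm l v0 / linForm l w)) • w with hv
  have hlv : linForm l v = 0 := by rw [hv, linForm_add, linForm_smul]; field_simp; ring
  have hbv : linForm b v ≠ 0 := by rw [hv, linForm_add, linForm_smul, hbw]; simpa using hv0
  have hyv : linForm y v = 0 := by
    have := h v
    rw [hlv, zero_mul] at this
    simpa [hk, hbv] using this.symm
  have hxw : linForm x w = 0 := by
    have := h w
    rw [hbw, mul_zero, zero_mul] at this
    simpa [hlw] using this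
  -- On v + t w the left side is linear in t, since x(w) = 0, and the right side is quadratic, since
  -- y(v) = 0. Comparing t = 1 with t = 2 kills the quadratic coefficient.
  have hyw : linForm y w = 0 := by
    have e1 := h (v + w)
    have e2 := h (v + (2 : ℂ) • w)
    simp only [linForm_add, linForm_smul, hlv, hbw, hyv, hxw] at e1 e2
    have e3 : k * linForm b v * (linForm y w * linForm y w) = 0 := by
      linear_combination e1 - e2 / 2
    simpa [hk, hbv] using e3
  refine eq_zero_of_linForm fun ξ => ?_
  -- The projection of ξ to the common kernel of l and b; evaluating the hypothesis at u + v
  -- isolates y(u)².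
  set u := ξ + (-(linForm l ξ / linForm l w)) • w + (-(linForm b ξ / linForm b v)) • v with hu
  have hlu : linForm l u = 0 := by
    rw [hu, linForm_add, linForm_add, linForm_smul, linForm_smul, hlv]; field_simp; ring
  have hbu : linForm b u = 0 := by
    rw [hu, linForm_add, linForm_add, linForm_smul, linForm_smul, hbw]; field_simp; ring
  have hyu : linForm y u = 0 := by
    have e1 := h (u + v)
    simp only [linForm_add, hlv, hlu, hbu, hyv] at e1
    rw [add_zero, zero_mul, zero_add, add_zero] at e1
    simpa [hk, hbv] using e1.symm
  rw [hu, linForm_add, linForm_add, linForm_smul, linForm_smul, hyw, hyv] at hyu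
  simpa using hyu

end LinForm

/-! ### Nondegeneracy of α + |β| where β ≠ 0. -/

namespace IsRanders

variable {n : ℕ} {U : Set (Cn n)} {a : Cn n → Fin n → Fin n → ℂ} {b : Cn n → Fin n → ℂ}
  {z η : Cn n} {D : (Cn n → Cn n → ℂ) → ℂ} {F : Cn n → Cn n → ℝ}

theorem denom_ne (h : IsRanders U a b) (hp : (z, η) ∈ randersDomain U b) :
    2 * alphaFn a z η * absBeta b z η + absBeta b z η ^ 2
      + normB a b z * alphaFn a z η ^ 2 ≠ 0 := by
  have h1 : 0 < ‖linForm (b z) η‖ := norm_pos_iff.2 hp.2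
  have h2 : 0 ≤ Real.sqrt (sesqForm (a z) η η).re := Real.sqrt_nonneg _
  have h3 := h.normB_pos hp.1
  have : (0 : ℝ) < 2 * Real.sqrt (sesqForm (a z) η η).re * ‖linForm (b z) η‖
      + ‖linForm (b z) η‖ ^ 2 + normB a b z * Real.sqrt (sesqForm (a z) η η).re ^ 2 := by
    positivity
  rw [alphaFn, absBeta]
  exact_mod_cast this.ne'

/-- A Randers metric is a complex Finsler metric where `β ≠ 0`. -/
theorem isMetricOn (h : IsRanders U a b)
    (hF : ∀ z ∈ U, ∀ η, F z η = Real.sqrt (sesqForm (a z) η η).re + ‖linForm (b z) η‖) :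
    IsMetricOn (randersDomain U b) F where
  isOpen := h.isOpen_domain
  smooth := by
    have hs := h.smoothOn_alphaFn.add h.smoothOn_absBeta
    exact (hs.mul hs).congr fun z η hp => sqMetric_eq hF hp.1 η
  euler := by
    intro z η hp
    have hE := euler_derivation h.isOpen_domain hp
    have e1 := h.derivation_alphaFn hE
    have e2 := h.derivation_absBeta hE
    simp only [h.herm.dEta_sesqForm h.isOpen_domain mem_base hp,
      dEta_linForm h.isOpen_domain h.smooth_b mem_base hp,
      dEta_conj_linForm h.isOpen_domain h.smooth_b mem_base hp] at e1 e2
    have e3 : ∑ k, η k * lower (a z) η k = alphaFn a z η * alphaFn a z η := by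
      rw [h.alphaFn_mul_self hp.1, sesqForm_eq_sum_lower]
      exact Finset.sum_congr rfl fun k _ => mul_comm _ _
    have e4 : ∑ k, η k * b z k = linForm (b z) η :=
      Finset.sum_congr rfl fun k _ => mul_comm _ _
    rw [e3] at e1
    rw [e4] at e2
    simp only [mul_zero, Finset.sum_const_zero, add_zero] at e2
    rw [← absBeta_mul_self] at e2
    have hα := h.alphaFn_ne hp
    have hγ := absBeta_ne hp
    have e5 : ∑ k, η k * dEta k (alphaFn a) z η = alphaFn a z η / 2 := by
      apply mul_left_cancel₀ (mul_ne_zero two_ne_zero hα); rw [e1]; ring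
    have e6 : ∑ k, η k * dEta k (absBeta b) z η = absBeta b z η / 2 := by
      apply mul_left_cancel₀ (mul_ne_zero two_ne_zero hγ); rw [e2]; ring
    rw [derivation_sqMetric h hF hE, e5, e6, sqMetric_eq hF hp.1]
    ring
  det_ne z η hp h0 := by
    obtain ⟨v, hv, h1⟩ := Matrix.exists_vecMul_eq_zero_iff.2 h0
    -- A kernel vector of g solves the linear system with R = 0; the positive factor in the third
    -- conclusion then gives β(v) = 0, and the rest follows.
    obtain ⟨i1, i2, i3⟩ := h.solve_fundTensor hF hp (θ := v) (R := fun _ => 0)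
      (fun m => by have := congrFun h1 m; simpa [Matrix.vecMul, dotProduct] using this) (by simp)
    have hx : linForm (b z) v = 0 := by
      simpa [h.denom_ne hp] using i3
    have hy : sesqForm (a z) v η = 0 := by
      simpa [hx, absBeta_ne hp] using i1
    refine h.herm.sesqForm_ne hp.1 hv ?_
    rw [sesqForm_eq_sum_lowerBar]
    refine Finset.sum_eq_zero fun j _ => ?_
    have := i2 j
    rw [hx, hy] at this
    have hj : lowerBar (a z) v j = 0 := by simpa [h.alphaFn_ne hp] using this
    rw [hj, zero_mul]

end IsRanders


/-- The derivation `ηʲ ∂ⱼ - 2 Gⁱ ∂̇ᵢ` along the spray of `Φ`. -/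
def sprayDeriv {n : ℕ} (Φ : Cn n → Cn n → ℝ) (f : Cn n → Cn n → ℂ) (z η : Cn n) : ℂ :=
  (∑ j, η j * dz j f z η) - 2 * ∑ i, spray Φ i z η * dEta i f z η

section

variable {n : ℕ} {Ω : Set (Cn n × Cn n)} {z η : Cn n} {Φ : Cn n → Cn n → ℝ}

theorem sprayDeriv_derivation (hΩ : IsOpen Ω) (hp : (z, η) ∈ Ω) :
    IsDerivationAt Ω z η (fun f => sprayDeriv Φ f z η) :=
  (IsDerivationAt.linComb (fun j => IsDerivationAt.dz hΩ hp j) _).sub'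
    ((IsDerivationAt.linComb (fun j => IsDerivationAt.dEta hΩ hp j) _).smul 2)

theorem IsMetricOn.sprayDeriv_sqMetric (h : IsMetricOn Ω Φ) (hp : (z, η) ∈ Ω) :
    sprayDeriv Φ (sqMetric Φ) z η = 0 := by
  rw [sprayDeriv, h.sum_spray_mul_dEta hp, sub_self]

end

/-! ### The spray of a generalized Berwald Randers metric. -/

namespace IsRanders

variable {n : ℕ} {U : Set (Cn n)} {a : Cn n → Fin n → Fin n → ℂ} {b : Cn n → Fin n → ℂ}
  {z η : Cn n} {F Φ : Cn n → Cn n → ℝ}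

theorem smoothOn_wirtinger (h : IsRanders U a b) {c : Cn n → ℂ} (hc : ContDiffOn ℝ ∞ c U)
    (j : Fin n) : SmoothOn (randersDomain U b) (fun z _ => wirtinger j c z) :=
  (SmoothOn.base hc mem_base).dz h.isOpen_domain j

theorem smooth_conj_b (h : IsRanders U a b) (i : Fin n) :
    ContDiffOn ℝ ∞ (fun z => conj (b z i)) U :=
  Complex.conjCLE.contDiff.comp_contDiffOn (h.smooth_b i)

theorem sprayDeriv_beta (h : IsRanders U a b) (hp : (z, η) ∈ randersDomain U b) :
    sprayDeriv Φ (fun z η => linForm (b z) η) z η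
      = ∑ j, η j * linForm (fun i => wirtinger j (fun z => b z i) z) η
        - 2 * ∑ i, spray Φ i z η * b z i := by
  simp only [sprayDeriv, dz_linForm h.isOpen_domain h.smooth_b mem_base hp,
    dEta_linForm h.isOpen_domain h.smooth_b mem_base hp]

/-- The coefficients `ηʲ ∂ⱼ b̄_q`. -/
def _root_.ComplexFinsler.dzConjB {n : ℕ} (b : Cn n → Fin n → ℂ) (q : Fin n) (z η : Cn n) : ℂ :=
  ∑ j, η j * wirtinger j (fun z => conj (b z q)) z

theorem sprayDeriv_conj_beta (h : IsRanders U a b) (hp : (z, η) ∈ randersDomain U b) :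
    sprayDeriv Φ (fun z η => conj (linForm (b z) η)) z η
      = ∑ q, dzConjB b q z η * conj (η q) := by
  simp only [sprayDeriv, dz_conj_linForm h.isOpen_domain h.smooth_b mem_base hp,
    dEta_conj_linForm h.isOpen_domain h.smooth_b mem_base hp, mul_zero, Finset.sum_const_zero,
    sub_zero, dzConjB, Finset.sum_mul, Finset.mul_sum]
  rw [Finset.sum_comm]
  exact Finset.sum_congr rfl fun i _ => Finset.sum_congr rfl fun j _ => by ring

theorem holOn_b (h : IsRanders U a b) (i : Fin n) : HolOn (randersDomain U b) (fun z _ => b z i) :=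
  HolOn.base (SmoothOn.base (h.smooth_b i) mem_base)

theorem holOn_conj_b (h : IsRanders U a b) (i : Fin n) :
    HolOn (randersDomain U b) (fun z _ => conj (b z i)) :=
  HolOn.base (SmoothOn.base (h.smooth_conj_b i) mem_base)

theorem holOn_a (h : IsRanders U a b) (i j : Fin n) :
    HolOn (randersDomain U b) (fun z _ => a z i j) :=
  HolOn.base (SmoothOn.base (h.herm.smooth i j) mem_base)

theorem holOn_linForm (h : IsRanders U a b) :
    HolOn (randersDomain U b) (fun z η => linForm (b z) η) :=
  HolOn.sum h.isOpen_domain fun i _ => (h.holOn_b i).mul h.isOpen_domain (HolOn.coord i)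

theorem holOn_lowerBar (h : IsRanders U a b) (q : Fin n) :
    HolOn (randersDomain U b) (fun z η => lowerBar (a z) η q) :=
  HolOn.sum h.isOpen_domain fun i _ => (h.holOn_a i q).mul h.isOpen_domain (HolOn.coord i)

theorem holOn_dzConjB (h : IsRanders U a b) (q : Fin n) :
    HolOn (randersDomain U b) (dzConjB b q) :=
  HolOn.sum h.isOpen_domain fun j _ => (HolOn.coord j).mul h.isOpen_domain
    (HolOn.base (h.smoothOn_wirtinger (h.smooth_conj_b q) j))

theorem isMetricOn_alpha (h : IsRanders U a b)
    (hΦ : ∀ z ∈ U, ∀ η, Φ z η = Real.sqrt (sesqForm (a z) η η).re) :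
    IsMetricOn (randersDomain U b) Φ :=
  h.herm.isMetricOn hΦ h.isOpen_domain mem_base

theorem holOn_spray_alpha (h : IsRanders U a b)
    (hΦ : ∀ z ∈ U, ∀ η, Φ z η = Real.sqrt (sesqForm (a z) η η).re) (i : Fin n) :
    HolOn (randersDomain U b) (spray Φ i) :=
  ⟨(h.isMetricOn_alpha hΦ).smooth_spray i, fun k _ _ hp =>
    h.herm.dEtaBar_spray hΦ h.isOpen_domain mem_base hp i k⟩

theorem holOn_sprayDeriv_beta (h : IsRanders U a b)
    (hΦ : ∀ z ∈ U, ∀ η, Φ z η = Real.sqrt (sesqForm (a z) η η).re) :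
    HolOn (randersDomain U b) (fun z η =>
      ∑ j, η j * linForm (fun i => wirtinger j (fun z => b z i) z) η
        - 2 * ∑ i, spray Φ i z η * b z i) := by
  have hΩ := h.isOpen_domain
  exact (HolOn.sum hΩ fun j _ => (HolOn.coord j).mul hΩ (HolOn.sum hΩ fun i _ =>
    (HolOn.base (h.smoothOn_wirtinger (h.smooth_b i) j)).mul hΩ (HolOn.coord i))).sub hΩ
    ((HolOn.const 2).mul hΩ (HolOn.sum hΩ fun i _ =>
      (h.holOn_spray_alpha hΦ i).mul hΩ (h.holOn_b i)))

/-- Comparison of the sprays of `α + |β|` and of `α`. -/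
theorem alphaFn_mul_eq (h : IsRanders U a b)
    (hF : ∀ z ∈ U, ∀ η, F z η = Real.sqrt (sesqForm (a z) η η).re + ‖linForm (b z) η‖)
    (hΦ : ∀ z ∈ U, ∀ η, Φ z η = Real.sqrt (sesqForm (a z) η η).re)
    (hp : (z, η) ∈ randersDomain U b) {K : Fin n → ℂ}
    (hK : ∀ i, spray F i z η = spray Φ i z η + K i) :
    alphaFn a z η * (sprayDeriv Φ (fun z η => linForm (b z) η) z η * conj (linForm (b z) η)
      + linForm (b z) η * sprayDeriv Φ (fun z η => conj (linForm (b z) η)) z η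
      - 2 * linForm (b z) K * conj (linForm (b z) η))
      = absBeta b z η * (2 * sesqForm (a z) K η) := by
  have hΩ := h.isOpen_domain
  have hD := sprayDeriv_derivation (Φ := Φ) hΩ hp
  have hα := h.alphaFn_ne hp
  have hγ := absBeta_ne hp
  have hFne : alphaFn a z η + absBeta b z η ≠ 0 := by
    have h1 : 0 < ‖linForm (b z) η‖ := norm_pos_iff.2 hp.2
    have h2 : 0 ≤ Real.sqrt (sesqForm (a z) η η).re := Real.sqrt_nonneg _
    rw [alphaFn, absBeta, ← Complex.ofReal_add, Complex.ofReal_ne_zero]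
    positivity
  have e1 := h.derivation_alphaFn hD
  have e0 : sprayDeriv Φ (fun z η => sesqForm (a z) η η) z η = 0 := by
    rw [← (h.isMetricOn_alpha hΦ).sprayDeriv_sqMetric hp]
    exact hD.congr fun z η hp => (h.herm.sqMetric_eq hΦ hp.1 η).symm
  rw [e0] at e1
  -- α² is constant along the spray of α, hence so is α.
  have e2 : sprayDeriv Φ (alphaFn a) z η = 0 := by simpa [hα] using e1
  have e3 := h.derivation_absBeta hD
  -- F² is constant along the spray of F, so its derivative along the spray of α is accounted for by
  -- the difference K alone.
  have e4 : sprayDeriv Φ (sqMetric F) z η = 2 * ∑ i, K i * dEta i (sqMetric F) z η := by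
    have := (h.isMetricOn hF).sum_spray_mul_dEta hp
    simp only [hK, add_mul, Finset.sum_add_distrib] at this
    rw [sprayDeriv, ← this]; ring
  rw [h.derivation_sqMetric hF hD, e2, zero_add] at e4
  have e5 : ∑ i, K i * dEta i (sqMetric F) z η = 2 * (alphaFn a z η + absBeta b z η)
      * ∑ i, K i * (dEta i (alphaFn a) z η + dEta i (absBeta b) z η) := by
    rw [Finset.mul_sum]
    exact Finset.sum_congr rfl fun i _ => by
      rw [h.derivation_sqMetric hF (IsDerivationAt.dEta hΩ hp i)]; ring
  rw [e5] at e4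
  have e6 : sprayDeriv Φ (absBeta b) z η
      = 2 * ∑ i, K i * (dEta i (alphaFn a) z η + dEta i (absBeta b) z η) := by
    apply mul_left_cancel₀ (mul_ne_zero two_ne_zero hFne)
    rw [e4]; ring
  have e7 : 2 * alphaFn a z η * absBeta b z η
      * ∑ i, K i * (dEta i (alphaFn a) z η + dEta i (absBeta b) z η)
      = absBeta b z η * sesqForm (a z) K η
        + alphaFn a z η * conj (linForm (b z) η) * linForm (b z) K := by
    rw [sesqForm_eq_sum_lower, show linForm (b z) K = ∑ i, b z i * K i from rfl, Finset.mul_sum,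
      Finset.mul_sum, Finset.mul_sum, ← Finset.sum_add_distrib]
    refine Finset.sum_congr rfl fun i _ => ?_
    linear_combination absBeta b z η * K i * h.dEta_alphaFn hp i
      + alphaFn a z η * K i * h.dEta_absBeta hp i
  rw [← e3, e6]
  linear_combination 2 * e7

/-- A generalized Berwald complex Randers metric has the spray of `α`. -/
theorem spray_eq (h : IsRanders U a b) (hn : 2 ≤ n)
    (hF : ∀ z ∈ U, ∀ η, F z η = Real.sqrt (sesqForm (a z) η η).re + ‖linForm (b z) η‖)
    (hΦ : ∀ z ∈ U, ∀ η, Φ z η = Real.sqrt (sesqForm (a z) η η).re)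
    (hB : ∀ z η, (z, η) ∈ randersDomain U b → ∀ i k, dEtaBar k (spray F i) z η = 0)
    (hp : (z, η) ∈ randersDomain U b) (i : Fin n) : spray F i z η = spray Φ i z η := by
  have hΩ := h.isOpen_domain
  -- The difference of the sprays is holomorphic in η: for F this is the generalized Berwald
  -- condition, for α the spray is quadratic. Below, `cX` and `cY` are the coefficients of η̄ in the
  -- two sides of `alphaFn_mul_eq`.
  set K : Fin n → Cn n → Cn n → ℂ := fun i z η => spray F i z η - spray Φ i z η with hKdef
  have hKhol : ∀ i, HolOn (randersDomain U b) (K i) := fun i =>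
    HolOn.sub hΩ ⟨(h.isMetricOn hF).smooth_spray i, fun k z η hp => hB z η hp i k⟩
      (h.holOn_spray_alpha hΦ i)
  set cX : Fin n → Cn n → Cn n → ℂ := fun q z η =>
    (∑ j, η j * linForm (fun i => wirtinger j (fun z => b z i) z) η
        - 2 * ∑ i, spray Φ i z η * b z i) * conj (b z q) + linForm (b z) η * dzConjB b q z η
      - 2 * (∑ i, b z i * K i z η) * conj (b z q) with hcX
  set cY : Fin n → Cn n → Cn n → ℂ := fun q z η => 2 * ∑ i, a z i q * K i z η with hcY
  have hcXhol : ∀ q, HolOn (randersDomain U b) (cX q) := fun q =>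
    (((h.holOn_sprayDeriv_beta hΦ).mul hΩ (h.holOn_conj_b q)).add hΩ
      (h.holOn_linForm.mul hΩ (h.holOn_dzConjB q))).sub hΩ
      (((HolOn.const 2).mul hΩ (HolOn.sum hΩ fun i _ => (h.holOn_b i).mul hΩ (hKhol i))).mul hΩ
        (h.holOn_conj_b q))
  have hcYhol : ∀ q, HolOn (randersDomain U b) (cY q) := fun q =>
    (HolOn.const 2).mul hΩ (HolOn.sum hΩ fun i _ => (h.holOn_a i q).mul hΩ (hKhol i))
  -- Squaring α·X = |β|·Y removes both roots. Every factor is then linear in η̄ with coefficients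
  -- holomorphic in η.
  have main : ∀ z η, (z, η) ∈ randersDomain U b →
      (∑ q, lowerBar (a z) η q * conj (η q)) * ((∑ q, cX q z η * conj (η q))
        * (∑ q, cX q z η * conj (η q)))
      = (∑ q, (linForm (b z) η * conj (b z q)) * conj (η q)) * ((∑ q, cY q z η * conj (η q))
        * (∑ q, cY q z η * conj (η q))) := by
    intro z η hp
    have e := h.alphaFn_mul_eq hF hΦ hp (K := fun i => K i z η) fun i => by simp [hKdef]
    rw [h.sprayDeriv_beta hp, h.sprayDeriv_conj_beta hp] at e
    have eb : ∑ q, conj (b z q) * conj (η q) = conj (linForm (b z) η) := by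
      simp only [linForm, map_sum, map_mul]
    have eX : ∑ q, cX q z η * conj (η q)
        = (∑ j, η j * linForm (fun i => wirtinger j (fun z => b z i) z) η
        - 2 * ∑ i, spray Φ i z η * b z i) * conj (linForm (b z) η)
          + linForm (b z) η * ∑ q, dzConjB b q z η * conj (η q)
          - 2 * linForm (b z) (fun i => K i z η) * conj (linForm (b z) η) := by
      have e' := sum_linComb₃_mul
        (∑ j, η j * linForm (fun i => wirtinger j (fun z => b z i) z) η
          - 2 * ∑ i, spray Φ i z η * b z i) (linForm (b z) η)
        (-(2 * linForm (b z) (fun i => K i z η))) (fun q => conj (b z q))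
        (fun q => dzConjB b q z η) (fun q => conj (b z q)) (fun q => conj (η q))
      rw [eb] at e'
      rw [sub_eq_add_neg, ← neg_mul, ← e']
      refine Finset.sum_congr rfl fun q _ => ?_
      simp only [hcX]
      rw [show linForm (b z) (fun i => K i z η) = ∑ i, b z i * K i z η from rfl]; ring
    have eY : ∑ q, cY q z η * conj (η q) = 2 * sesqForm (a z) (fun i => K i z η) η := by
      rw [sesqForm_eq_sum_lowerBar, Finset.mul_sum]
      refine Finset.sum_congr rfl fun q _ => ?_
      simp only [hcY, lowerBar]; ring
    rw [← eX, ← eY] at e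
    simp only [mul_assoc, ← Finset.mul_sum]
    rw [eb, ← sesqForm_eq_sum_lowerBar, ← h.alphaFn_mul_self hp.1]
    have e2 := absBeta_mul_self (b := b) z η
    linear_combination (alphaFn a z η * ∑ q, cX q z η * conj (η q)) * e
      + (absBeta b z η * ∑ q, cY q z η * conj (η q)) * e
      + (∑ q, cY q z η * conj (η q)) * (∑ q, cY q z η * conj (η q)) * e2
  have hzero : ∀ z η, (z, η) ∈ randersDomain U b →
      (∃ w, linForm (b z) w = 0 ∧ sesqForm (a z) η w ≠ 0) → ∀ i, K i z η = 0 := by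
    rintro z η hp ⟨w, hbw, haw⟩
    -- After polarization l(ξ) X(ξ)² = β · b̄(ξ) Y(ξ)² for all ξ, with l = a(η, ·). When l and b̄
    -- are independent, divisibility of linear factors forces Y = 0, hence K = 0.
    have pol : ∀ ξ : Fin n → ℂ, linForm (fun q => lowerBar (a z) η q) ξ
        * (linForm (fun q => cX q z η) ξ * linForm (fun q => cX q z η) ξ)
        = linForm (b z) η * linForm (fun q => conj (b z q)) ξ
          * (linForm (fun q => cY q z η) ξ * linForm (fun q => cY q z η) ξ) := by
      intro ξ
      have := AffineFor.mul_sq_eq (dBarDir_derivation hΩ ξ)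
        (affineFor_antilinear hΩ (fun q => h.holOn_lowerBar q) ξ)
        (affineFor_antilinear hΩ hcXhol ξ)
        (affineFor_antilinear hΩ (fun q => h.holOn_linForm.mul hΩ (h.holOn_conj_b q)) ξ)
        (affineFor_antilinear hΩ hcYhol ξ) main hp
      simp only [mul_assoc, ← Finset.mul_sum] at this
      simp only [linForm] at this ⊢
      rw [this]; ring
    have hb' : (fun q => conj (b z q)) ≠ 0 := fun h0 => h.b_ne z hp.1 <| funext fun q => by
      have := congrFun h0 q
      simpa using this
    have hy := linForm_eq_zero_of_mul_sq (l := fun q => lowerBar (a z) η q) hp.2 hb'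
      ⟨fun q => conj (w q), by
        simp only [linForm, ← map_mul, ← map_sum] at hbw ⊢
        rw [hbw, map_zero], by
        rwa [sesqForm_eq_sum_lowerBar] at haw⟩ pol
    have := h.herm.eq_of_sum hp.1 (v := fun i => K i z η) (w := fun _ => 0) fun q => by
      have := congrFun hy q
      simp only [hcY, Pi.zero_apply, mul_eq_zero, OfNat.ofNat_ne_zero, false_or] at this
      simp only [zero_mul, Finset.sum_const_zero]
      rw [← this]
      exact Finset.sum_congr rfl fun i _ => mul_comm _ _
    exact fun i => congrFun this i
  -- Where η is a-orthogonal to the chosen w in ker β, move η along w: β(η) is unchanged, the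
  -- exceptional case is left for every t ≠ 0, and continuity of K concludes.
  suffices hK0 : K i z η = 0 from sub_eq_zero.1 hK0
  obtain ⟨w, hw, hbw⟩ := exists_ker_ne_zero hn (b z)
  by_cases haw : sesqForm (a z) η w = 0
  · have hc : ContinuousAt (K i z) η := ((hKhol i).1.differentiableAt_snd hΩ hp).continuousAt
    have hc2 : Filter.Tendsto (fun t : ℂ => K i z (η + t • w)) (nhdsWithin 0 {0}ᶜ)
        (nhds (K i z η)) := by
      have h1 : Filter.Tendsto (fun t : ℂ => η + t • w) (nhds 0) (nhds η) := by
        have : Continuous (fun t : ℂ => η + t • w) := by fun_prop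
        simpa using this.tendsto 0
      exact (hc.tendsto.comp h1).mono_left nhdsWithin_le_nhds
    refine tendsto_nhds_unique hc2 (tendsto_const_nhds.congr' ?_)
    filter_upwards [self_mem_nhdsWithin] with t ht
    refine (hzero z (η + t • w) ⟨hp.1, ?_⟩ ⟨w, hbw, ?_⟩ i).symm
    · simpa [linForm_add, linForm_smul, hbw] using hp.2
    · rw [sesqForm_add_left, sesqForm_smul_left, haw, zero_add]
      exact mul_ne_zero ht (h.herm.sesqForm_ne hp.1 hw)
  · exact hzero z η hp ⟨w, hbw, haw⟩ i

/-- The condition on `β` for a complex Randers metric to be generalized Berwald. -/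
theorem sprayDeriv_beta_mul (h : IsRanders U a b)
    (hF : ∀ z ∈ U, ∀ η, F z η = Real.sqrt (sesqForm (a z) η η).re + ‖linForm (b z) η‖)
    (hΦ : ∀ z ∈ U, ∀ η, Φ z η = Real.sqrt (sesqForm (a z) η η).re)
    (hS : ∀ z η, (z, η) ∈ randersDomain U b → ∀ i, spray F i z η = spray Φ i z η)
    (hp : (z, η) ∈ randersDomain U b) (q : Fin n) :
    sprayDeriv Φ (fun z η => linForm (b z) η) z η * conj (b z q)
      + linForm (b z) η * dzConjB b q z η = 0 := by
  have hΩ := h.isOpen_domain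
  -- With K = 0 the right side of the comparison vanishes and α can be cancelled. What remains is
  -- linear in η̄, so each coefficient vanishes.
  have hX : ∀ z η, (z, η) ∈ randersDomain U b → ∑ q,
      ((∑ j, η j * linForm (fun i => wirtinger j (fun z => b z i) z) η
        - 2 * ∑ i, spray Φ i z η * b z i) * conj (b z q)
        + linForm (b z) η * dzConjB b q z η) * conj (η q) = 0 := by
    intro z η hp
    have e := h.alphaFn_mul_eq hF hΦ hp (K := 0) fun i => by simp [hS z η hp i]
    have e0 : linForm (b z) 0 = 0 := by simp [linForm]
    have e1 : sesqForm (a z) 0 η = 0 := by simp [sesqForm]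
    rw [h.sprayDeriv_beta hp, h.sprayDeriv_conj_beta hp, e0, e1] at e
    simp only [mul_zero, zero_mul, sub_zero, mul_eq_zero, h.alphaFn_ne hp, false_or] at e
    rw [← e]
    have eb : conj (linForm (b z) η) = ∑ q, conj (b z q) * conj (η q) := by
      simp only [linForm, map_sum, map_mul]
    have e' := sum_linComb₃_mul
        (∑ j, η j * linForm (fun i => wirtinger j (fun z => b z i) z) η
          - 2 * ∑ i, spray Φ i z η * b z i) (linForm (b z) η) 0 (fun q => conj (b z q))
        (fun q => dzConjB b q z η) 0 (fun q => conj (η q))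
    rw [← eb] at e'
    rw [zero_mul, add_zero] at e'
    rw [← e']
    exact Finset.sum_congr rfl fun q _ => by ring
  have := AffineFor.eq_zero (dBarDir_derivation hΩ (Pi.single q 1)) (affineFor_antilinear hΩ
    (fun q => ((h.holOn_sprayDeriv_beta hΦ).mul hΩ (h.holOn_conj_b q)).add hΩ
      (h.holOn_linForm.mul hΩ (h.holOn_dzConjB q))) (Pi.single q 1)) hX hp
  rw [h.sprayDeriv_beta hp]
  simpa [Pi.single_apply] using this

end IsRanders


section LinForm

variable {n : ℕ}

/-- A vector of the kernel of c is a difference of two vectors outside it. -/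
theorem linForm_eq_zero_of_ne {c d : Fin n → ℂ} (hc : c ≠ 0)
    (h : ∀ ξ, linForm c ξ ≠ 0 → linForm d ξ = 0) : d = 0 := by
  obtain ⟨ξ, hξ⟩ := exists_linForm_ne hc
  refine eq_zero_of_linForm fun u => ?_
  by_cases hu : linForm c u = 0
  · have := h (ξ + u) (by rwa [linForm_add, hu, add_zero])
    rwa [linForm_add, h ξ hξ, zero_add] at this
  · exact h u hu

theorem linForm_eq_zero_of_ne_ne {p q r : Fin n → ℂ} (hp : p ≠ 0) (hq : q ≠ 0)
    (h : ∀ ξ, linForm p ξ ≠ 0 → linForm q ξ ≠ 0 → linForm r ξ = 0) : r = 0 := by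
  obtain ⟨ξ, hpξ, hqξ⟩ : ∃ ξ, linForm p ξ ≠ 0 ∧ linForm q ξ ≠ 0 := by
    by_contra! h0
    exact hq (linForm_eq_zero_of_ne hp h0)
  refine linForm_eq_zero_of_ne hp fun u hu => ?_
  by_cases hqu : linForm q u = 0
  · have h1 := h (u + (linForm p u / linForm p ξ) • ξ) (by
      rw [linForm_add, linForm_smul, div_mul_cancel₀ _ hpξ, ← two_mul]
      exact mul_ne_zero two_ne_zero hu) (by
      rw [linForm_add, linForm_smul, hqu, zero_add]
      exact mul_ne_zero (div_ne_zero hu hpξ) hqξ)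
    rwa [linForm_add, linForm_smul, h ξ hpξ hqξ, mul_zero, add_zero] at h1
  · exact h u hu hqu

end LinForm

/-- The derivation `∂ₘ - (∂̇ₘ Gᵖ) ∂̇ₚ`. -/
def horizDeriv {n : ℕ} (Φ : Cn n → Cn n → ℝ) (m : Fin n) (f : Cn n → Cn n → ℂ) (z η : Cn n) : ℂ :=
  dz m f z η - ∑ p, dEta m (spray Φ p) z η * dEta p f z η

theorem horizDeriv_derivation {n : ℕ} {Ω : Set (Cn n × Cn n)} {z η : Cn n} {Φ : Cn n → Cn n → ℝ}
    (hΩ : IsOpen Ω) (hp : (z, η) ∈ Ω) (m : Fin n) :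
    IsDerivationAt Ω z η (fun f => horizDeriv Φ m f z η) :=
  (IsDerivationAt.dz hΩ hp m).sub'
    (IsDerivationAt.linComb (fun j => IsDerivationAt.dEta hΩ hp j) _)

/-- Euler's identity ηᵐ ∂̇ₘGᵖ = 2Gᵖ. -/
theorem IsMetricOn.sum_horizDeriv {n : ℕ} {Ω : Set (Cn n × Cn n)} {z η : Cn n}
    {Φ : Cn n → Cn n → ℝ} (h : IsMetricOn Ω Φ) (hp : (z, η) ∈ Ω) (f : Cn n → Cn n → ℂ) :
    ∑ m, η m * horizDeriv Φ m f z η = sprayDeriv Φ f z η := by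
  simp only [horizDeriv, sprayDeriv, mul_sub, Finset.sum_sub_distrib, Finset.mul_sum]
  congr 1
  rw [Finset.sum_comm]
  refine Finset.sum_congr rfl fun p _ => ?_
  rw [← mul_assoc, ← h.eulerOn_spray p z η hp, Finset.sum_mul]
  exact Finset.sum_congr rfl fun m _ => by ring

/-- The Hermitian matrix `a - b ⊗ b̄`. -/
def cutForm {n : ℕ} (a : Cn n → Fin n → Fin n → ℂ) (b : Cn n → Fin n → ℂ) (z : Cn n)
    (i j : Fin n) : ℂ := a z i j - b z i * conj (b z j)

/-- Coordinate data of a Randers metric `α + |β|` together with the Hermitian metric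
`e (a - b ⊗ b̄)`. -/
structure IsNavigation {n : ℕ} (U : Set (Cn n)) (a : Cn n → Fin n → Fin n → ℂ)
    (b : Cn n → Fin n → ℂ) (e : Cn n → ℝ) : Prop where
  randers : IsRanders U a b
  smooth_e : ContDiffOn ℝ ∞ (fun z => (e z : ℂ)) U
  e_pos : ∀ z ∈ U, 0 < e z
  cut_pos : ∀ z ∈ U, ∀ η : Cn n, η ≠ 0 → 0 < (sesqForm (cutForm a b z) η η).re

/-- The matrix of the Hermitian metric `e (a - b ⊗ b̄)`. -/
def scaledForm {n : ℕ} (a : Cn n → Fin n → Fin n → ℂ) (b : Cn n → Fin n → ℂ) (e : Cn n → ℝ)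
    (z : Cn n) (i j : Fin n) : ℂ := (e z : ℂ) * cutForm a b z i j

section Cut

variable {n : ℕ} (a : Cn n → Fin n → Fin n → ℂ) (b : Cn n → Fin n → ℂ) (e : Cn n → ℝ)
  (z η ζ : Cn n)

theorem sesqForm_cutForm : sesqForm (cutForm a b z) η ζ
    = sesqForm (a z) η ζ - linForm (b z) η * conj (linForm (b z) ζ) := by
  simp only [sesqForm, cutForm, linForm, map_sum, Finset.sum_mul_sum, ← Finset.sum_sub_distrib,
    map_mul]
  exact Finset.sum_congr rfl fun i _ => Finset.sum_congr rfl fun j _ => by ring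

theorem sesqForm_scaledForm : sesqForm (scaledForm a b e z) η ζ
    = e z * sesqForm (cutForm a b z) η ζ := by
  simp only [sesqForm, scaledForm, Finset.mul_sum]
  exact Finset.sum_congr rfl fun i _ => Finset.sum_congr rfl fun j _ => by ring

theorem lower_scaledForm (i : Fin n) : lower (scaledForm a b e z) η i
    = e z * lower (cutForm a b z) η i := by
  simp only [lower, scaledForm, Finset.mul_sum]
  exact Finset.sum_congr rfl fun j _ => by ring

end Cut

/-! ### The spray and horizontal derivative of e (a - b ⊗ b̄) compared with those of a. -/

namespace IsNavigation

variable {n : ℕ} {U : Set (Cn n)} {a : Cn n → Fin n → Fin n → ℂ} {b : Cn n → Fin n → ℂ}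
  {e : Cn n → ℝ} {z η : Cn n} {Φ Ψ : Cn n → Cn n → ℝ}

theorem conj_cutForm (h : IsNavigation U a b e) (hz : z ∈ U) (i j : Fin n) :
    conj (cutForm a b z i j) = cutForm a b z j i := by
  simp only [cutForm, map_sub, map_mul, h.randers.herm.herm z hz, Complex.conj_conj]
  ring

theorem isHermOn (h : IsNavigation U a b e) : IsHermOn U (scaledForm a b e) where
  isOpen := h.randers.herm.isOpen
  smooth i j := h.smooth_e.mul ((h.randers.herm.smooth i j).sub
    ((h.randers.smooth_b i).mul (h.randers.smooth_conj_b j)))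
  herm z hz i j := by
    rw [scaledForm, map_mul, h.conj_cutForm hz, Complex.conj_ofReal, scaledForm]
  pos z hz η hη := by
    rw [sesqForm_scaledForm, Complex.re_ofReal_mul]
    exact mul_pos (h.e_pos z hz) (h.cut_pos z hz η hη)

theorem e_ne (h : IsNavigation U a b e) (hz : z ∈ U) : (e z : ℂ) ≠ 0 :=
  Complex.ofReal_ne_zero.2 (h.e_pos z hz).ne'

theorem cut_ne (h : IsNavigation U a b e) (hz : z ∈ U) (hη : η ≠ 0) :
    sesqForm (cutForm a b z) η η ≠ 0 := by
  intro h0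
  have := h.cut_pos z hz η hη
  rw [h0] at this
  simp at this

theorem cutForm_sharp (h : IsNavigation U a b e) (hz : z ∈ U) (ζ : Cn n) :
    sesqForm (cutForm a b z) (sharp a b z) ζ = (1 - normB a b z) * conj (linForm (b z) ζ) := by
  rw [sesqForm_cutForm, h.randers.sharp_sesqForm hz, h.randers.linForm_sharp hz]; ring

/-- On b♯ the form a - b⊗b̄ takes the value (1 - ν)ν, which must be positive. -/
theorem normB_lt_one (h : IsNavigation U a b e) (hz : z ∈ U) : normB a b z < 1 := by
  have h1 := h.cut_pos z hz _ (h.randers.sharp_ne hz)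
  rw [h.cutForm_sharp hz, h.randers.linForm_sharp hz, Complex.conj_ofReal] at h1
  norm_cast at h1
  have h2 := h.randers.normB_pos hz
  nlinarith

theorem smoothOn_e (h : IsNavigation U a b e) :
    SmoothOn (randersDomain U b) (fun z _ => (e z : ℂ)) :=
  SmoothOn.base h.smooth_e IsRanders.mem_base

/-- The derivative `∂e` as a linear form. -/
def _root_.ComplexFinsler.dzReal {n : ℕ} (e : Cn n → ℝ) (z : Cn n) (j : Fin n) : ℂ :=
  wirtinger j (fun z => (e z : ℂ)) z

theorem wirtinger_scaledForm (h : IsNavigation U a b e) (hp : (z, η) ∈ randersDomain U b)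
    (j l q : Fin n) : wirtinger j (fun z => scaledForm a b e z l q) z
      = dzReal e z j * cutForm a b z l q + e z * (wirtinger j (fun z => a z l q) z
        - wirtinger j (fun z => b z l) z * conj (b z q)
        - b z l * wirtinger j (fun z => conj (b z q)) z) := by
  have hD := IsDerivationAt.dz h.randers.isOpen_domain hp j
  have sa := (h.randers.holOn_a l q).1
  have sb := (h.randers.holOn_b l).1
  have sc := (h.randers.holOn_conj_b q).1
  have e1 := hD.mul h.smoothOn_e (sa.sub (sb.mul sc))
  rw [hD.sub sa (sb.mul sc), hD.mul sb sc] at e1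
  have e2 : wirtinger j (fun z => scaledForm a b e z l q) z
      = dz j (fun z _ => (e z : ℂ) * (a z l q - b z l * conj (b z q))) z η := rfl
  rw [e2, e1]
  simp only [dz_base (n := n), dzReal, cutForm]
  ring

/-- The spray of the Hermitian metric `e (a - b ⊗ b̄)`. -/
theorem spray_scaled (h : IsNavigation U a b e)
    (hΦ : ∀ z ∈ U, ∀ η, Φ z η = Real.sqrt (sesqForm (a z) η η).re)
    (hΨ : ∀ z ∈ U, ∀ η, Ψ z η = Real.sqrt (sesqForm (scaledForm a b e z) η η).re)
    (hb : ∀ z η, (z, η) ∈ randersDomain U b → ∀ q,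
      sprayDeriv Φ (fun z η => linForm (b z) η) z η * conj (b z q)
        + linForm (b z) η * dzConjB b q z η = 0)
    (hp : (z, η) ∈ randersDomain U b) (i : Fin n) :
    spray Ψ i z η = spray Φ i z η + linForm (dzReal e z) η / (2 * e z) * η i := by
  have he := h.e_ne hp.1
  have hΩ := h.randers.isOpen_domain
  refine congrFun (h.isHermOn.eq_of_sum hp.1 (v := fun i => spray Ψ i z η)
    (w := fun i => spray Φ i z η + linForm (dzReal e z) η / (2 * e z) * η i) fun q => ?_) i
  have e1 := h.isHermOn.spray_mul hΨ hΩ IsRanders.mem_base hp q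
  have e2 := h.randers.herm.spray_mul hΦ hΩ IsRanders.mem_base hp q
  have e3 := hb z η hp q
  rw [h.randers.sprayDeriv_beta hp] at e3
  have e4 : ∑ j, η j * lowerBar (fun l q => wirtinger j (fun z => scaledForm a b e z l q) z) η q
      = linForm (dzReal e z) η * lowerBar (cutForm a b z) η q
        + e z * ((∑ j, η j * lowerBar (fun l q => wirtinger j (fun z => a z l q) z) η q)
          - (∑ j, η j * linForm (fun i => wirtinger j (fun z => b z i) z) η) * conj (b z q)
          - linForm (b z) η * dzConjB b q z η) := by
    have e5 : ∀ j, lowerBar (fun l q => wirtinger j (fun z => scaledForm a b e z l q) z) η q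
        = dzReal e z j * lowerBar (cutForm a b z) η q
          + e z * (lowerBar (fun l q => wirtinger j (fun z => a z l q) z) η q
          - linForm (fun i => wirtinger j (fun z => b z i) z) η * conj (b z q)
          - linForm (b z) η * wirtinger j (fun z => conj (b z q)) z) := fun j => by
      simp only [lowerBar, linForm, h.wirtinger_scaledForm hp, Finset.mul_sum, Finset.sum_mul,
        ← Finset.sum_sub_distrib, ← Finset.sum_add_distrib]
      exact Finset.sum_congr rfl fun l _ => by ring
    simp only [e5]
    rw [dzConjB, show linForm (dzReal e z) η = ∑ j, dzReal e z j * η j from rfl]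
    simp only [Finset.mul_sum, Finset.sum_mul, mul_sub, ← Finset.sum_sub_distrib,
      ← Finset.sum_add_distrib]
    exact Finset.sum_congr rfl fun l _ => by ring
  rw [e4, ← e2] at e1
  have e6 : ∑ i, (spray Φ i z η + linForm (dzReal e z) η / (2 * e z) * η i)
        * scaledForm a b e z i q
      = e z * (∑ i, spray Φ i z η * a z i q - (∑ i, spray Φ i z η * b z i) * conj (b z q))
        + linForm (dzReal e z) η / 2 * lowerBar (cutForm a b z) η q := by
    simp only [lowerBar, Finset.mul_sum, Finset.sum_mul, mul_sub, ← Finset.sum_sub_distrib,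
      ← Finset.sum_add_distrib]
    refine Finset.sum_congr rfl fun i _ => ?_
    simp only [scaledForm, cutForm]
    field_simp
  rw [e6]
  -- The derivatives of b occur exactly in the combination that `e3` makes zero, so only the
  -- derivative of the factor e remains.
  linear_combination e1 / 2 - e z * e3 / 2

theorem sesqForm_eq_on (h : IsNavigation U a b e)
    {D : (Cn n → Cn n → ℂ) → ℂ} (hD : IsDerivationAt (randersDomain U b) z η D) :
    D (fun z η => sesqForm (scaledForm a b e z) η η)
      = D (fun z _ => (e z : ℂ)) * sesqForm (cutForm a b z) η η
        + e z * (D (fun z η => sesqForm (a z) η η)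
          - D (fun z η => linForm (b z) η * conj (linForm (b z) η))) := by
  have sA := h.randers.herm.smoothOn_sesqForm (Ω := randersDomain U b) IsRanders.mem_base
  have sB := h.randers.smoothOn_beta.mul h.randers.smoothOn_beta.conjugate
  rw [hD.congr (g := fun z η => (e z : ℂ) * (sesqForm (a z) η η
      - linForm (b z) η * conj (linForm (b z) η))) fun z η _ => by
        rw [sesqForm_scaledForm, sesqForm_cutForm], hD.mul h.smoothOn_e (sA.sub sB),
    hD.sub sA sB, sesqForm_cutForm]

/-- The spray change alters ∂̇ₘGᵖ by (eₘ ηᵖ + ∂e(η) δᵖₘ)/(2e), where eₘ = ∂ₘe. Applied to the metric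
eC this subtracts half of eₘ C(η,η) + ∂e(η) Cₘ, while the unchanged operator differentiates the
factor e and gives eₘ C(η,η). -/
theorem horizontal_scaled (h : IsNavigation U a b e)
    (hΦ : ∀ z ∈ U, ∀ η, Φ z η = Real.sqrt (sesqForm (a z) η η).re)
    (hΨ : ∀ z ∈ U, ∀ η, Ψ z η = Real.sqrt (sesqForm (scaledForm a b e z) η η).re)
    (hb : ∀ z η, (z, η) ∈ randersDomain U b → ∀ q,
      sprayDeriv Φ (fun z η => linForm (b z) η) z η * conj (b z q)
        + linForm (b z) η * dzConjB b q z η = 0)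
    (hp : (z, η) ∈ randersDomain U b) (m : Fin n) :
    2 * horizontal Ψ m z η = dzReal e z m * sesqForm (cutForm a b z) η η
      - linForm (dzReal e z) η * lower (cutForm a b z) η m
      + 2 * e z * (horizontal Φ m z η
        - horizDeriv Φ m (fun z η => linForm (b z) η * conj (linForm (b z) η)) z η) := by
  have he := h.e_ne hp.1
  have hΩ := h.randers.isOpen_domain
  have hD := IsDerivationAt.dEta hΩ hp m
  have sΦ := fun p => (h.randers.isMetricOn_alpha hΦ).smooth_spray p
  have e1 : ∀ p, dEta m (spray Ψ p) z η = dEta m (spray Φ p) z η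
      + (dzReal e z m * η p + linForm (dzReal e z) η * if m = p then 1 else 0) / (2 * e z) := by
    intro p
    have : dEta m (spray Ψ p) z η = dEta m (fun z' η => spray Φ p z' η
        + (2 * (e z : ℂ))⁻¹ * (linForm (dzReal e z) η * η p)) z η := by
      refine dEta_congr_fibre ?_ m
      filter_upwards [eventually_fibre hΩ hp] with ζ hζ
      rw [h.spray_scaled hΦ hΨ hb hζ]; ring
    have s1 := (smoothOn_linForm_const (Ω := randersDomain U b) (dzReal e z)).mul
      (SmoothOn.coord p)
    rw [this, hD.add (sΦ p) ((SmoothOn.const _).mul s1), hD.const_mul _ s1,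
      hD.mul (smoothOn_linForm_const (dzReal e z)) (SmoothOn.coord p), dEta_linForm_const,
      dEta_coord]
    ring
  rw [h.isHermOn.horizontal_eq hΨ hΩ IsRanders.mem_base hp,
    h.randers.herm.horizontal_eq hΦ hΩ IsRanders.mem_base hp]
  have e2 := h.sesqForm_eq_on (horizDeriv_derivation (Φ := Φ) hΩ hp m)
  have e3 : horizDeriv Φ m (fun z _ => (e z : ℂ)) z η = dzReal e z m := by
    simp [horizDeriv, dEta_base (fun z => (e z : ℂ)), dzReal, dz_base (fun z => (e z : ℂ))]
  rw [e3] at e2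
  have e4 : dz m (fun z η => sesqForm (scaledForm a b e z) η η) z η
      - ∑ p, dEta m (spray Ψ p) z η * dEta p (fun z η => sesqForm (scaledForm a b e z) η η) z η
      = horizDeriv Φ m (fun z η => sesqForm (scaledForm a b e z) η η) z η
        - (dzReal e z m * sesqForm (cutForm a b z) η η
          + linForm (dzReal e z) η * lower (cutForm a b z) η m) / 2 := by
    have e5 : ∑ p, (dzReal e z m * η p + linForm (dzReal e z) η * if m = p then 1 else 0)
          / (2 * e z) * (e z * lower (cutForm a b z) η p)
        = (dzReal e z m * sesqForm (cutForm a b z) η η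
          + linForm (dzReal e z) η * lower (cutForm a b z) η m) / 2 := by
      have e6 : ∀ p, (dzReal e z m * η p + linForm (dzReal e z) η * if m = p then 1 else 0)
          / (2 * e z) * (e z * lower (cutForm a b z) η p)
          = dzReal e z m / 2 * (lower (cutForm a b z) η p * η p)
            + (if m = p then linForm (dzReal e z) η / 2 * lower (cutForm a b z) η p else 0) := by
        intro p
        split_ifs <;> field_simp
        ring
      simp only [e6, Finset.sum_add_distrib, ← Finset.mul_sum, ← sesqForm_eq_sum_lower,
        Finset.sum_ite_eq, Finset.mem_univ, if_true]
      ring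
    rw [← e5, horizDeriv, sub_sub, ← Finset.sum_add_distrib]
    congr 1
    refine Finset.sum_congr rfl fun p _ => ?_
    rw [h.isHermOn.dEta_sesqForm hΩ IsRanders.mem_base hp, lower_scaledForm, e1]
    ring
  rw [e4, e2]
  simp only [horizDeriv]
  ring

end IsNavigation


/-! ### Consequences of projective relatedness of a and e (a - b ⊗ b̄). -/

theorem HolOn.dEta {n : ℕ} {Ω : Set (Cn n × Cn n)} {f : Cn n → Cn n → ℂ} (hΩ : IsOpen Ω)
    (hf : HolOn Ω f) (k : Fin n) : HolOn Ω (dEta k f) :=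
  ⟨hf.1.dEta hΩ k, fun j z η hp => by
    rw [(isDirectional_dEtaBar Ω j).comm (isDirectional_dEta Ω k) hΩ hf.1 hp,
      (IsDerivationAt.dEta hΩ hp k).congr (hf.2 j)]
    exact (IsDerivationAt.dEta hΩ hp k).const 0⟩

/-- `bˡ torsion_{l r q̄} ηʳ`, twice the antilinear coefficients of `b^m ∂ₘ`-torsion. -/
def sharpTorsion {n : ℕ} (a : Cn n → Fin n → Fin n → ℂ) (b : Cn n → Fin n → ℂ) (z η ζ : Cn n) :
    ℂ := ∑ m, sharp a b z m * sesqForm (hermTorsion a z m) η ζ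

/-- The antilinear coefficients of the horizontal derivative of `β β̄`. -/
def horizBetaCoef {n : ℕ} (Φ : Cn n → Cn n → ℝ) (b : Cn n → Fin n → ℂ) (m q : Fin n)
    (z η : Cn n) : ℂ :=
  (linForm (fun i => wirtinger m (fun z => b z i) z) η - ∑ p, dEta m (spray Φ p) z η * b z p)
    * conj (b z q) + linForm (b z) η * wirtinger m (fun z => conj (b z q)) z

namespace IsNavigation

variable {n : ℕ} {U : Set (Cn n)} {a : Cn n → Fin n → Fin n → ℂ} {b : Cn n → Fin n → ℂ}
  {e : Cn n → ℝ} {z η : Cn n} {Φ Ψ : Cn n → Cn n → ℝ}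

/-- Exhibits the derivative as linear in η̄ with coefficients holomorphic in η, the form required
for polarization. -/
theorem horizDeriv_beta_sq (h : IsNavigation U a b e) (hp : (z, η) ∈ randersDomain U b)
    (m : Fin n) :
    horizDeriv Φ m (fun z η => linForm (b z) η * conj (linForm (b z) η)) z η
      = ∑ q, horizBetaCoef Φ b m q z η * conj (η q) := by
  have hR := h.randers
  have hΩ := hR.isOpen_domain
  have hD := horizDeriv_derivation (Φ := Φ) hΩ hp m
  rw [hD.mul hR.smoothOn_beta hR.smoothOn_beta.conjugate]
  have e1 : horizDeriv Φ m (fun z η => linForm (b z) η) z η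
      = linForm (fun i => wirtinger m (fun z => b z i) z) η
        - ∑ p, dEta m (spray Φ p) z η * b z p := by
    simp only [horizDeriv, dz_linForm hΩ hR.smooth_b IsRanders.mem_base hp,
      dEta_linForm hΩ hR.smooth_b IsRanders.mem_base hp]
  have e2 : horizDeriv Φ m (fun z η => conj (linForm (b z) η)) z η
      = ∑ q, wirtinger m (fun z => conj (b z q)) z * conj (η q) := by
    simp only [horizDeriv, dz_conj_linForm hΩ hR.smooth_b IsRanders.mem_base hp,
      dEta_conj_linForm hΩ hR.smooth_b IsRanders.mem_base hp, mul_zero, Finset.sum_const_zero,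
      sub_zero]
  have e3 : conj (linForm (b z) η) = ∑ q, conj (b z q) * conj (η q) := by
    simp only [linForm, map_sum, map_mul]
  have e4 := sum_linComb₃_mul (linForm (fun i => wirtinger m (fun z => b z i) z) η
        - ∑ p, dEta m (spray Φ p) z η * b z p) (linForm (b z) η) 0 (fun q => conj (b z q))
        (fun q => wirtinger m (fun z => conj (b z q)) z) 0 (fun q => conj (η q))
  rw [← e3, zero_mul, add_zero] at e4
  rw [e1, e2, ← e4]
  exact Finset.sum_congr rfl fun q _ => by rw [horizBetaCoef]; ring

theorem holOn_horizBetaCoef (h : IsNavigation U a b e)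
    (hΦ : ∀ z ∈ U, ∀ η, Φ z η = Real.sqrt (sesqForm (a z) η η).re) (m q : Fin n) :
    HolOn (randersDomain U b) (horizBetaCoef Φ b m q) := by
  have hR := h.randers
  have hΩ := hR.isOpen_domain
  exact (((HolOn.sum hΩ fun i _ => (HolOn.base (hR.smoothOn_wirtinger (hR.smooth_b i) m)).mul hΩ
    (HolOn.coord i)).sub hΩ (HolOn.sum hΩ fun p _ =>
      ((hR.holOn_spray_alpha hΦ p).dEta hΩ m).mul hΩ (hR.holOn_b p))).mul hΩ
      (hR.holOn_conj_b q)).add hΩ (hR.holOn_linForm.mul hΩ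
      (HolOn.base (hR.smoothOn_wirtinger (hR.smooth_conj_b q) m)))

/-- Contraction with η gives the derivative along the spray, and `hb` says that |β|² is constant
along it. -/
theorem sum_horizDeriv_beta_sq (h : IsNavigation U a b e)
    (hΦ : ∀ z ∈ U, ∀ η, Φ z η = Real.sqrt (sesqForm (a z) η η).re)
    (hb : ∀ z η, (z, η) ∈ randersDomain U b → ∀ q,
      sprayDeriv Φ (fun z η => linForm (b z) η) z η * conj (b z q)
        + linForm (b z) η * dzConjB b q z η = 0)
    (hp : (z, η) ∈ randersDomain U b) :
    ∑ m, η m * horizDeriv Φ m (fun z η => linForm (b z) η * conj (linForm (b z) η)) z η = 0 := by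
  have hR := h.randers
  have hΩ := hR.isOpen_domain
  rw [(hR.isMetricOn_alpha hΦ).sum_horizDeriv hp,
    (sprayDeriv_derivation hΩ hp).mul hR.smoothOn_beta hR.smoothOn_beta.conjugate,
    hR.sprayDeriv_conj_beta hp]
  have e3 : conj (linForm (b z) η) = ∑ q, conj (b z q) * conj (η q) := by
    simp only [linForm, map_sum, map_mul]
  rw [e3, Finset.mul_sum, Finset.mul_sum, ← Finset.sum_add_distrib]
  refine Finset.sum_eq_zero fun q _ => ?_
  linear_combination conj (η q) * hb z η hp q

theorem horizontal_alpha (h : IsNavigation U a b e)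
    (hΦ : ∀ z ∈ U, ∀ η, Φ z η = Real.sqrt (sesqForm (a z) η η).re)
    (hp : (z, η) ∈ randersDomain U b) (m : Fin n) :
    horizontal Φ m z η = sesqForm (hermTorsion a z m) η η :=
  h.randers.herm.horizontal_eq_torsion hΦ h.randers.isOpen_domain IsRanders.mem_base hp m

theorem lowerBar_thetaStar (h : IsNavigation U a b e)
    (hΦ : ∀ z ∈ U, ∀ η, Φ z η = Real.sqrt (sesqForm (a z) η η).re)
    (hp : (z, η) ∈ randersDomain U b) (q : Fin n) :
    lowerBar (a z) (fun k => thetaStar Φ k z η) q = 2 * conj (horizontal Φ q z η) := by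
  rw [← (h.randers.isMetricOn_alpha hΦ).sum_thetaStar_mul hp,
    h.randers.herm.fundTensor_eq hΦ h.randers.isOpen_domain IsRanders.mem_base hp]
  exact Finset.sum_congr rfl fun k _ => mul_comm _ _

theorem linForm_thetaStar (h : IsNavigation U a b e)
    (hΦ : ∀ z ∈ U, ∀ η, Φ z η = Real.sqrt (sesqForm (a z) η η).re)
    (hp : (z, η) ∈ randersDomain U b) :
    linForm (b z) (fun k => thetaStar Φ k z η) = 2 * conj (sharpTorsion a b z η η) := by
  rw [← h.randers.sesqForm_sharp hp.1, sesqForm_eq_sum_lowerBar, sharpTorsion, map_sum,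
    Finset.mul_sum]
  refine Finset.sum_congr rfl fun q _ => ?_
  rw [h.lowerBar_thetaStar hΦ hp, h.horizontal_alpha hΦ hp, map_mul]; ring

/-- The pointwise consequence of projective relatedness. -/
theorem proj_identity (h : IsNavigation U a b e)
    (hΦ : ∀ z ∈ U, ∀ η, Φ z η = Real.sqrt (sesqForm (a z) η η).re)
    (hΨ : ∀ z ∈ U, ∀ η, Ψ z η = Real.sqrt (sesqForm (scaledForm a b e z) η η).re)
    (hb : ∀ z η, (z, η) ∈ randersDomain U b → ∀ q,
      sprayDeriv Φ (fun z η => linForm (b z) η) z η * conj (b z q)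
        + linForm (b z) η * dzConjB b q z η = 0)
    (hp : (z, η) ∈ randersDomain U b) {P : ℂ}
    (hP : ∀ i, spray Φ i z η = spray Ψ i z η + (thetaStar Φ i z η - thetaStar Ψ i z η) / 2
      + P * η i) (q : Fin n) :
    sesqForm (cutForm a b z) η η * (2 * e z
        * (horizDeriv Φ q (fun z η => linForm (b z) η * conj (linForm (b z) η)) z η
          - sharpTorsion a b z η η * b z q) - dzReal e z q * sesqForm (cutForm a b z) η η)
      + (linForm (dzReal e z) η * sesqForm (cutForm a b z) η η
        + 2 * e z * sharpTorsion a b z η η * linForm (b z) η) * lower (cutForm a b z) η q = 0 := by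
  have hR := h.randers
  have hΩ := hR.isOpen_domain
  -- The sprays already differ by a multiple of η, so projective relatedness makes the two θ* differ
  -- by a multiple of η as well; `κ` is that multiple.
  set κ : ℂ := -2 * (linForm (dzReal e z) η / (2 * e z) + P) with hκdef
  have hκ : ∀ i, thetaStar Ψ i z η = thetaStar Φ i z η - κ * η i := fun i => by
    have := hP i
    rw [h.spray_scaled hΦ hΨ hb hp] at this
    rw [hκdef]
    linear_combination 2 * this
  have eq1 : ∀ q, 2 * horizontal Ψ q z η = e z * (2 * horizontal Φ q z η
      - 2 * sharpTorsion a b z η η * b z q) - conj κ * (e z * lower (cutForm a b z) η q) := by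
    intro q
    have e1 := (h.isHermOn.isMetricOn hΨ hΩ IsRanders.mem_base).sum_thetaStar_mul hp q
    rw [h.isHermOn.fundTensor_eq hΨ hΩ IsRanders.mem_base hp] at e1
    simp only [Matrix.of_apply, hκ] at e1
    have e2 : ∑ k, (thetaStar Φ k z η - κ * η k) * scaledForm a b e z k q
        = e z * (lowerBar (a z) (fun k => thetaStar Φ k z η) q
          - linForm (b z) (fun k => thetaStar Φ k z η) * conj (b z q))
          - κ * (e z * lowerBar (cutForm a b z) η q) := by
      simp only [lowerBar, linForm, scaledForm, Finset.mul_sum, Finset.sum_mul,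
        ← Finset.sum_sub_distrib]
      refine Finset.sum_congr rfl fun k _ => ?_
      simp only [cutForm]; ring
    rw [e2, h.lowerBar_thetaStar hΦ hp, h.linForm_thetaStar hΦ hp] at e1
    have e3 := congrArg conj e1
    simp only [map_sub, map_mul, Complex.conj_conj, Complex.conj_ofReal, map_ofNat,
      conj_lowerBar η (h.conj_cutForm hp.1)] at e3
    rw [← e3]
  have eq2 : ∀ q, 2 * e z
        * (horizDeriv Φ q (fun z η => linForm (b z) η * conj (linForm (b z) η)) z η
          - sharpTorsion a b z η η * b z q) - dzReal e z q * sesqForm (cutForm a b z) η η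
          + linForm (dzReal e z) η * lower (cutForm a b z) η q
        = conj κ * e z * lower (cutForm a b z) η q := fun q => by
    linear_combination h.horizontal_scaled hΦ hΨ hb hp q - eq1 q
  -- Contraction with η determines `κ`: the horizontal derivative of |β|² contributes nothing and
  -- the two ∂e terms cancel.
  have eq3 : conj κ * e z * sesqForm (cutForm a b z) η η
      = -2 * e z * sharpTorsion a b z η η * linForm (b z) η := by
    have s1 := h.sum_horizDeriv_beta_sq hΦ hb hp
    have s2 : ∑ q, η q * dzReal e z q = linForm (dzReal e z) η :=
      Finset.sum_congr rfl fun _ _ => mul_comm _ _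
    have s3 : ∑ q, η q * b z q = linForm (b z) η :=
      Finset.sum_congr rfl fun _ _ => mul_comm _ _
    have s4 : ∑ q, η q * lower (cutForm a b z) η q = sesqForm (cutForm a b z) η η := by
      rw [sesqForm_eq_sum_lower]; exact Finset.sum_congr rfl fun _ _ => mul_comm _ _
    have s5 := Finset.sum_congr rfl fun q (_ : q ∈ Finset.univ) => congrArg (η q * ·) (eq2 q)
    have s6 : ∑ q, η q * (2 * e z
        * (horizDeriv Φ q (fun z η => linForm (b z) η * conj (linForm (b z) η)) z η
          - sharpTorsion a b z η η * b z q) - dzReal e z q * sesqForm (cutForm a b z) η η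
          + linForm (dzReal e z) η * lower (cutForm a b z) η q)
        = 2 * e z * (∑ q, η q
            * horizDeriv Φ q (fun z η => linForm (b z) η * conj (linForm (b z) η)) z η)
          - 2 * e z * sharpTorsion a b z η η * (∑ q, η q * b z q)
          - sesqForm (cutForm a b z) η η * (∑ q, η q * dzReal e z q)
          + linForm (dzReal e z) η * (∑ q, η q * lower (cutForm a b z) η q) := by
      simp only [Finset.mul_sum, ← Finset.sum_sub_distrib, ← Finset.sum_add_distrib]
      exact Finset.sum_congr rfl fun q _ => by ring
    have s7 : ∑ q, η q * (conj κ * e z * lower (cutForm a b z) η q)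
        = conj κ * e z * ∑ q, η q * lower (cutForm a b z) η q := by
      rw [Finset.mul_sum]; exact Finset.sum_congr rfl fun q _ => by ring
    rw [s6, s7, s1, s2, s3, s4] at s5
    linear_combination -s5
  linear_combination sesqForm (cutForm a b z) η η * eq2 q + lower (cutForm a b z) η q * eq3

/-- The torsion is antisymmetric in its first two indices, both contracted here with b♯. -/
theorem sharpTorsion_sharp (ζ : Cn n) : sharpTorsion a b z (sharp a b z) ζ = 0 := by
  have h1 : sharpTorsion a b z (sharp a b z) ζ = - sharpTorsion a b z (sharp a b z) ζ := by
    have e : sharpTorsion a b z (sharp a b z) ζ = ∑ m, ∑ l, ∑ q,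
        sharp a b z m * sharp a b z l * hermTorsion a z m l q * conj (ζ q) := by
      simp only [sharpTorsion, sesqForm, Finset.mul_sum]
      exact Finset.sum_congr rfl fun m _ => Finset.sum_congr rfl fun l _ =>
        Finset.sum_congr rfl fun q _ => by ring
    rw [e]
    nth_rewrite 1 [Finset.sum_comm]
    simp only [← Finset.sum_neg_distrib]
    refine Finset.sum_congr rfl fun m _ => Finset.sum_congr rfl fun l _ =>
        Finset.sum_congr rfl fun q _ => ?_
    rw [IsHermOn.hermTorsion_antisymm]; ring
  linear_combination h1 / 2

theorem sharpTorsion_add_left (η ξ ζ : Cn n) : sharpTorsion a b z (η + ξ) ζ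
    = sharpTorsion a b z η ζ + sharpTorsion a b z ξ ζ := by
  simp only [sharpTorsion, sesqForm_add_left, mul_add, Finset.sum_add_distrib]

theorem sharpTorsion_smul_left (s : ℂ) (η ζ : Cn n) : sharpTorsion a b z (s • η) ζ
    = s * sharpTorsion a b z η ζ := by
  simp only [sharpTorsion, sesqForm_smul_left, Finset.mul_sum]
  exact Finset.sum_congr rfl fun m _ => by ring

theorem sharpTorsion_eq_sum (η ζ : Cn n) : sharpTorsion a b z η ζ
    = ∑ q, (∑ m, sharp a b z m * lowerBar (hermTorsion a z m) η q) * conj (ζ q) := by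
  simp only [sharpTorsion, sesqForm_eq_sum_lowerBar, Finset.mul_sum, Finset.sum_mul]
  rw [Finset.sum_comm]
  exact Finset.sum_congr rfl fun m _ => Finset.sum_congr rfl fun q _ => by ring

theorem holOn_sharpTorsion (h : IsNavigation U a b e) (q : Fin n) :
    HolOn (randersDomain U b)
      (fun z η => ∑ m, sharp a b z m * lowerBar (hermTorsion a z m) η q) := by
  have hR := h.randers
  have hΩ := hR.isOpen_domain
  have ht : ∀ m l, SmoothOn (randersDomain U b) (fun z _ => hermTorsion a z m l q) := fun m l =>
    ((hR.smoothOn_wirtinger (hR.herm.smooth l q) m).sub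
      (hR.smoothOn_wirtinger (hR.herm.smooth m q) l)).div_const 2
  exact HolOn.sum hΩ fun m _ => (HolOn.base (hR.smoothOn_sharp m)).mul hΩ
    (HolOn.sum hΩ fun l _ => (HolOn.base (ht m l)).mul hΩ (HolOn.coord l))

theorem holOn_cutForm (h : IsNavigation U a b e) (i j : Fin n) :
    HolOn (randersDomain U b) (fun z _ => cutForm a b z i j) :=
  (h.randers.holOn_a i j).sub h.randers.isOpen_domain
    ((h.randers.holOn_b i).mul h.randers.isOpen_domain (h.randers.holOn_conj_b j))

theorem holOn_lowerBar_cut (h : IsNavigation U a b e) (q : Fin n) :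
    HolOn (randersDomain U b) (fun z η => lowerBar (cutForm a b z) η q) :=
  HolOn.sum h.randers.isOpen_domain fun i _ =>
    (h.holOn_cutForm i q).mul h.randers.isOpen_domain (HolOn.coord i)

theorem holOn_e (h : IsNavigation U a b e) : HolOn (randersDomain U b) (fun z _ => (e z : ℂ)) :=
  HolOn.base h.smoothOn_e

theorem holOn_dzReal (h : IsNavigation U a b e) (q : Fin n) :
    HolOn (randersDomain U b) (fun z _ => dzReal e z q) :=
  HolOn.base (h.randers.smoothOn_wirtinger h.smooth_e q)

theorem holOn_linForm_dzReal (h : IsNavigation U a b e) :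
    HolOn (randersDomain U b) (fun z η => linForm (dzReal e z) η) :=
  HolOn.sum h.randers.isOpen_domain fun i _ =>
    (h.holOn_dzReal i).mul h.randers.isOpen_domain (HolOn.coord i)

/-- The polarization of `proj_identity`. -/
theorem proj_identity_polarized (h : IsNavigation U a b e)
    (hΦ : ∀ z ∈ U, ∀ η, Φ z η = Real.sqrt (sesqForm (a z) η η).re) {q : Fin n}
    (hid : ∀ z η, (z, η) ∈ randersDomain U b → sesqForm (cutForm a b z) η η * (2 * e z
        * (horizDeriv Φ q (fun z η => linForm (b z) η * conj (linForm (b z) η)) z η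
          - sharpTorsion a b z η η * b z q) - dzReal e z q * sesqForm (cutForm a b z) η η)
      + (linForm (dzReal e z) η * sesqForm (cutForm a b z) η η
        + 2 * e z * sharpTorsion a b z η η * linForm (b z) η) * lower (cutForm a b z) η q = 0)
    (hp : (z, η) ∈ randersDomain U b) (ζ : Cn n) :
    sesqForm (cutForm a b z) η ζ * (2 * e z * (∑ r, horizBetaCoef Φ b q r z η * conj (ζ r)
          - sharpTorsion a b z η ζ * b z q) - dzReal e z q * sesqForm (cutForm a b z) η ζ)
      + (linForm (dzReal e z) η * sesqForm (cutForm a b z) η ζ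
        + 2 * e z * sharpTorsion a b z η ζ * linForm (b z) η) * lower (cutForm a b z) ζ q = 0 := by
  have hΩ := h.randers.isOpen_domain
  have c1 := h.holOn_lowerBar_cut
  have c2 : ∀ r, HolOn (randersDomain U b) (fun z η =>
      2 * (e z : ℂ) * (horizBetaCoef Φ b q r z η
        - (∑ m, sharp a b z m * lowerBar (hermTorsion a z m) η r) * b z q)
        - dzReal e z q * lowerBar (cutForm a b z) η r) := fun r =>
    (((HolOn.const 2).mul hΩ h.holOn_e).mul hΩ ((h.holOn_horizBetaCoef hΦ q r).sub hΩ
      ((h.holOn_sharpTorsion r).mul hΩ (h.randers.holOn_b q)))).sub hΩ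
      ((h.holOn_dzReal q).mul hΩ (c1 r))
  have c3 : ∀ r, HolOn (randersDomain U b) (fun z η =>
      linForm (dzReal e z) η * lowerBar (cutForm a b z) η r
        + 2 * (e z : ℂ) * (∑ m, sharp a b z m * lowerBar (hermTorsion a z m) η r)
          * linForm (b z) η) := fun r =>
    (h.holOn_linForm_dzReal.mul hΩ (c1 r)).add hΩ
      ((((HolOn.const 2).mul hΩ h.holOn_e).mul hΩ (h.holOn_sharpTorsion r)).mul hΩ
        h.randers.holOn_linForm)
  have c4 := fun r => h.holOn_cutForm q r
  have s2 : ∀ z η ζ : Cn n, ∑ r, (2 * (e z : ℂ) * (horizBetaCoef Φ b q r z η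
        - (∑ m, sharp a b z m * lowerBar (hermTorsion a z m) η r) * b z q)
        - dzReal e z q * lowerBar (cutForm a b z) η r) * conj (ζ r)
      = 2 * e z * (∑ r, horizBetaCoef Φ b q r z η * conj (ζ r) - sharpTorsion a b z η ζ * b z q)
        - dzReal e z q * sesqForm (cutForm a b z) η ζ := by
    intro z η ζ
    have := sum_linComb₃_mul (2 * (e z : ℂ)) (-(2 * (e z : ℂ) * b z q)) (-dzReal e z q)
      (fun r => horizBetaCoef Φ b q r z η)
      (fun r => ∑ m, sharp a b z m * lowerBar (hermTorsion a z m) η r)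
      (fun r => lowerBar (cutForm a b z) η r) (fun r => conj (ζ r))
    rw [← sharpTorsion_eq_sum, ← sesqForm_eq_sum_lowerBar] at this
    exact Eq.trans (Finset.sum_congr rfl fun r _ => by ring) (this.trans (by ring))
  have s3 : ∀ z η ζ : Cn n, ∑ r, (linForm (dzReal e z) η * lowerBar (cutForm a b z) η r
        + 2 * (e z : ℂ) * (∑ m, sharp a b z m * lowerBar (hermTorsion a z m) η r)
          * linForm (b z) η) * conj (ζ r)
      = linForm (dzReal e z) η * sesqForm (cutForm a b z) η ζ
        + 2 * e z * sharpTorsion a b z η ζ * linForm (b z) η := by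
    intro z η ζ
    have := sum_linComb₃_mul (linForm (dzReal e z) η) (2 * (e z : ℂ) * linForm (b z) η) 0
      (fun r => lowerBar (cutForm a b z) η r)
      (fun r => ∑ m, sharp a b z m * lowerBar (hermTorsion a z m) η r) 0 (fun r => conj (ζ r))
    rw [← sharpTorsion_eq_sum, ← sesqForm_eq_sum_lowerBar, zero_mul, add_zero] at this
    rw [mul_right_comm (2 * (e z : ℂ)), ← this]
    exact Finset.sum_congr rfl fun r _ => by ring
  have := AffineFor.sum_two_mul (dBarDir_derivation hΩ fun r => conj (ζ r))
    (affineFor_antilinear hΩ c1 _) (affineFor_antilinear hΩ c2 _) (affineFor_antilinear hΩ c3 _)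
    (affineFor_antilinear hΩ c4 _) (fun z η hp => by
      rw [s2, s3, ← sesqForm_eq_sum_lowerBar, ← h.horizDeriv_beta_sq hp]
      exact hid z η hp) hp
  rwa [s2, s3, ← sesqForm_eq_sum_lowerBar] at this

/-- For projectively related metrics the torsion of `a` is annihilated by `b`. -/
theorem sharpTorsion_eq_zero (h : IsNavigation U a b e)
    (hΦ : ∀ z ∈ U, ∀ η, Φ z η = Real.sqrt (sesqForm (a z) η η).re)
    (hid : ∀ q z η, (z, η) ∈ randersDomain U b → sesqForm (cutForm a b z) η η * (2 * e z
        * (horizDeriv Φ q (fun z η => linForm (b z) η * conj (linForm (b z) η)) z η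
          - sharpTorsion a b z η η * b z q) - dzReal e z q * sesqForm (cutForm a b z) η η)
      + (linForm (dzReal e z) η * sesqForm (cutForm a b z) η η
        + 2 * e z * sharpTorsion a b z η η * linForm (b z) η) * lower (cutForm a b z) η q = 0)
    (hz : z ∈ U) (η ζ : Cn n) : sharpTorsion a b z η ζ = 0 := by
  have hR := h.randers
  -- If C(η, ζ) = 0, the polarized identity reduces to a multiple of the torsion times C(·, ζ), and
  -- C(·, ζ) is not zero.
  have step1 : ∀ η ζ : Cn n, ζ ≠ 0 → linForm (b z) η ≠ 0 → sesqForm (cutForm a b z) η ζ = 0 →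
      sharpTorsion a b z η ζ = 0 := by
    intro η ζ hζ hη h0
    by_contra ht
    refine h.cut_ne hz hζ ?_
    rw [sesqForm_eq_sum_lower]
    refine Finset.sum_eq_zero fun q _ => ?_
    have := h.proj_identity_polarized hΦ (hid q) (z := z) (η := η) ⟨hz, hη⟩ ζ
    rw [h0, zero_mul, mul_zero, zero_add, zero_add] at this
    have hne : 2 * (e z : ℂ) * sharpTorsion a b z η ζ * linForm (b z) η ≠ 0 :=
      mul_ne_zero (mul_ne_zero (mul_ne_zero two_ne_zero (h.e_ne hz)) ht) hη
    rw [(mul_eq_zero.1 this).resolve_left hne, zero_mul]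
  have hν := hR.normB_pos hz
  have hν' := h.normB_lt_one hz
  have hνc : (normB a b z : ℂ) ≠ 0 := Complex.ofReal_ne_zero.2 hν.ne'
  have hνc' : (1 - normB a b z : ℂ) ≠ 0 := by
    rw [← Complex.ofReal_one, ← Complex.ofReal_sub]
    exact Complex.ofReal_ne_zero.2 (by linarith)
  -- Correct η by a multiple of b♯ to make it C-orthogonal to ζ. This keeps β nonzero and, by
  -- `sharpTorsion_sharp`, changes the torsion only by the factor `s`.
  have step2 : ∀ η ζ : Cn n, linForm (b z) η = 0 → linForm (b z) ζ ≠ 0 →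
      sesqForm (a z) η ζ ≠ 0 → sharpTorsion a b z η ζ = 0 := by
    intro η ζ hη hζ hne
    set s := (1 - normB a b z : ℂ) * conj (linForm (b z) ζ) with hs
    have hs0 : s ≠ 0 := mul_ne_zero hνc' (by simpa using hζ)
    have hcut : sesqForm (cutForm a b z) η ζ = sesqForm (a z) η ζ := by
      rw [sesqForm_cutForm, hη, zero_mul, sub_zero]
    have := step1 (s • η + (-sesqForm (a z) η ζ) • sharp a b z) ζ
      (linForm_ne_zero hζ) (by
        rw [linForm_add, linForm_smul, linForm_smul, hη, hR.linForm_sharp hz, mul_zero, zero_add]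
        exact mul_ne_zero (neg_ne_zero.2 hne) hνc) (by
        rw [sesqForm_add_left, sesqForm_smul_left, sesqForm_smul_left, h.cutForm_sharp hz, hcut]
        ring)
    rw [sharpTorsion_add_left, sharpTorsion_smul_left, sharpTorsion_smul_left, sharpTorsion_sharp,
      mul_zero, add_zero] at this
    exact (mul_eq_zero.1 this).resolve_left hs0
  -- For fixed η the previous step excludes only two hyperplanes of ζ, and an antilinear form
  -- vanishing off them is zero.
  have step3 : ∀ η ζ : Cn n, linForm (b z) η = 0 → sharpTorsion a b z η ζ = 0 := by
    intro η ζ hη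
    by_cases hη0 : η = 0
    · subst hη0; simp [sharpTorsion, sesqForm]
    have hb' : (fun q => conj (b z q)) ≠ 0 := fun h0 => hR.b_ne z hz <| funext fun q => by
      have := congrFun h0 q
      simpa using this
    have ha' : (fun q => lowerBar (a z) η q) ≠ 0 := fun h0 => hR.herm.sesqForm_ne hz hη0 <| by
      rw [sesqForm_eq_sum_lowerBar]
      exact Finset.sum_eq_zero fun q _ => by rw [show lowerBar (a z) η q = 0 from congrFun h0 q,
        zero_mul]
    have hr := linForm_eq_zero_of_ne_ne
      (r := fun q => ∑ m, sharp a b z m * lowerBar (hermTorsion a z m) η q) hb' ha' fun ξ h1 h2 => by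
      have := step2 η (fun q => conj (ξ q)) hη (fun h0 => h1 <| by
        have := congrArg conj h0
        simpa [linForm, map_sum, map_mul] using this) (fun h0 => h2 <| by
        rw [sesqForm_eq_sum_lowerBar] at h0
        simpa [linForm] using h0)
      rw [sharpTorsion_eq_sum] at this
      simpa [linForm] using this
    rw [sharpTorsion_eq_sum]
    exact Finset.sum_eq_zero fun q _ => by
      rw [show (∑ m, sharp a b z m * lowerBar (hermTorsion a z m) η q) = 0 from congrFun hr q,
        zero_mul]
  -- Every η is a vector of ker β plus a multiple of b♯.
  have := step3 (η + (-(linForm (b z) η / normB a b z)) • sharp a b z) ζ (by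
    rw [linForm_add, linForm_smul, hR.linForm_sharp hz]; field_simp; ring)
  rwa [sharpTorsion_add_left, sharpTorsion_smul_left, sharpTorsion_sharp, mul_zero,
    add_zero] at this

/-- For projectively related metrics, the horizontal derivative of `|β|²` is determined by `e`. -/
theorem horizDeriv_beta_sq_eq (h : IsNavigation U a b e)
    (hΦ : ∀ z ∈ U, ∀ η, Φ z η = Real.sqrt (sesqForm (a z) η η).re)
    (hid : ∀ q z η, (z, η) ∈ randersDomain U b → sesqForm (cutForm a b z) η η * (2 * e z
        * (horizDeriv Φ q (fun z η => linForm (b z) η * conj (linForm (b z) η)) z η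
          - sharpTorsion a b z η η * b z q) - dzReal e z q * sesqForm (cutForm a b z) η η)
      + (linForm (dzReal e z) η * sesqForm (cutForm a b z) η η
        + 2 * e z * sharpTorsion a b z η η * linForm (b z) η) * lower (cutForm a b z) η q = 0)
    (hp : (z, η) ∈ randersDomain U b) (q : Fin n) :
    2 * e z * horizDeriv Φ q (fun z η => linForm (b z) η * conj (linForm (b z) η)) z η
      = dzReal e z q * sesqForm (cutForm a b z) η η
        - linForm (dzReal e z) η * lower (cutForm a b z) η q := by
  have e1 := hid q z η hp
  rw [h.sharpTorsion_eq_zero hΦ hid hp.1] at e1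
  apply mul_left_cancel₀ (h.cut_ne hp.1 (linForm_ne_zero hp.2))
  linear_combination e1

/-- For projectively related metrics and a generalized Berwald Randers metric, `∂e` vanishes in
the direction dual to `β`. -/
theorem dzReal_sharp (h : IsNavigation U a b e) (hn : 2 ≤ n)
    (hΦ : ∀ z ∈ U, ∀ η, Φ z η = Real.sqrt (sesqForm (a z) η η).re)
    (hb : ∀ z η, (z, η) ∈ randersDomain U b → ∀ q,
      sprayDeriv Φ (fun z η => linForm (b z) η) z η * conj (b z q)
        + linForm (b z) η * dzConjB b q z η = 0)
    (hB : ∀ q z η, (z, η) ∈ randersDomain U b →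
      2 * e z * horizDeriv Φ q (fun z η => linForm (b z) η * conj (linForm (b z) η)) z η
      = dzReal e z q * sesqForm (cutForm a b z) η η
        - linForm (dzReal e z) η * lower (cutForm a b z) η q)
    (hz : z ∈ U) : linForm (dzReal e z) (sharp a b z) = 0 := by
  have hR := h.randers
  have hΩ := hR.isOpen_domain
  obtain ⟨w, hw, hbw⟩ := exists_ker_ne_zero hn (b z)
  have hcw : ∑ q, conj (b z q) * conj (w q) = 0 := by
    simp only [← map_mul, ← map_sum]
    rw [show ∑ q, b z q * w q = 0 from hbw, map_zero]
  -- Contracting `hb` with w̄, where β(w) = 0, removes its first term, and β(ξ) can be divided out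
  -- of the second.
  have hdw : (fun j => ∑ q, wirtinger j (fun z => conj (b z q)) z * conj (w q)) = 0 := by
    refine linForm_eq_zero_of_ne (hR.b_ne z hz) fun ξ hξ => ?_
    have e1 : ∑ q, (sprayDeriv Φ (fun z η => linForm (b z) η) z ξ * conj (b z q)
        + linForm (b z) ξ * dzConjB b q z ξ) * conj (w q) = 0 :=
      Finset.sum_eq_zero fun q _ => by rw [hb z ξ ⟨hz, hξ⟩ q, zero_mul]
    have e2 := sum_linComb₃_mul (sprayDeriv Φ (fun z η => linForm (b z) η) z ξ)
      (linForm (b z) ξ) 0 (fun q => conj (b z q)) (fun q => dzConjB b q z ξ) 0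
      (fun q => conj (w q))
    rw [hcw, mul_zero, zero_mul, add_zero, zero_add] at e2
    simp only [zero_mul, add_zero] at e2
    rw [e1] at e2
    have e3 := (mul_eq_zero.1 e2.symm).resolve_left hξ
    rw [← e3]
    simp only [linForm, dzConjB, Finset.sum_mul]
    rw [Finset.sum_comm]
    exact Finset.sum_congr rfl fun q _ => Finset.sum_congr rfl fun j _ => by ring
  have hs : (z, sharp a b z) ∈ randersDomain U b := ⟨hz, by
    change linForm (b z) (sharp a b z) ≠ 0
    rw [hR.linForm_sharp hz]; exact Complex.ofReal_ne_zero.2 (hR.normB_pos hz).ne'⟩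
  -- Polarize `hB` at η = b♯ with η̄ replaced by w̄. By `hcw` and `hdw` the derivative of |β|²
  -- contributes nothing, and C(b♯, w) is a multiple of conj β(w) = 0; only ∂e(b♯) C(·, w) survives.
  have pol : ∀ q, linForm (dzReal e z) (sharp a b z) * lower (cutForm a b z) w q = 0 := by
    intro q
    have c : ∀ r, HolOn (randersDomain U b) (fun z η => 2 * (e z : ℂ) * horizBetaCoef Φ b q r z η
        - (dzReal e z q * lowerBar (cutForm a b z) η r
          - linForm (dzReal e z) η * cutForm a b z q r)) := fun r =>
      (((HolOn.const 2).mul hΩ h.holOn_e).mul hΩ (h.holOn_horizBetaCoef hΦ q r)).sub hΩ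
        (((h.holOn_dzReal q).mul hΩ (h.holOn_lowerBar_cut r)).sub hΩ
          (h.holOn_linForm_dzReal.mul hΩ (h.holOn_cutForm q r)))
    have s : ∀ z η ζ : Cn n, ∑ r, (2 * (e z : ℂ) * horizBetaCoef Φ b q r z η
        - (dzReal e z q * lowerBar (cutForm a b z) η r
          - linForm (dzReal e z) η * cutForm a b z q r)) * conj (ζ r)
        = 2 * e z * ∑ r, horizBetaCoef Φ b q r z η * conj (ζ r)
          - dzReal e z q * sesqForm (cutForm a b z) η ζ
          + linForm (dzReal e z) η * lower (cutForm a b z) ζ q := by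
      intro z η ζ
      have := sum_linComb₃_mul (2 * (e z : ℂ)) (-dzReal e z q) (linForm (dzReal e z) η)
        (fun r => horizBetaCoef Φ b q r z η) (fun r => lowerBar (cutForm a b z) η r)
        (fun r => cutForm a b z q r) (fun r => conj (ζ r))
      rw [← sesqForm_eq_sum_lowerBar] at this
      rw [sub_eq_add_neg _ (dzReal e z q * sesqForm (cutForm a b z) η ζ), ← neg_mul]
      refine Eq.trans (Finset.sum_congr rfl fun r _ => by ring) this
    have key := AffineFor.eq_zero (dBarDir_derivation hΩ fun r => conj (w r))
      (affineFor_antilinear hΩ c _) (fun z η hp => by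
        rw [s, ← h.horizDeriv_beta_sq hp, hB q z η hp]; ring) hs
    rw [s, h.cutForm_sharp hz, hbw, map_zero, mul_zero, mul_zero, sub_zero] at key
    have e4 : ∑ r, horizBetaCoef Φ b q r z (sharp a b z) * conj (w r) = 0 := by
      have := sum_linComb₃_mul (linForm (fun i => wirtinger q (fun z => b z i) z) (sharp a b z)
        - ∑ p, dEta q (spray Φ p) z (sharp a b z) * b z p) (linForm (b z) (sharp a b z)) 0
        (fun r => conj (b z r)) (fun r => wirtinger q (fun z => conj (b z r)) z) 0
        (fun r => conj (w r))
      rw [hcw, show ∑ r, wirtinger q (fun z => conj (b z r)) z * conj (w r) = 0 from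
        congrFun hdw q] at this
      simp only [mul_zero, zero_mul, add_zero] at this
      exact this
    rw [e4, mul_zero, zero_add] at key
    exact key
  by_contra h0
  refine h.cut_ne hz hw ?_
  rw [sesqForm_eq_sum_lower]
  exact Finset.sum_eq_zero fun q _ => by
    rw [(mul_eq_zero.1 (pol q)).resolve_left h0, zero_mul]

end IsNavigation


/-! ### The spray and the torsion of the Randers metric -/

namespace IsRanders

variable {n : ℕ} {U : Set (Cn n)} {a : Cn n → Fin n → Fin n → ℂ} {b : Cn n → Fin n → ℂ}
  {z η : Cn n} {F Φ : Cn n → Cn n → ℝ}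

/-- Equal sprays give equal horizontal operators, so this is the chain rule for (α + |β|)² in terms
of α² and |β|². -/
theorem horizontal_eq (h : IsRanders U a b)
    (hF : ∀ z ∈ U, ∀ η, F z η = Real.sqrt (sesqForm (a z) η η).re + ‖linForm (b z) η‖)
    (hΦ : ∀ z ∈ U, ∀ η, Φ z η = Real.sqrt (sesqForm (a z) η η).re)
    (hS : ∀ z η, (z, η) ∈ randersDomain U b → ∀ i, spray F i z η = spray Φ i z η)
    (hp : (z, η) ∈ randersDomain U b) (m : Fin n) :
    horizontal F m z η = (alphaFn a z η + absBeta b z η)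
      * (horizontal Φ m z η / alphaFn a z η
        + horizDeriv Φ m (fun z η => linForm (b z) η * conj (linForm (b z) η)) z η
          / absBeta b z η) := by
  have hΩ := h.isOpen_domain
  have hD := horizDeriv_derivation (Φ := Φ) hΩ hp m
  have h1 : horizontal F m z η = horizDeriv Φ m (sqMetric F) z η := by
    simp only [horizontal, horizDeriv,
      fun p => (isDirectional_dEta _ m).congr hΩ (fun z η hp => hS z η hp p) hp]
  have h2 : horizontal Φ m z η = horizDeriv Φ m (fun z η => sesqForm (a z) η η) z η :=
    hD.congr fun z η hp => h.herm.sqMetric_eq hΦ hp.1 η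
  rw [h1, h.derivation_sqMetric hF hD, h2, ← h.derivation_alphaFn hD,
    hD.mul h.smoothOn_beta h.smoothOn_beta.conjugate, ← h.derivation_absBeta hD]
  have := h.alphaFn_ne hp
  have := absBeta_ne hp
  field_simp

end IsRanders

namespace IsNavigation

variable {n : ℕ} {U : Set (Cn n)} {a : Cn n → Fin n → Fin n → ℂ} {b : Cn n → Fin n → ℂ}
  {e : Cn n → ℝ} {z η : Cn n} {F Φ : Cn n → Cn n → ℝ}

/-- The equations determining `θ*` of the Randers metric. -/
theorem thetaStar_randers (h : IsNavigation U a b e)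
    (hF : ∀ z ∈ U, ∀ η, F z η = Real.sqrt (sesqForm (a z) η η).re + ‖linForm (b z) η‖)
    (hΦ : ∀ z ∈ U, ∀ η, Φ z η = Real.sqrt (sesqForm (a z) η η).re)
    (hS : ∀ z η, (z, η) ∈ randersDomain U b → ∀ i, spray F i z η = spray Φ i z η)
    (hb : ∀ z η, (z, η) ∈ randersDomain U b → ∀ q,
      sprayDeriv Φ (fun z η => linForm (b z) η) z η * conj (b z q)
        + linForm (b z) η * dzConjB b q z η = 0)
    {R : Fin n → ℂ} (hp : (z, η) ∈ randersDomain U b)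
    (hR : ∀ m, R m = conj (horizontal Φ m z η / alphaFn a z η
        + horizDeriv Φ m (fun z η => linForm (b z) η * conj (linForm (b z) η)) z η
          / absBeta b z η)) :
    absBeta b z η * sesqForm (a z) (fun k => thetaStar F k z η) η
        + alphaFn a z η * conj (linForm (b z) η) * linForm (b z) (fun k => thetaStar F k z η) = 0 ∧
    (∀ m, lowerBar (a z) (fun k => thetaStar F k z η) m / (2 * alphaFn a z η)
      - sesqForm (a z) (fun k => thetaStar F k z η) η * lowerBar (a z) η m
        / (4 * alphaFn a z η ^ 3)
      + linForm (b z) (fun k => thetaStar F k z η) * conj (b z m) / (4 * absBeta b z η) = R m) ∧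
    linForm (b z) (fun k => thetaStar F k z η) * (2 * alphaFn a z η * absBeta b z η
      + absBeta b z η ^ 2 + normB a b z * alphaFn a z η ^ 2)
      = 4 * alphaFn a z η ^ 2 * absBeta b z η * ∑ m, R m * conj (sharp a b z m) := by
  have hα : conj (alphaFn a z η) = alphaFn a z η := Complex.conj_ofReal _
  have hγ : conj (absBeta b z η) = absBeta b z η := Complex.conj_ofReal _
  refine h.randers.solve_fundTensor hF hp (fun m => ?_) ?_
  · rw [(h.randers.isMetricOn hF).sum_thetaStar_mul hp, h.randers.horizontal_eq hF hΦ hS hp, hR,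
      map_mul, map_add, hα, hγ]
    ring
  · have s1 : ∑ m, η m * horizontal Φ m z η = 0 := by
      rw [← (h.randers.isMetricOn_alpha hΦ).sprayDeriv_sqMetric hp,
        ← (h.randers.isMetricOn_alpha hΦ).sum_horizDeriv hp]
      rfl
    have s2 := h.sum_horizDeriv_beta_sq hΦ hb hp
    have s3 : ∑ m, (horizontal Φ m z η / alphaFn a z η
        + horizDeriv Φ m (fun z η => linForm (b z) η * conj (linForm (b z) η)) z η
          / absBeta b z η) * η m = 0 := by
      have e : ∑ m, (horizontal Φ m z η / alphaFn a z η
        + horizDeriv Φ m (fun z η => linForm (b z) η * conj (linForm (b z) η)) z η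
          / absBeta b z η) * η m = (∑ m, η m * horizontal Φ m z η) / alphaFn a z η
          + (∑ m, η m * horizDeriv Φ m (fun z η => linForm (b z) η * conj (linForm (b z) η)) z η)
            / absBeta b z η := by
        rw [Finset.sum_div, Finset.sum_div, ← Finset.sum_add_distrib]
        exact Finset.sum_congr rfl fun m _ => by ring
      rw [e, s1, s2, zero_div, zero_div, add_zero]
    simp only [hR, ← map_mul, ← map_sum]
    rw [s3, map_zero]

/-- If `∂e = 0`, the Randers metric has the torsion of `a`. -/
theorem thetaStar_eq (h : IsNavigation U a b e)
    (hF : ∀ z ∈ U, ∀ η, F z η = Real.sqrt (sesqForm (a z) η η).re + ‖linForm (b z) η‖)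
    (hΦ : ∀ z ∈ U, ∀ η, Φ z η = Real.sqrt (sesqForm (a z) η η).re)
    (hS : ∀ z η, (z, η) ∈ randersDomain U b → ∀ i, spray F i z η = spray Φ i z η)
    (hb : ∀ z η, (z, η) ∈ randersDomain U b → ∀ q,
      sprayDeriv Φ (fun z η => linForm (b z) η) z η * conj (b z q)
        + linForm (b z) η * dzConjB b q z η = 0)
    (hA : ∀ z ∈ U, ∀ η ζ, sharpTorsion a b z η ζ = 0)
    (hB : ∀ q z η, (z, η) ∈ randersDomain U b →
      2 * e z * horizDeriv Φ q (fun z η => linForm (b z) η * conj (linForm (b z) η)) z η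
      = dzReal e z q * sesqForm (cutForm a b z) η η
        - linForm (dzReal e z) η * lower (cutForm a b z) η q)
    (he : dzReal e z = 0) (hp : (z, η) ∈ randersDomain U b) (k : Fin n) :
    thetaStar F k z η = thetaStar Φ k z η := by
  have hB0 : ∀ q, horizDeriv Φ q (fun z η => linForm (b z) η * conj (linForm (b z) η)) z η = 0 := by
    intro q
    have := hB q z η hp
    simp only [he, linForm, Pi.zero_apply, zero_mul, Finset.sum_const_zero, sub_zero,
      mul_eq_zero, two_ne_zero, h.e_ne hp.1, false_or] at this
    exact this
  have hα := h.randers.alphaFn_ne hp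
  have hαc : conj (alphaFn a z η) = alphaFn a z η := Complex.conj_ofReal _
  obtain ⟨e1, e2, e3⟩ := h.thetaStar_randers hF hΦ hS hb hp fun m => rfl
  simp only [hB0, zero_div, add_zero] at e2 e3
  have e4 : ∑ m, conj (horizontal Φ m z η / alphaFn a z η) * conj (sharp a b z m) = 0 := by
    have : ∑ m, horizontal Φ m z η / alphaFn a z η * sharp a b z m
        = sharpTorsion a b z η η / alphaFn a z η := by
      rw [sharpTorsion, Finset.sum_div]
      refine Finset.sum_congr rfl fun m _ => ?_
      rw [h.horizontal_alpha hΦ hp]; ring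
    simp only [← map_mul, ← map_sum]
    rw [this, hA z hp.1, zero_div, map_zero]
  rw [e4, mul_zero] at e3
  -- The torsion annihilates b♯, hence β(θ*) = 0 and then a(θ*, η) = 0. The remaining equation is
  -- the one that determines θ* of α.
  have e5 := (mul_eq_zero.1 e3).resolve_right (h.randers.denom_ne hp)
  rw [e5, mul_zero, add_zero] at e1
  have e6 := (mul_eq_zero.1 e1).resolve_left (IsRanders.absBeta_ne hp)
  refine congrFun (h.randers.herm.eq_of_sum hp.1 (v := fun k => thetaStar F k z η)
    (w := fun k => thetaStar Φ k z η) fun q => ?_) k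
  have e7 := e2 q
  rw [e5, e6, map_div₀, hαc] at e7
  have e8 := h.lowerBar_thetaStar hΦ hp q
  have e9 : lowerBar (a z) (fun k => thetaStar F k z η) q = 2 * conj (horizontal Φ q z η) := by
    simp only [zero_mul, zero_div, sub_zero, add_zero] at e7
    field_simp at e7
    linear_combination e7
  rw [← e9] at e8
  simp only [lowerBar] at e8
  simpa only [mul_comm] using e8.symm

/-- The part of `θ*` of the Randers metric transversal to `η`. -/
theorem linForm_thetaStar_mul (h : IsNavigation U a b e)
    (hF : ∀ z ∈ U, ∀ η, F z η = Real.sqrt (sesqForm (a z) η η).re + ‖linForm (b z) η‖)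
    (hΦ : ∀ z ∈ U, ∀ η, Φ z η = Real.sqrt (sesqForm (a z) η η).re)
    (hS : ∀ z η, (z, η) ∈ randersDomain U b → ∀ i, spray F i z η = spray Φ i z η)
    (hb : ∀ z η, (z, η) ∈ randersDomain U b → ∀ q,
      sprayDeriv Φ (fun z η => linForm (b z) η) z η * conj (b z q)
        + linForm (b z) η * dzConjB b q z η = 0)
    (hA : ∀ z ∈ U, ∀ η ζ, sharpTorsion a b z η ζ = 0)
    (hB : ∀ q z η, (z, η) ∈ randersDomain U b →
      2 * e z * horizDeriv Φ q (fun z η => linForm (b z) η * conj (linForm (b z) η)) z η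
      = dzReal e z q * sesqForm (cutForm a b z) η η
        - linForm (dzReal e z) η * lower (cutForm a b z) η q)
    (hs : linForm (dzReal e z) (sharp a b z) = 0) (hp : (z, η) ∈ randersDomain U b) :
    (linForm (b z) (fun k => thetaStar F k z η) * alphaFn a z η ^ 2
        - linForm (b z) η * sesqForm (a z) (fun k => thetaStar F k z η) η)
      * (2 * alphaFn a z η * absBeta b z η + absBeta b z η ^ 2
        + normB a b z * alphaFn a z η ^ 2)
      = -2 * (1 - normB a b z) * conj (linForm (dzReal e z) η) / e z * linForm (b z) η
        * alphaFn a z η ^ 3 * (alphaFn a z η + absBeta b z η) := by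
  have hα := h.randers.alphaFn_ne hp
  have hγ := IsRanders.absBeta_ne hp
  have he := h.e_ne hp.1
  have hαc : conj (alphaFn a z η) = alphaFn a z η := Complex.conj_ofReal _
  have hγc : conj (absBeta b z η) = absBeta b z η := Complex.conj_ofReal _
  have hγ2 := IsRanders.absBeta_mul_self (b := b) z η
  obtain ⟨e1, -, e3⟩ := h.thetaStar_randers hF hΦ hS hb hp fun m => rfl
  -- Contract `hB` with b♯: the term with ∂e(b♯) vanishes by `hs`, and C(b♯, η) = (1 - ν) conj β(η).
  have e4 : ∑ m, horizDeriv Φ m (fun z η => linForm (b z) η * conj (linForm (b z) η)) z η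
      * sharp a b z m = - (linForm (dzReal e z) η / (2 * e z)) * ((1 - normB a b z)
        * conj (linForm (b z) η)) := by
    have t1 : 2 * (e z : ℂ) * ∑ m, horizDeriv Φ m
        (fun z η => linForm (b z) η * conj (linForm (b z) η)) z η * sharp a b z m
        = sesqForm (cutForm a b z) η η * linForm (dzReal e z) (sharp a b z)
          - linForm (dzReal e z) η * sesqForm (cutForm a b z) (sharp a b z) η := by
      rw [sesqForm_eq_sum_lower _ (sharp a b z), linForm, linForm, Finset.mul_sum, Finset.mul_sum,
        Finset.mul_sum, ← Finset.sum_sub_distrib]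
      refine Finset.sum_congr rfl fun m _ => ?_
      rw [← mul_assoc, hB m z η hp, linForm]; ring
    rw [hs, h.cutForm_sharp hp.1, mul_zero, zero_sub] at t1
    field_simp
    linear_combination t1
  have e5 : ∑ m, conj (horizontal Φ m z η / alphaFn a z η
        + horizDeriv Φ m (fun z η => linForm (b z) η * conj (linForm (b z) η)) z η
          / absBeta b z η) * conj (sharp a b z m)
      = - (conj (linForm (dzReal e z) η) / (2 * e z)) * ((1 - normB a b z)
        * linForm (b z) η) / absBeta b z η := by
    have : ∑ m, (horizontal Φ m z η / alphaFn a z η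
        + horizDeriv Φ m (fun z η => linForm (b z) η * conj (linForm (b z) η)) z η
          / absBeta b z η) * sharp a b z m
        = sharpTorsion a b z η η / alphaFn a z η + (∑ m, horizDeriv Φ m
          (fun z η => linForm (b z) η * conj (linForm (b z) η)) z η * sharp a b z m)
            / absBeta b z η := by
      rw [sharpTorsion, Finset.sum_div, Finset.sum_div, ← Finset.sum_add_distrib]
      refine Finset.sum_congr rfl fun m _ => ?_
      rw [h.horizontal_alpha hΦ hp]; ring
    simp only [← map_mul, ← map_sum]
    rw [this, hA z hp.1, e4, zero_div, zero_add]
    simp only [map_div₀, map_mul, map_neg, map_sub, map_one, map_ofNat, Complex.conj_conj,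
      Complex.conj_ofReal, hγc]
  rw [e5] at e3
  set x := linForm (b z) (fun k => thetaStar F k z η)
  set y := sesqForm (a z) (fun k => thetaStar F k z η) η
  -- The tangency relation multiplied by β; it eliminates y, since ββ̄ = |β|².
  have e6 : linForm (b z) η * y = - alphaFn a z η * absBeta b z η * x := by
    apply mul_left_cancel₀ hγ
    linear_combination linForm (b z) η * e1 + alphaFn a z η * x * hγ2
  rw [e6]
  have e7 : (x * alphaFn a z η ^ 2 - -alphaFn a z η * absBeta b z η * x)
      * (2 * alphaFn a z η * absBeta b z η + absBeta b z η ^ 2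
        + normB a b z * alphaFn a z η ^ 2) = alphaFn a z η * (alphaFn a z η + absBeta b z η)
        * (x * (2 * alphaFn a z η * absBeta b z η + absBeta b z η ^ 2
        + normB a b z * alphaFn a z η ^ 2)) := by ring
  rw [e7, e3]
  field_simp
  ring

end IsNavigation


/-! ### Incompatibility of the Randers torsion equation with polynomial dependence on t. -/

theorem eq_zero_of_eq_zero_on_pos {f : ℝ → ℂ} (hf : Continuous f) (h : ∀ t, 0 < t → f t = 0) :
    f 0 = 0 := by
  have h1 : Filter.Tendsto f (nhdsWithin 0 (Set.Ioi 0)) (nhds (f 0)) :=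
    hf.continuousAt.tendsto.mono_left nhdsWithin_le_nhds
  refine tendsto_nhds_unique h1 (tendsto_const_nhds.congr' ?_)
  filter_upwards [self_mem_nhdsWithin] with t ht
  exact (h t ht).symm

theorem eval_decomp (p : Polynomial ℂ) : ∃ (c₀ c₁ c₂ : ℂ) (q : Polynomial ℂ), ∀ x,
    p.eval x = c₀ + c₁ * x + c₂ * x ^ 2 + q.eval x * x ^ 3 := by
  refine ⟨p.coeff 0, p.divX.coeff 0, p.divX.divX.coeff 0, p.divX.divX.divX, fun x => ?_⟩
  conv_lhs => rw [← p.divX_mul_X_add, ← p.divX.divX_mul_X_add, ← p.divX.divX.divX_mul_X_add]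
  simp only [Polynomial.eval_add, Polynomial.eval_mul, Polynomial.eval_X, Polynomial.eval_C]
  ring

/-- No polynomial satisfies the Randers torsion equation along a real line. -/
theorem not_polynomial_randers {p : Polynomial ℂ} {A ν : ℝ} {c : ℂ} (hA : 0 < A) (hν : 0 < ν)
    (hν1 : ν < 1) (hc : c ≠ 0)
    (h : ∀ t : ℝ, t ≠ 0 → p.eval (t : ℂ) * (2 * (Real.sqrt (A + ν * t ^ 2) : ℝ) * (|t| * ν : ℝ)
      + (|t| * ν : ℝ) ^ 2 + ν * (Real.sqrt (A + ν * t ^ 2) : ℝ) ^ 2)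
      = c * t * (Real.sqrt (A + ν * t ^ 2) : ℝ) ^ 3
        * ((Real.sqrt (A + ν * t ^ 2) : ℝ) + (|t| * ν : ℝ))) : False := by
  obtain ⟨c₀, c₁, c₂, q, hq⟩ := eval_decomp p
  have hqc : Continuous fun t : ℝ => q.eval (t : ℂ) := q.continuous.comp Complex.continuous_ofReal
  have hqc' : Continuous fun t : ℝ => q.eval (-t : ℂ) :=
    q.continuous.comp Complex.continuous_ofReal.neg
  -- The right side is odd in t, and the factor multiplying p is even and positive, so p is odd
  -- where t ≠ 0. Hence c₀ and c₂ vanish.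
  have hodd : ∀ t : ℝ, 0 < t → p.eval (t : ℂ) + p.eval (-t : ℂ) = 0 := by
    intro t ht
    have h1 := h t ht.ne'
    have h2 := h (-t) (neg_ne_zero.2 ht.ne')
    rw [abs_neg, neg_sq] at h2
    have hs : 0 < Real.sqrt (A + ν * t ^ 2) := Real.sqrt_pos.2 (by positivity)
    have hD : (2 * (Real.sqrt (A + ν * t ^ 2) : ℝ) * (|t| * ν : ℝ)
      + (|t| * ν : ℝ) ^ 2 + ν * (Real.sqrt (A + ν * t ^ 2) : ℝ) ^ 2 : ℂ) ≠ 0 := by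
      norm_cast
      positivity
    refine (mul_eq_zero.1 ?_).resolve_right hD
    push_cast at h1 h2 ⊢
    linear_combination h1 + h2
  have h0 : c₀ = 0 := by
    have := eq_zero_of_eq_zero_on_pos
      (f := fun t : ℝ => c₀ + c₂ * t ^ 2 + (q.eval (t : ℂ) - q.eval (-t : ℂ)) * t ^ 3 / 2)
      (by fun_prop) fun t ht => by
        have := hodd t ht
        rw [hq, hq] at this
        linear_combination this / 2
    simpa using this
  have h2 : c₂ = 0 := by
    have := eq_zero_of_eq_zero_on_pos
      (f := fun t : ℝ => c₂ + (q.eval (t : ℂ) - q.eval (-t : ℂ)) * t / 2)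
      (by fun_prop) fun t ht => by
        have := hodd t ht
        rw [hq, hq, h0] at this
        have ht' : (t : ℂ) ^ 2 ≠ 0 := pow_ne_zero _ (Complex.ofReal_ne_zero.2 ht.ne')
        apply mul_left_cancel₀ ht'
        linear_combination this / 2
    simpa using this
  have hsc : Continuous fun t : ℝ => ((Real.sqrt (A + ν * t ^ 2) : ℝ) : ℂ) := by fun_prop
  have hsq : ∀ t : ℝ, ((Real.sqrt (A + ν * t ^ 2) : ℝ) : ℂ) ^ 2 = A + ν * t ^ 2 := fun t => by
    rw [← Complex.ofReal_pow, Real.sq_sqrt (by positivity)]; push_cast; ring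
  have key : ∀ t : ℝ, 0 < t → (c₁ + q.eval (t : ℂ) * t ^ 2)
      * (2 * (Real.sqrt (A + ν * t ^ 2) : ℝ) * (t * ν) + (t * ν) ^ 2 + ν * (A + ν * t ^ 2))
      - c * (A + ν * t ^ 2) * ((A + ν * t ^ 2) + (Real.sqrt (A + ν * t ^ 2) : ℝ) * (t * ν)) = 0 := by
    intro t ht
    have h1 := h t ht.ne'
    rw [abs_of_pos ht, hq, h0, h2] at h1
    push_cast at h1
    have ht' : (t : ℂ) ≠ 0 := Complex.ofReal_ne_zero.2 ht.ne'
    apply mul_left_cancel₀ ht'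
    rw [mul_zero, ← hsq]
    linear_combination h1
  -- Order zero at t = 0: c₁ν = cA.
  have k1 := eq_zero_of_eq_zero_on_pos (by fun_prop) key
  have hA' : (A : ℂ) ≠ 0 := Complex.ofReal_ne_zero.2 hA.ne'
  have k1' : c₁ * ν = c * A := by
    simp only [Complex.ofReal_zero] at k1
    apply mul_left_cancel₀ hA'
    linear_combination k1
  -- The identity `key` with its order zero part removed and one factor t divided out. Its value at
  -- t = 0 gives 2c₁ = cA, the contribution of |t|.
  have k2 := eq_zero_of_eq_zero_on_pos (f := fun t : ℝ =>
      c₁ * (2 * (Real.sqrt (A + ν * t ^ 2) : ℝ) * ν + t * ν ^ 2 + ν * ν * t)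
      + q.eval (t : ℂ) * t
      * (2 * (Real.sqrt (A + ν * t ^ 2) : ℝ) * (t * ν) + (t * ν) ^ 2 + ν * (A + ν * t ^ 2))
      - c * (2 * A * ν * t + ν ^ 2 * t ^ 3)
      - c * (A + ν * t ^ 2) * (Real.sqrt (A + ν * t ^ 2) : ℝ) * ν)
    (by fun_prop) fun t ht => by
      have ht' : (t : ℂ) ≠ 0 := Complex.ofReal_ne_zero.2 ht.ne'
      apply mul_left_cancel₀ ht'
      linear_combination key t ht - A * k1'
  have hs0 : ((Real.sqrt A : ℝ) : ℂ) ≠ 0 := Complex.ofReal_ne_zero.2 (Real.sqrt_pos.2 hA).ne'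
  have hν' : (ν : ℂ) ≠ 0 := Complex.ofReal_ne_zero.2 hν.ne'
  have k2' : 2 * c₁ = c * A := by
    have e : A + ν * (0 : ℝ) ^ 2 = A := by ring
    simp only [e] at k2
    apply mul_left_cancel₀ (mul_ne_zero hs0 hν')
    simp only [Complex.ofReal_zero] at k2
    linear_combination k2
  -- The two relations together force ν = 2, impossible for ν < 1.
  have : c * A * ((ν : ℂ) - 2) = 0 := by linear_combination 2 * k1' - ν * k2'
  have hν2 : (ν : ℂ) - 2 ≠ 0 := by
    rw [sub_ne_zero]
    norm_cast
    linarith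
  exact mul_ne_zero (mul_ne_zero hc hA') hν2 this


/-! ### Metrics with polynomial spray and torsion -/

section Fibre

variable {n : ℕ} {Ω : Set (Cn n × Cn n)} {z η : Cn n} {P : Cn n → Cn n → ℂ}
  {F : Cn n → Cn n → ℝ}

/-- A sum of terms of bidegree (2,0) and (1,1) has constant second derivatives ∂̇_k∂̇_j and
∂̇_k̄∂̇_j. -/
theorem third_derivatives_eq_zero (hΩ : IsOpen Ω) {c d : Fin n → Fin n → ℂ}
    (h : ∀ ζ, (z, ζ) ∈ Ω → P z ζ = quadForm c ζ + sesqForm d ζ ζ) (hp : (z, η) ∈ Ω)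
    (j k l : Fin n) : dEta l (dEta k (dEta j P)) z η = 0 ∧
      dEtaBar l (dEta k (dEta j P)) z η = 0 ∧ dEtaBar l (dEtaBar k (dEta j P)) z η = 0 := by
  have hD := fun ζ => IsDerivationAt.dEta (Ω := Set.univ) (z := z) (η := ζ) isOpen_univ trivial
  have hD' := fun ζ => IsDerivationAt.dEtaBar (Ω := Set.univ) (z := z) (η := ζ) isOpen_univ trivial
  have e1 : ∀ ζ, (z, ζ) ∈ Ω → dEta j P z ζ = linForm (fun l => c j l + c l j) ζ
      + conj (linForm (fun l => conj (d j l)) ζ) := fun ζ hζ => by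
    rw [dEta_congr_fibre (g := fun _ ζ => quadForm c ζ + sesqForm d ζ ζ)
      ((eventually_fibre hΩ hζ).mono h), (hD ζ j).add (smoothOn_quadForm_const c)
      (smoothOn_sesqForm_const d), dEta_quadForm, dEta_sesqForm_const]
  have s1 : SmoothOn Set.univ (fun _ ζ => linForm (fun l => c j l + c l j) ζ) :=
    smoothOn_linForm_const _
  have s2 : SmoothOn Set.univ (fun _ ζ => conj (linForm (fun l => conj (d j l)) ζ)) :=
    (smoothOn_linForm_const _).conjugate
  have e2 : ∀ ζ, (z, ζ) ∈ Ω → dEta k (dEta j P) z ζ = c j k + c k j := fun ζ hζ => by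
    rw [dEta_congr_fibre (g := fun _ ζ => linForm (fun l => c j l + c l j) ζ
        + conj (linForm (fun l => conj (d j l)) ζ)) ((eventually_fibre hΩ hζ).mono e1),
      (hD ζ k).add s1 s2, dEta_linForm_const, dEta_conj_linForm_const, add_zero]
  have e3 : ∀ ζ, (z, ζ) ∈ Ω → dEtaBar k (dEta j P) z ζ = d j k := fun ζ hζ => by
    rw [dEtaBar_congr_fibre (g := fun _ ζ => linForm (fun l => c j l + c l j) ζ
        + conj (linForm (fun l => conj (d j l)) ζ)) ((eventually_fibre hΩ hζ).mono e1),
      (hD' ζ k).add s1 s2, dEtaBar_linForm_const, dEtaBar_conj_linForm_const, zero_add,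
      Complex.conj_conj]
  refine ⟨?_, ?_, ?_⟩
  · rw [dEta_congr_fibre (g := fun _ _ => c j k + c k j) ((eventually_fibre hΩ hp).mono e2)]
    exact dEta_base (fun _ => c j k + c k j) l z η
  · rw [dEtaBar_congr_fibre (g := fun _ _ => c j k + c k j) ((eventually_fibre hΩ hp).mono e2)]
    exact dEtaBar_base (fun _ => c j k + c k j) l z η
  · rw [dEtaBar_congr_fibre (g := fun _ _ => d j k) ((eventually_fibre hΩ hp).mono e3)]
    exact dEtaBar_base (fun _ => d j k) l z η

/-- The trace terms are linear in η, respectively in η̄, times ηⁱ, so they keep the bidegrees (2,0)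
and (1,1). -/
theorem exists_projSpray_eq (hΩ : IsOpen Ω) {c d : Fin n → Fin n → Fin n → ℂ}
    (hG : ∀ m ζ, (z, ζ) ∈ Ω → spray F m z ζ = quadForm (c m) ζ)
    (hT : ∀ m ζ, (z, ζ) ∈ Ω → thetaStar F m z ζ = sesqForm (d m) ζ ζ) (i : Fin n) :
    ∃ c' d' : Fin n → Fin n → ℂ, ∀ ζ, (z, ζ) ∈ Ω →
      projSpray F i z ζ = quadForm c' ζ + sesqForm d' ζ ζ := by
  refine ⟨fun l j => c i l j - (if j = i then ∑ m, (c m m l + c m l m) else 0) / ((n : ℂ) + 1),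
    fun l j => -(d i l j - (if l = i then ∑ m, d m m j else 0) / (n : ℂ)) / 2, fun ζ hζ => ?_⟩
  have e1 : ∑ m, dEta m (spray F m) z ζ = ∑ l, (∑ m, (c m m l + c m l m)) * ζ l := by
    simp only [Finset.sum_mul]
    rw [Finset.sum_comm]
    refine Finset.sum_congr rfl fun m _ => ?_
    rw [dEta_congr_fibre (g := fun _ ζ => quadForm (c m) ζ)
      ((eventually_fibre hΩ hζ).mono (hG m)), dEta_quadForm, linForm]
  have e2 : ∑ m, dEta m (thetaStar F m) z ζ = ∑ j, (∑ m, d m m j) * conj (ζ j) := by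
    simp only [Finset.sum_mul]
    rw [Finset.sum_comm]
    refine Finset.sum_congr rfl fun m _ => ?_
    rw [dEta_congr_fibre (g := fun _ ζ => sesqForm (d m) ζ ζ)
      ((eventually_fibre hΩ hζ).mono (hT m)), dEta_sesqForm_const, linForm]
    simp only [map_sum, map_mul, Complex.conj_conj]
  have e3 : quadForm (fun l j => c i l j
      - (if j = i then ∑ m, (c m m l + c m l m) else 0) / ((n : ℂ) + 1)) ζ
      = quadForm (c i) ζ - (∑ l, (∑ m, (c m m l + c m l m)) * ζ l) / ((n : ℂ) + 1) * ζ i := by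
    simp only [quadForm, sub_mul, Finset.sum_sub_distrib]
    congr 1
    rw [Finset.sum_div, Finset.sum_mul]
    refine Finset.sum_congr rfl fun l _ => ?_
    rw [Finset.sum_eq_single i (fun j _ hj => by simp [hj]) (by simp), if_pos rfl]
    ring
  have e4 : sesqForm (fun l j => -(d i l j - (if l = i then ∑ m, d m m j else 0) / (n : ℂ)) / 2) ζ ζ
      = -(sesqForm (d i) ζ ζ - (∑ j, (∑ m, d m m j) * conj (ζ j)) / (n : ℂ) * ζ i) / 2 := by
    have e5 : (∑ j, (∑ m, d m m j) * conj (ζ j)) / (n : ℂ) * ζ i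
        = sesqForm (fun l j => (if l = i then ∑ m, d m m j else 0) / (n : ℂ)) ζ ζ := by
      refine Eq.trans ?_ (Finset.sum_eq_single i (fun l _ hl => by simp [hl]) (by simp)).symm
      rw [Finset.sum_div, Finset.sum_mul]
      refine Finset.sum_congr rfl fun j _ => ?_
      simp only [if_true]; ring
    rw [e5]
    simp only [sesqForm, ← Finset.sum_sub_distrib, ← Finset.sum_neg_distrib, Finset.sum_div]
    exact Finset.sum_congr rfl fun l _ => Finset.sum_congr rfl fun j _ => by ring
  rw [e3, e4, projSpray, e1, e2, hG i ζ hζ, hT i ζ hζ]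
  ring

/-- Raise the index in `sum_thetaStar_mul`: the horizontal derivative is sesquilinear in η and g is
independent of η. -/
theorem IsHermOn.exists_thetaStar_eq {U : Set (Cn n)} {a : Cn n → Fin n → Fin n → ℂ}
    (h : IsHermOn U a)
    (hΦ : ∀ z ∈ U, ∀ η, F z η = Real.sqrt (sesqForm (a z) η η).re) (hΩ : IsOpen Ω)
    (hU : ∀ z η, (z, η) ∈ Ω → z ∈ U) (z : Cn n) (k : Fin n) : ∃ d : Fin n → Fin n → ℂ,
      ∀ ζ, (z, ζ) ∈ Ω → thetaStar F k z ζ = sesqForm d ζ ζ := by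
  refine ⟨fun i j => ∑ m, (Matrix.of (a z))⁻¹ m k * (2 * conj (hermTorsion a z m j i)),
    fun ζ hζ => ?_⟩
  have hM := h.isMetricOn hΦ hΩ hU
  have e1 : thetaStar F k z ζ
      = ∑ m, fundTensorInv F z ζ m k * (2 * conj (horizontal F m z ζ)) :=
    congrFun (hM.eq_of_sum_fundTensor hζ (v := fun k => thetaStar F k z ζ)
      (w := fun k => ∑ m, fundTensorInv F z ζ m k * (2 * conj (horizontal F m z ζ)))
      fun q => by rw [hM.sum_thetaStar_mul hζ, hM.sum_inv_mul hζ]) k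
  have e2 : ∀ m, conj (horizontal F m z ζ)
      = sesqForm (fun i j => conj (hermTorsion a z m j i)) ζ ζ := fun m => by
    rw [h.horizontal_eq_torsion hΦ hΩ hU hζ]
    simp only [sesqForm, map_sum, map_mul, Complex.conj_conj]
    rw [Finset.sum_comm]
    exact Finset.sum_congr rfl fun i _ => Finset.sum_congr rfl fun j _ => by ring
  simp only [e1, e2, fundTensorInv, h.fundTensor_eq hΦ hΩ hU hζ, sesqForm, Finset.mul_sum,
    Finset.sum_mul]
  rw [Finset.sum_comm]
  refine Finset.sum_congr rfl fun i _ => ?_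
  rw [Finset.sum_comm]
  exact Finset.sum_congr rfl fun j _ => Finset.sum_congr rfl fun m _ => by ring

end Fibre

/-! ### The trace of the second derivatives of the projective spray -/

/-- The trace-free part of `θ*`. -/
def thetaStarTraceFree {n : ℕ} (Φ : Cn n → Cn n → ℝ) (i : Fin n) (z η : Cn n) : ℂ :=
  thetaStar Φ i z η - (∑ m, dEta m (thetaStar Φ m) z η) / (n : ℂ) * η i

/-- The double sum applies both Euler operators. The spray part has degree 0 in η̄ and is
annihilated; the trace-free part of θ* has bidegree (1,1) and reproduces itself. It recovers θ*,
modulo η, from the second derivatives that the Douglas invariants control. -/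
theorem IsMetricOn.sum_dEtaBar_dEta_projSpray {n : ℕ} {Ω : Set (Cn n × Cn n)}
    {Φ : Cn n → Cn n → ℝ} {z η : Cn n} (h : IsMetricOn Ω Φ)
    (hB : ∀ i, EulerBarOn Ω 0 (spray Φ i)) (hp : (z, η) ∈ Ω) (i : Fin n) :
    ∑ j, ∑ k, dEtaBar k (dEta j (projSpray Φ i)) z η * η j * conj (η k)
      = - thetaStarTraceFree Φ i z η / 2 := by
  have hΩ := h.isOpen
  set Q : Cn n → Cn n → ℂ := fun z η =>
    spray Φ i z η - (∑ m, dEta m (spray Φ m) z η) / ((n : ℂ) + 1) * η i with hQ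
  have hP : projSpray Φ i = fun z η => Q z η - thetaStarTraceFree Φ i z η / 2 := rfl
  have sG : SmoothOn Ω (fun z η => (∑ m, dEta m (spray Φ m) z η) / ((n : ℂ) + 1)) :=
    (SmoothOn.sum fun m _ => (h.smooth_spray m).dEta hΩ m).div_const _
  have sθ : SmoothOn Ω (fun z η => (∑ m, dEta m (thetaStar Φ m) z η) / (n : ℂ)) :=
    (SmoothOn.sum fun m _ => (h.smooth_thetaStar m).dEta hΩ m).div_const _
  have sQ : SmoothOn Ω Q := (h.smooth_spray i).sub (sG.mul (SmoothOn.coord i))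
  have sT : SmoothOn Ω (thetaStarTraceFree Φ i) :=
    (h.smooth_thetaStar i).sub (sθ.mul (SmoothOn.coord i))
  have eQ : EulerOn Ω 2 Q := by
    refine (h.eulerOn_spray i).sub hΩ (h.smooth_spray i) (sG.mul (SmoothOn.coord i)) ?_
    have : EulerOn Ω (1 + 1) (fun z η => (∑ m, dEta m (spray Φ m) z η) / ((n : ℂ) + 1) * η i) :=
      EulerOn.mul hΩ sG (SmoothOn.coord i) (fun z η hp => by
        rw [(euler_derivation hΩ hp).div_const _ (SmoothOn.sum fun m _ =>
            (h.smooth_spray m).dEta hΩ m),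
          EulerOn.sum hΩ (c := 2 - 1) (fun m _ => (h.smooth_spray m).dEta hΩ m) (fun m _ =>
            (h.eulerOn_spray m).dEta hΩ (h.smooth_spray m) m) z η hp]
        ring) (eulerOn_coord i)
    rwa [one_add_one_eq_two] at this
  have eQ' : EulerBarOn Ω 0 Q := by
    refine (hB i).sub hΩ (h.smooth_spray i) (sG.mul (SmoothOn.coord i)) ?_
    have : EulerBarOn Ω (0 + 0)
        (fun z η => (∑ m, dEta m (spray Φ m) z η) / ((n : ℂ) + 1) * η i) :=
      EulerBarOn.mul hΩ sG (SmoothOn.coord i) (fun z η hp => by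
        rw [(eulerBar_derivation hΩ hp).div_const _ (SmoothOn.sum fun m _ =>
            (h.smooth_spray m).dEta hΩ m),
          EulerBarOn.sum hΩ (c := 0) (fun m _ => (h.smooth_spray m).dEta hΩ m) (fun m _ =>
            (hB m).dEta hΩ (h.smooth_spray m) m) z η hp]
        ring) (eulerBarOn_coord i)
    rwa [add_zero] at this
  have eT : EulerOn Ω 1 (thetaStarTraceFree Φ i) := by
    refine (h.eulerOn_thetaStar hB i).sub hΩ (h.smooth_thetaStar i) (sθ.mul (SmoothOn.coord i)) ?_
    have : EulerOn Ω (0 + 1) (fun z η => (∑ m, dEta m (thetaStar Φ m) z η) / (n : ℂ) * η i) :=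
      EulerOn.mul hΩ sθ (SmoothOn.coord i) (fun z η hp => by
        rw [(euler_derivation hΩ hp).div_const _ (SmoothOn.sum fun m _ =>
            (h.smooth_thetaStar m).dEta hΩ m),
          EulerOn.sum hΩ (c := 1 - 1) (fun m _ => (h.smooth_thetaStar m).dEta hΩ m) (fun m _ =>
            (h.eulerOn_thetaStar hB m).dEta hΩ (h.smooth_thetaStar m) m) z η hp]
        ring) (eulerOn_coord i)
    rwa [zero_add] at this
  have eT' : EulerBarOn Ω 1 (thetaStarTraceFree Φ i) := by
    refine (h.eulerBarOn_thetaStar i).sub hΩ (h.smooth_thetaStar i) (sθ.mul (SmoothOn.coord i)) ?_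
    have : EulerBarOn Ω (1 + 0) (fun z η => (∑ m, dEta m (thetaStar Φ m) z η) / (n : ℂ) * η i) :=
      EulerBarOn.mul hΩ sθ (SmoothOn.coord i) (fun z η hp => by
        rw [(eulerBar_derivation hΩ hp).div_const _ (SmoothOn.sum fun m _ =>
            (h.smooth_thetaStar m).dEta hΩ m),
          EulerBarOn.sum hΩ (c := 1) (fun m _ => (h.smooth_thetaStar m).dEta hΩ m) (fun m _ =>
            (h.eulerBarOn_thetaStar m).dEta hΩ (h.smooth_thetaStar m) m) z η hp]
        ring) (eulerBarOn_coord i)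
    rwa [add_zero] at this
  have k1 : ∀ z η, (z, η) ∈ Ω → ∑ j, η j * dEta j (projSpray Φ i) z η
      = 2 * Q z η - thetaStarTraceFree Φ i z η / 2 := fun z η hp => by
    rw [hP, (euler_derivation hΩ hp).sub sQ (sT.div_const 2),
      (euler_derivation hΩ hp).div_const 2 sT, eQ z η hp, eT z η hp]
    ring
  have hE := eulerBar_derivation hΩ hp
  have k2 := hE.congr k1
  rw [hE.sub ((SmoothOn.const 2).mul sQ) (sT.div_const 2), hE.div_const 2 sT, hE.const_mul 2 sQ,
    eQ' z η hp, eT' z η hp, hE.sum_mul (F := fun k _ η => η k) (fun k => SmoothOn.coord k)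
      (fun k => (h.smooth_projSpray i).dEta hΩ k)] at k2
  have k3 : ∑ j, ∑ k, dEtaBar k (dEta j (projSpray Φ i)) z η * η j * conj (η k)
      = 2 * (0 * Q z η) - 1 * thetaStarTraceFree Φ i z η / 2 := by
    rw [← k2]
    refine Finset.sum_congr rfl fun j _ => ?_
    rw [eulerBarOn_coord (Ω := Ω) j z η hp, zero_mul, zero_mul, zero_add, Finset.mul_sum]
    exact Finset.sum_congr rfl fun k _ => by ring
  rw [k3]; ring

/-! ### Functions with vanishing fibre derivatives -/

section Const

variable {n : ℕ}

theorem fderiv_eq_zero_of_wirtinger {g : Cn n → ℂ} {η : Cn n} (h : ∀ k, wirtinger k g η = 0)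
    (h' : ∀ k, wirtingerBar k g η = 0) : fderiv ℝ g η = 0 := by
  have h1 : ∀ k, fderiv ℝ g η (Pi.single k 1) = 0 := fun k => by
    have e1 := h k
    have e2 := h' k
    simp only [wirtinger, wirtingerBar] at e1 e2
    linear_combination e1 + e2
  have h2 : ∀ k, fderiv ℝ g η (Pi.single k Complex.I) = 0 := fun k => by
    have e2 := h' k
    simp only [wirtingerBar, h1, zero_add] at e2
    simpa using e2
  ext v
  have hv : v = ∑ k, ((v k).re • (Pi.single k (1 : ℂ) : Cn n)
      + (v k).im • (Pi.single k Complex.I : Cn n)) := by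
    conv_lhs => rw [← Finset.univ_sum_single v]
    refine Finset.sum_congr rfl fun k _ => ?_
    rw [← Pi.single_smul, ← Pi.single_smul, ← Pi.single_add]
    congr 1
    simp [Complex.re_add_im]
  rw [hv]
  simp [h1, h2]

/-- The punctured complex line is connected, unlike the punctured real line; so the same constant
serves for positive and negative parameters. -/
theorem eq_on_punctured_line {Ω : Set (Cn n × Cn n)} (hΩ : IsOpen Ω) {f : Cn n → Cn n → ℂ}
    (hf : SmoothOn Ω f) {z w v : Cn n} (hw : ∀ s : ℂ, s ≠ 0 → (z, w + s • v) ∈ Ω)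
    (h : ∀ η, (z, η) ∈ Ω → ∀ k, dEta k f z η = 0) (h' : ∀ η, (z, η) ∈ Ω → ∀ k, dEtaBar k f z η = 0)
    {s t : ℂ} (hs : s ≠ 0) (ht : t ≠ 0) : f z (w + s • v) = f z (w + t • v) := by
  have hd : ∀ s : ℂ, s ≠ 0 → HasFDerivAt (fun s : ℂ => f z (w + s • v)) (0 : ℂ →L[ℝ] ℂ) s := by
    intro s hs
    have h1 := (hf.differentiableAt_snd hΩ (hw s hs)).hasFDerivAt
    rw [fderiv_eq_zero_of_wirtinger (h _ (hw s hs)) (h' _ (hw s hs))] at h1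
    have h2 : DifferentiableAt ℝ (fun s : ℂ => w + s • v) s := by fun_prop
    have h3 := h1.comp s h2.hasFDerivAt
    rw [ContinuousLinearMap.zero_comp] at h3
    exact h3
  refine isOpen_compl_singleton.is_const_of_fderiv_eq_zero (𝕜 := ℝ) (s := ({0}ᶜ : Set ℂ))
    (f := fun s => f z (w + s • v))
    (isConnected_compl_singleton_of_one_lt_rank (by simp) 0).isPreconnected
    (fun s hs => (hd s hs).differentiableAt.differentiableWithinAt)
    (fun s hs => (hd s hs).fderiv) hs ht

end Const


/-! ### The local equivalence between the Douglas condition and ∂e = 0. -/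

namespace IsNavigation

variable {n : ℕ} {U : Set (Cn n)} {a : Cn n → Fin n → Fin n → ℂ} {b : Cn n → Fin n → ℂ}
  {e : Cn n → ℝ} {z η : Cn n} {F Φ Ψ : Cn n → Cn n → ℝ}

/-- A Randers metric with polynomial spray and torsion is Douglas. -/
theorem douglas_eq_zero (h : IsNavigation U a b e)
    (hΦ : ∀ z ∈ U, ∀ η, Φ z η = Real.sqrt (sesqForm (a z) η η).re)
    (hS : ∀ z η, (z, η) ∈ randersDomain U b → ∀ i, spray F i z η = spray Φ i z η)
    (hT : ∀ z η, (z, η) ∈ randersDomain U b → ∀ i, thetaStar F i z η = thetaStar Φ i z η)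
    (hp : (z, η) ∈ randersDomain U b) (i j k l : Fin n) :
    douglas₁ F i j k l z η = 0 ∧ douglas₂ F i j k l z η = 0 ∧ douglas₃ F i j k l z η = 0 := by
  have hR := h.randers
  have hΩ := hR.isOpen_domain
  choose d hd using hR.herm.exists_thetaStar_eq hΦ hΩ IsRanders.mem_base z
  obtain ⟨c', d', hcd⟩ := exists_projSpray_eq (F := F) hΩ
    (fun m ζ hζ => (hS z ζ hζ m).trans (hR.herm.spray_eq hΦ hΩ IsRanders.mem_base hζ m))
    (fun m ζ hζ => (hT z ζ hζ m).trans (hd m ζ hζ)) i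
  exact third_derivatives_eq_zero hΩ hcd hp j k l

/-- If the second and third Douglas invariants of the Randers metric vanish over `z`, then
`∂e = 0` at `z`. -/
theorem dzReal_eq_zero (h : IsNavigation U a b e)
    (hF : ∀ z ∈ U, ∀ η, F z η = Real.sqrt (sesqForm (a z) η η).re + ‖linForm (b z) η‖)
    (hΦ : ∀ z ∈ U, ∀ η, Φ z η = Real.sqrt (sesqForm (a z) η η).re)
    (hE : ∀ z η, (z, η) ∈ randersDomain U b → ∀ i k, dEtaBar k (spray F i) z η = 0)
    (hS : ∀ z η, (z, η) ∈ randersDomain U b → ∀ i, spray F i z η = spray Φ i z η)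
    (hb : ∀ z η, (z, η) ∈ randersDomain U b → ∀ q,
      sprayDeriv Φ (fun z η => linForm (b z) η) z η * conj (b z q)
        + linForm (b z) η * dzConjB b q z η = 0)
    (hA : ∀ z ∈ U, ∀ η ζ, sharpTorsion a b z η ζ = 0)
    (hB : ∀ q z η, (z, η) ∈ randersDomain U b →
      2 * e z * horizDeriv Φ q (fun z η => linForm (b z) η * conj (linForm (b z) η)) z η
      = dzReal e z q * sesqForm (cutForm a b z) η η
        - linForm (dzReal e z) η * lower (cutForm a b z) η q)
    (hs : linForm (dzReal e z) (sharp a b z) = 0) (hz : z ∈ U)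
    (h₂ : ∀ η, (z, η) ∈ randersDomain U b → ∀ i j k l, douglas₂ F i j k l z η = 0)
    (h₃ : ∀ η, (z, η) ∈ randersDomain U b → ∀ i j k l, douglas₃ F i j k l z η = 0) :
    dzReal e z = 0 := by
  by_contra hne
  have hR := h.randers
  have hΩ := hR.isOpen_domain
  have hM := hR.isMetricOn hF
  set v := sharp a b z with hv
  set ν := normB a b z with hνdef
  have hν : 0 < ν := hR.normB_pos hz
  have hν1 : ν < 1 := h.normB_lt_one hz
  have hνc : (ν : ℂ) ≠ 0 := Complex.ofReal_ne_zero.2 hν.ne'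
  have hbv : linForm (b z) v = ν := hR.linForm_sharp hz
  -- Removing the b♯ component from a vector with ∂e ≠ 0 does not change ∂e, since ∂e(b♯) = 0. On
  -- the line w + t b♯ one then has α² = A + νt² and |β| = |t|ν, and ∂e(η) is constant.
  obtain ⟨w, hbw, hew⟩ : ∃ w, linForm (b z) w = 0 ∧ linForm (dzReal e z) w ≠ 0 := by
    obtain ⟨ξ, hξ⟩ := exists_linForm_ne hne
    refine ⟨ξ + (-(linForm (b z) ξ / ν)) • v, ?_, ?_⟩
    · rw [linForm_add, linForm_smul, hbv]; field_simp; ring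
    · rwa [linForm_add, linForm_smul, hs, mul_zero, add_zero]
  have hw0 : w ≠ 0 := linForm_ne_zero hew
  set A := (sesqForm (a z) w w).re with hAdef
  have hA0 : 0 < A := hR.herm.pos z hz w hw0
  have hAc : sesqForm (a z) w w = A := (hR.herm.sesqForm_re hz w).symm
  have hβ : ∀ s : ℂ, linForm (b z) (w + s • v) = s * ν := fun s => by
    rw [linForm_add, linForm_smul, hbw, hbv, zero_add]
  have hmem : ∀ s : ℂ, s ≠ 0 → (z, w + s • v) ∈ randersDomain U b := fun s hs0 =>
    ⟨hz, by change linForm (b z) (w + s • v) ≠ 0; rw [hβ]; exact mul_ne_zero hs0 hνc⟩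
  have hσ : ∀ s : ℂ, linForm (dzReal e z) (w + s • v) = linForm (dzReal e z) w := fun s => by
    rw [linForm_add, linForm_smul, hs, mul_zero, add_zero]
  have hlow : ∀ (t : ℝ) i, lower (a z) (w + (t : ℂ) • v) i = lower (a z) w i + t * b z i :=
    fun t i => by
    rw [← hR.lower_sharp hz i]
    simp only [lower, Pi.add_apply, Pi.smul_apply, smul_eq_mul, map_add, map_mul,
      Complex.conj_ofReal, mul_add, Finset.sum_add_distrib, Finset.mul_sum]
    congr 1
    exact Finset.sum_congr rfl fun j _ => by ring
  have hsesq : ∀ t : ℝ, sesqForm (a z) (w + (t : ℂ) • v) (w + (t : ℂ) • v)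
      = ((A + ν * t ^ 2 : ℝ) : ℂ) := fun t => by
    rw [sesqForm_add_left, sesqForm_add_right, sesqForm_add_right, sesqForm_smul_left,
      sesqForm_smul_left, sesqForm_smul_right, sesqForm_smul_right, hR.sesqForm_sharp hz,
      hR.sesqForm_sharp hz, hR.sharp_sesqForm hz, hbw, hbv, hAc, Complex.conj_ofReal, map_zero]
    push_cast; ring
  have hα : ∀ t : ℝ, alphaFn a z (w + (t : ℂ) • v) = ((Real.sqrt (A + ν * t ^ 2) : ℝ) : ℂ) :=
    fun t => by rw [alphaFn, hsesq, Complex.ofReal_re]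
  have hγ : ∀ t : ℝ, absBeta b z (w + (t : ℂ) • v) = ((|t| * ν : ℝ) : ℂ) := fun t => by
    rw [absBeta, hβ, norm_mul, Complex.norm_real, Complex.norm_real, Real.norm_eq_abs,
      Real.norm_of_nonneg hν.le]
  -- The first fibre derivatives of this second derivative are the second and third Douglas
  -- invariants, so it is constant on the punctured line.
  have hcon : ∀ i j k (t : ℝ), t ≠ 0 → dEtaBar k (dEta j (projSpray F i)) z (w + (t : ℂ) • v)
      = dEtaBar k (dEta j (projSpray F i)) z (w + (1 : ℂ) • v) := fun i j k t ht => by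
    have sP := (hM.smooth_projSpray i).dEta hΩ j
    refine eq_on_punctured_line hΩ (sP.dEtaBar hΩ k) hmem (fun η hη l => ?_)
      (fun η hη l => h₃ η hη i j k l) (Complex.ofReal_ne_zero.2 ht) one_ne_zero
    rw [(isDirectional_dEta _ l).comm (isDirectional_dEtaBar _ k) hΩ sP hη]
    exact h₂ η hη i j l k
  set C : Fin n → Fin n → Fin n → ℂ := fun i j k =>
    dEtaBar k (dEta j (projSpray F i)) z (w + (1 : ℂ) • v) with hC
  -- With constant second derivatives, contraction with ηʲη̄ᵏ on the real line w + t b♯ is a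
  -- polynomial in t, equal to minus half the trace-free part of θ*.
  set E : Fin n → Polynomial ℂ := fun i => ∑ j, ∑ k, Polynomial.C (C i j k)
    * (Polynomial.C (w j) + Polynomial.X * Polynomial.C (v j))
    * (Polynomial.C (conj (w k)) + Polynomial.X * Polynomial.C (conj (v k))) with hEdef
  have hT : ∀ i (t : ℝ), t ≠ 0 → (E i).eval (t : ℂ)
      = - thetaStarTraceFree F i z (w + (t : ℂ) • v) / 2 := fun i t ht => by
    rw [← hM.sum_dEtaBar_dEta_projSpray (fun i z η hp => by
      rw [zero_mul]; exact Finset.sum_eq_zero fun k _ => by rw [hE z η hp, mul_zero])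
      (hmem t (Complex.ofReal_ne_zero.2 ht)) i]
    simp only [hEdef, Polynomial.eval_finsetSum, Polynomial.eval_mul, Polynomial.eval_add,
      Polynomial.eval_C, Polynomial.eval_X, hcon _ _ _ t ht, Pi.add_apply, Pi.smul_apply,
      smul_eq_mul, map_add, map_mul, Complex.conj_ofReal]
    rfl
  -- The polynomial expresses β(θ*)α² - β a(θ*, η) along the line. This combination vanishes for θ*
  -- proportional to η, so the trace-free part computes it; the factor -2 undoes the normalization
  -- of `E`. The constant c is read off `linForm_thetaStar_mul`, with β = tν supplying the last
  -- factor ν.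
  refine not_polynomial_randers (p := Polynomial.C (-2)
      * ((∑ i, Polynomial.C (b z i) * E i)
          * (Polynomial.C (A : ℂ) + Polynomial.C (ν : ℂ) * Polynomial.X ^ 2)
        - Polynomial.C (ν : ℂ) * Polynomial.X * ∑ i, (Polynomial.C (lower (a z) w i)
          + Polynomial.X * Polynomial.C (b z i)) * E i))
    (c := -2 * (1 - ν) * conj (linForm (dzReal e z) w) / e z * ν) hA0 hν hν1 ?_ fun t ht => ?_
  · have h1 : (1 - ν : ℂ) ≠ 0 := by
      rw [← Complex.ofReal_one, ← Complex.ofReal_sub]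
      exact Complex.ofReal_ne_zero.2 (by linarith)
    exact mul_ne_zero (div_ne_zero (mul_ne_zero (mul_ne_zero (by norm_num) h1)
      ((map_ne_zero _).2 hew)) (h.e_ne hz)) hνc
  · have key := h.linForm_thetaStar_mul hF hΦ hS hb hA hB hs (hmem t (Complex.ofReal_ne_zero.2 ht))
    set η := w + (t : ℂ) • v with hη
    set τ := (∑ m, dEta m (thetaStar F m) z η) / (n : ℂ) with hτ
    have hx : ∑ i, b z i * thetaStarTraceFree F i z η
        = linForm (b z) (fun k => thetaStar F k z η) - τ * linForm (b z) η := by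
      simp only [linForm, thetaStarTraceFree, mul_sub, Finset.sum_sub_distrib, Finset.mul_sum]
      congr 1
      exact Finset.sum_congr rfl fun i _ => by ring
    have hy : ∑ i, lower (a z) η i * thetaStarTraceFree F i z η
        = sesqForm (a z) (fun k => thetaStar F k z η) η - τ * sesqForm (a z) η η := by
      simp only [sesqForm_eq_sum_lower, thetaStarTraceFree, mul_sub, Finset.sum_sub_distrib,
        Finset.mul_sum]
      congr 1
      exact Finset.sum_congr rfl fun i _ => by ring
    have hα2 := hR.alphaFn_mul_self hz η
    rw [hσ, hβ] at key
    rw [← hα t, ← hγ t]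
    have hp : Polynomial.eval (t : ℂ) (Polynomial.C (-2)
      * ((∑ i, Polynomial.C (b z i) * E i)
          * (Polynomial.C (A : ℂ) + Polynomial.C (ν : ℂ) * Polynomial.X ^ 2)
        - Polynomial.C (ν : ℂ) * Polynomial.X * ∑ i, (Polynomial.C (lower (a z) w i)
          + Polynomial.X * Polynomial.C (b z i)) * E i))
        = linForm (b z) (fun k => thetaStar F k z η) * alphaFn a z η ^ 2
          - t * ν * sesqForm (a z) (fun k => thetaStar F k z η) η := by
      have e1 : linForm (b z) (fun k => thetaStar F k z η) * alphaFn a z η ^ 2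
          - t * ν * sesqForm (a z) (fun k => thetaStar F k z η) η
          = (∑ i, b z i * thetaStarTraceFree F i z η) * sesqForm (a z) η η
            - t * ν * ∑ i, lower (a z) η i * thetaStarTraceFree F i z η := by
        rw [hx, hy, hβ, ← hα2]; ring
      have e2 : ∀ c : Fin n → ℂ, ∑ i, c i * (-thetaStarTraceFree F i z η / 2)
          = -(∑ i, c i * thetaStarTraceFree F i z η) / 2 := fun c => by
        rw [← Finset.sum_neg_distrib, Finset.sum_div]
        exact Finset.sum_congr rfl fun i _ => by ring
      rw [e1, hsesq]
      simp only [Polynomial.eval_finsetSum, Polynomial.eval_mul, Polynomial.eval_add,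
        Polynomial.eval_sub, Polynomial.eval_pow, Polynomial.eval_C, Polynomial.eval_X,
        hT _ t ht, ← hη, ← hlow, e2]
      push_cast
      ring
    rw [hp]
    linear_combination key

/-- The local form of the theorem: with the Randers metric generalized Berwald and the metrics `a`
and `e (a - b ⊗ b̄)` projectively related, the Douglas condition over `z` means `∂e = 0`. -/
theorem douglas_iff (h : IsNavigation U a b e) (hn : 2 ≤ n)
    (hF : ∀ z ∈ U, ∀ η, F z η = Real.sqrt (sesqForm (a z) η η).re + ‖linForm (b z) η‖)
    (hΦ : ∀ z ∈ U, ∀ η, Φ z η = Real.sqrt (sesqForm (a z) η η).re)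
    (hΨ : ∀ z ∈ U, ∀ η, Ψ z η = Real.sqrt (sesqForm (scaledForm a b e z) η η).re)
    (hE : ∀ z η, (z, η) ∈ randersDomain U b → ∀ i k, dEtaBar k (spray F i) z η = 0)
    {P : Cn n → Cn n → ℂ} (hP : ∀ z η, (z, η) ∈ randersDomain U b → ∀ i, spray Φ i z η
      = spray Ψ i z η + (thetaStar Φ i z η - thetaStar Ψ i z η) / 2 + P z η * η i) :
    (∀ z η, (z, η) ∈ randersDomain U b → ∀ i j k l, douglas₁ F i j k l z η = 0 ∧
      douglas₂ F i j k l z η = 0 ∧ douglas₃ F i j k l z η = 0) ↔ ∀ z ∈ U, dzReal e z = 0 := by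
  have hR := h.randers
  have hS : ∀ z η, (z, η) ∈ randersDomain U b → ∀ i, spray F i z η = spray Φ i z η :=
    fun z η hp i => hR.spray_eq hn hF hΦ hE hp i
  have hb := fun z η hp => hR.sprayDeriv_beta_mul (z := z) (η := η) hF hΦ hS hp
  have hid := fun q z η hp => h.proj_identity (z := z) (η := η) hΦ hΨ hb hp (hP z η hp) q
  have hA : ∀ z ∈ U, ∀ η ζ, sharpTorsion a b z η ζ = 0 := fun z hz =>
    h.sharpTorsion_eq_zero hΦ hid hz
  have hB := fun q z η hp => h.horizDeriv_beta_sq_eq (z := z) (η := η) hΦ hid hp q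
  constructor
  · intro hD z hz
    exact h.dzReal_eq_zero hF hΦ hE hS hb hA hB (h.dzReal_sharp hn hΦ hb hB hz) hz
      (fun η hη i j k l => (hD z η hη i j k l).2.1) (fun η hη i j k l => (hD z η hη i j k l).2.2)
  · intro he z η hp i j k l
    exact h.douglas_eq_zero hΦ hS
      (fun z η hp k => h.thetaStar_eq hF hΦ hS hb hA hB (he z hp.1) hp k) hp i j k l

end IsNavigation


/-! ### Regular points -/

section Regular

variable {n : ℕ} {U : Set (Cn n)} {a : Cn n → Fin n → Fin n → ℂ} {b : Cn n → Fin n → ℂ}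
  {z η : Cn n} {F Φ : Cn n → Cn n → ℝ}

theorem IsHermOn.regularAt (h : IsHermOn U a)
    (hΦ : ∀ z ∈ U, ∀ η, Φ z η = Real.sqrt (sesqForm (a z) η η).re) (hz : z ∈ U) (hη : η ≠ 0) :
    RegularAt Φ z η := by
  refine ⟨hη, ?_⟩
  have hU : IsOpen (Prod.fst ⁻¹' U : Set (Cn n × Cn n)) := h.isOpen.preimage continuous_fst
  have hm : (Prod.fst ⁻¹' U : Set (Cn n × Cn n)) ∈ nhds (z, η) := hU.mem_nhds hz
  have h1 : ContDiffAt ℝ ∞ (fun p : Cn n × Cn n => sesqForm (a p.1) p.2 p.2) (z, η) :=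
    (h.smoothOn_sesqForm (Ω := Prod.fst ⁻¹' U) fun _ _ hp => hp).contDiffAt hm
  have h2 : ContDiffAt ℝ ∞ (fun p : Cn n × Cn n => (sesqForm (a p.1) p.2 p.2).re) (z, η) :=
    Complex.reCLM.contDiff.contDiffAt.comp (z, η) h1
  refine (h2.sqrt (h.pos z hz η hη).ne').congr_of_eventuallyEq ?_
  filter_upwards [hm] with p hp using hΦ p.1 hp p.2

/-- At η ≠ 0 with β(η) = 0 the term α is smooth, while along a line η + t u with β(u) ≠ 0 the
difference F - α is |t| times a nonzero constant. -/
theorem IsRanders.regularAt_iff (h : IsRanders U a b)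
    (hF : ∀ z ∈ U, ∀ η, F z η = Real.sqrt (sesqForm (a z) η η).re + ‖linForm (b z) η‖)
    (hz : z ∈ U) : RegularAt F z η ↔ (z, η) ∈ randersDomain U b := by
  constructor
  · rintro ⟨hη, hs⟩
    refine ⟨hz, fun h0 => ?_⟩
    change linForm (b z) η = 0 at h0
    obtain ⟨u, hu⟩ := exists_linForm_ne (h.b_ne z hz)
    have hl : DifferentiableAt ℝ (fun t : ℝ => (z, η + t • u)) 0 := by fun_prop
    have e0 : (z, η + (0 : ℝ) • u) = (z, η) := by simp
    have d1 : DifferentiableAt ℝ (fun t : ℝ => F z (η + t • u)) 0 := by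
      have h1 : DifferentiableAt ℝ (fun p : Cn n × Cn n => F p.1 p.2) (z, η + (0 : ℝ) • u) := by
        rw [e0]; exact hs.differentiableAt (by simp)
      exact DifferentiableAt.comp (g := fun p : Cn n × Cn n => F p.1 p.2)
        (f := fun t : ℝ => (z, η + t • u)) (0 : ℝ) h1 hl
    have d2 : DifferentiableAt ℝ
        (fun t : ℝ => Real.sqrt (sesqForm (a z) (η + t • u) (η + t • u)).re) 0 := by
      have hr := (h.herm.regularAt (Φ := fun z η => Real.sqrt (sesqForm (a z) η η).re)
        (fun _ _ _ => rfl) hz hη).2.differentiableAt (by simp)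
      rw [← e0] at hr
      exact DifferentiableAt.comp
        (g := fun p : Cn n × Cn n => Real.sqrt (sesqForm (a p.1) p.2 p.2).re)
        (f := fun t : ℝ => (z, η + t • u)) (0 : ℝ) hr hl
    have d3 : DifferentiableAt ℝ (fun t : ℝ => |t|) 0 := by
      refine ((d1.sub d2).div_const ‖linForm (b z) u‖).congr_of_eventuallyEq
        (Filter.Eventually.of_forall fun t => ?_)
      have e1 : linForm (b z) (η + t • u) = t * linForm (b z) u := by
        rw [linForm_add, h0, zero_add, ← linForm_smul]; rfl
      simp only [Pi.sub_apply, hF z hz, e1, norm_mul, Complex.norm_real, Real.norm_eq_abs]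
      have := norm_ne_zero_iff.2 hu
      field_simp
      ring
    exact not_differentiableAt_abs_zero d3
  · intro hp
    refine ⟨linForm_ne_zero hp.2, ?_⟩
    have hm := h.isOpen_domain.mem_nhds hp
    have h1 := (h.herm.regularAt (Φ := fun z η => Real.sqrt (sesqForm (a z) η η).re)
        (fun _ _ _ => rfl) hz (linForm_ne_zero hp.2)).2
    have h2 : ContDiffAt ℝ ∞ (fun p : Cn n × Cn n => ‖linForm (b p.1) p.2‖) (z, η) :=
      ContDiffAt.norm ℝ (h.smoothOn_beta.contDiffAt hm) hp.2
    refine (h1.add h2).congr_of_eventuallyEq ?_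
    filter_upwards [hm] with p hq using hF p.1 hq.1 p.2

end Regular

/-- Since e is real, the barred Wirtinger derivatives are the conjugates of the unbarred ones and
vanish with them. -/
theorem fderiv_eq_zero_of_dzReal {n : ℕ} {e : Cn n → ℝ} {z : Cn n}
    (he : DifferentiableAt ℝ e z) (h : dzReal e z = 0) : fderiv ℝ e z = 0 := by
  have hc : HasFDerivAt (fun z => (e z : ℂ)) (Complex.ofRealCLM.comp (fderiv ℝ e z)) z :=
    Complex.ofRealCLM.hasFDerivAt.comp z he.hasFDerivAt
  have h1 : ∀ k, wirtinger k (fun z => (e z : ℂ)) z = 0 := fun k => congrFun h k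
  have h2 : ∀ k, wirtingerBar k (fun z => (e z : ℂ)) z = 0 := fun k => by
    have := congrArg conj (h1 k)
    simpa [wirtinger, wirtingerBar, hc.fderiv] using this
  have h3 := fderiv_eq_zero_of_wirtinger h1 h2
  rw [hc.fderiv] at h3
  ext v
  have := congrArg (fun L : Cn n →L[ℝ] ℂ => L v) h3
  simpa using this

/-! ### Navigation data in a chart -/

section Chart

variable {n : ℕ} {M : Type*} [TopologicalSpace M] [ChartedSpace (Cn n) M]

theorem tangentAt_eq_sum (φ : OpenPartialHomeomorph M (Cn n)) (z η : Cn n) :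
    tangentAt φ z η = ∑ i, η i • tangentAt φ z (Pi.single i 1) := by
  have h : η = ∑ i, η i • (Pi.single i 1 : Cn n) := by
    conv_lhs => rw [← Finset.univ_sum_single η]
    refine Finset.sum_congr rfl fun i _ => ?_
    rw [← Pi.single_smul, smul_eq_mul, mul_one]
  let L : Cn n →L[ℂ] HTangent n (φ.symm z) := mfderiv 𝓘(ℂ, Cn n) 𝓘(ℂ, Cn n) φ.symm z
  have hL : ∀ ζ, tangentAt φ z ζ = L ζ := fun _ => rfl
  simp only [hL]
  conv_lhs => rw [h]
  rw [map_sum]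
  exact Finset.sum_congr rfl fun i _ => map_smul _ _ _

section Manifold

variable [IsManifold 𝓘(ℂ, Cn n) ω M] {φ : OpenPartialHomeomorph M (Cn n)}

theorem mdifferentiable_of_mem (hφ : φ ∈ atlas (Cn n) M) :
    φ.MDifferentiable 𝓘(ℂ, Cn n) 𝓘(ℂ, Cn n) := by
  have : IsManifold 𝓘(ℂ, Cn n) 1 M := IsManifold.of_le (n := ω) le_top
  exact mdifferentiable_of_mem_atlas hφ

theorem tangentAt_ne_zero (hφ : φ ∈ atlas (Cn n) M) {z : Cn n} (hz : z ∈ φ.target) {η : Cn n}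
    (hη : η ≠ 0) : tangentAt φ z η ≠ 0 := by
  intro h0
  have h1 := (mdifferentiable_of_mem hφ).comp_symm_deriv hz
  have h2 : mfderiv 𝓘(ℂ, Cn n) 𝓘(ℂ, Cn n) φ (φ.symm z) (tangentAt φ z η) = η :=
    congrArg (fun L : Cn n →L[ℂ] Cn n => L η) h1
  rw [h0, map_zero] at h2
  exact hη h2.symm

theorem tangentAt_mfderiv (hφ : φ ∈ atlas (Cn n) M) {z : Cn n} (hz : z ∈ φ.target)
    (X : HTangent n (φ.symm z)) :
    tangentAt φ z (mfderiv 𝓘(ℂ, Cn n) 𝓘(ℂ, Cn n) φ (φ.symm z) X) = X := by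
  have h1 := (mdifferentiable_of_mem hφ).symm_comp_deriv (φ.map_target hz)
  rw [φ.right_inv hz] at h1
  exact congrArg (fun L : HTangent n (φ.symm z) →L[ℂ] HTangent n (φ.symm z) => L X) h1

end Manifold

end Chart


namespace NavigationData

variable {n : ℕ} {M : Type*} [TopologicalSpace M] [ChartedSpace (Cn n) M]
  (D : NavigationData n M) (ϕ : ℝ) (φ : OpenPartialHomeomorph M (Cn n))

/-- The coefficients `h_{i j̄}` in a chart. -/
def hCoef (z : Cn n) (i j : Fin n) : ℂ :=
  D.h.form (φ.symm z) (tangentAt φ z (Pi.single i 1)) (tangentAt φ z (Pi.single j 1))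

/-- The coefficients `bᵢ` in a chart. -/
def bCoef (z : Cn n) (i : Fin n) : ℂ := D.beta ϕ (φ.symm z) (tangentAt φ z (Pi.single i 1))

/-- The coefficients `a_{i j̄}` in a chart. -/
def aCoef (z : Cn n) (i j : Fin n) : ℂ :=
  D.hCoef φ z i j / D.eps (φ.symm z) + D.bCoef ϕ φ z i * conj (D.bCoef ϕ φ z j)

theorem aForm_eq (x : M) (η ζ : HTangent n x) : D.aForm ϕ x η ζ
    = D.h.form x η ζ / D.eps x + D.beta ϕ x η * conj (D.beta ϕ x ζ) := by
  simp only [aForm, beta, map_mul, map_neg, Complex.conj_ofReal]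
  push_cast
  ring

theorem form_tangentAt_left (z η : Cn n) (X : HTangent n (φ.symm z)) :
    D.h.form (φ.symm z) (tangentAt φ z η) X
      = linForm (fun i => D.h.form (φ.symm z) (tangentAt φ z (Pi.single i 1)) X) η := by
  conv_lhs => rw [tangentAt_eq_sum]
  rw [map_sum, LinearMap.sum_apply, linForm]
  refine Finset.sum_congr rfl fun i _ => ?_
  rw [map_smul, LinearMap.smul_apply, smul_eq_mul, mul_comm]

theorem form_tangentAt_right (z ζ : Cn n) (X : HTangent n (φ.symm z)) :
    D.h.form (φ.symm z) X (tangentAt φ z ζ)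
      = ∑ j, D.h.form (φ.symm z) X (tangentAt φ z (Pi.single j 1)) * conj (ζ j) := by
  conv_lhs => rw [tangentAt_eq_sum]
  rw [map_sum]
  refine Finset.sum_congr rfl fun i _ => ?_
  rw [map_smulₛₗ, smul_eq_mul, mul_comm]

theorem form_tangentAt (z η ζ : Cn n) :
    D.h.form (φ.symm z) (tangentAt φ z η) (tangentAt φ z ζ) = sesqForm (D.hCoef φ z) η ζ := by
  rw [form_tangentAt_left, sesqForm_eq_sum_lower, linForm]
  refine Finset.sum_congr rfl fun i _ => ?_
  rw [form_tangentAt_right]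
  rfl

theorem beta_tangentAt (z η : Cn n) :
    D.beta ϕ (φ.symm z) (tangentAt φ z η) = linForm (D.bCoef ϕ φ z) η := by
  rw [beta, form_tangentAt_left, linForm, linForm, Finset.sum_div, ← Finset.sum_neg_distrib,
    Finset.sum_mul]
  refine Finset.sum_congr rfl fun i _ => ?_
  rw [bCoef, beta]; ring

theorem sesqForm_aCoef (z η ζ : Cn n) : sesqForm (D.aCoef ϕ φ z) η ζ
    = sesqForm (D.hCoef φ z) η ζ / D.eps (φ.symm z)
      + linForm (D.bCoef ϕ φ z) η * conj (linForm (D.bCoef ϕ φ z) ζ) := by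
  simp only [sesqForm, aCoef, linForm, map_sum, map_mul, Finset.sum_div, Finset.sum_mul_sum,
    ← Finset.sum_add_distrib]
  exact Finset.sum_congr rfl fun i _ => Finset.sum_congr rfl fun j _ => by ring

theorem alpha_localRep (z η : Cn n) : localRep (D.alpha ϕ) φ z η
    = Real.sqrt (sesqForm (D.aCoef ϕ φ z) η η).re := by
  rw [localRep, alpha, aForm_eq, form_tangentAt, beta_tangentAt, sesqForm_aCoef]

theorem solution_localRep (hϕ : Real.cos ϕ ≤ 0) (z η : Cn n) :
    localRep (D.solution ϕ) φ z η
      = Real.sqrt (sesqForm (D.aCoef ϕ φ z) η η).re + ‖linForm (D.bCoef ϕ φ z) η‖ := by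
  rw [← alpha_localRep, ← beta_tangentAt, localRep, solution_eq_randers D ϕ hϕ]
  rfl

theorem cutForm_aCoef (z : Cn n) (i j : Fin n) :
    cutForm (D.aCoef ϕ φ) (D.bCoef ϕ φ) z i j = D.hCoef φ z i j / D.eps (φ.symm z) := by
  simp only [cutForm, aCoef]; ring

/-- Identifies the metric e (a - b ⊗ b̄) of the local theory with h. -/
theorem scaledForm_aCoef (z : Cn n) :
    scaledForm (D.aCoef ϕ φ) (D.bCoef ϕ φ) (fun z => D.eps (φ.symm z)) z = D.hCoef φ z := by
  funext i j
  rw [scaledForm, cutForm_aCoef]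
  have : (D.eps (φ.symm z) : ℂ) ≠ 0 := Complex.ofReal_ne_zero.2 (D.eps_pos _).ne'
  field_simp

theorem norm_localRep (z η : Cn n) : localRep D.h.norm φ z η
    = Real.sqrt (sesqForm (scaledForm (D.aCoef ϕ φ) (D.bCoef ϕ φ) (fun z => D.eps (φ.symm z)) z)
      η η).re := by
  rw [scaledForm_aCoef, localRep, HermitianMetric.norm, form_tangentAt]

/-- The components of `W` in a chart. -/
def wCoef (z : Cn n) : Cn n :=
  mfderiv 𝓘(ℂ, Cn n) 𝓘(ℂ, Cn n) φ (φ.symm z) (D.W (φ.symm z))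

variable {φ}

theorem conj_hCoef (z : Cn n) (i j : Fin n) : conj (D.hCoef φ z i j) = D.hCoef φ z j i :=
  D.h.conj_symm _ _ _

theorem smooth_wCoef (hφ : φ ∈ atlas (Cn n) M) (j : Fin n) :
    ContDiffOn ℝ ∞ (fun z => D.wCoef φ z j) φ.target :=
  contDiffOn_pi.1 (D.smooth_W φ hφ) j

section Smooth

variable [IsManifold 𝓘(ℂ, Cn n) ω M]

theorem tangentAt_wCoef (hφ : φ ∈ atlas (Cn n) M) {z : Cn n} (hz : z ∈ φ.target) :
    tangentAt φ z (D.wCoef φ z) = D.W (φ.symm z) :=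
  tangentAt_mfderiv hφ hz _

theorem smooth_conj {U : Set (Cn n)} {f : Cn n → ℂ} (hf : ContDiffOn ℝ ∞ f U) :
    ContDiffOn ℝ ∞ (fun z => conj (f z)) U :=
  Complex.conjCLE.contDiff.comp_contDiffOn hf

theorem sesqForm_hCoef_pos (hφ : φ ∈ atlas (Cn n) M) {z η : Cn n} (hz : z ∈ φ.target)
    (hη : η ≠ 0) : 0 < (sesqForm (D.hCoef φ z) η η).re := by
  rw [← form_tangentAt]
  exact D.h.pos _ _ (tangentAt_ne_zero hφ hz hη)

theorem smooth_eps (hφ : φ ∈ atlas (Cn n) M) :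
    ContDiffOn ℝ ∞ (fun z => D.eps (φ.symm z)) φ.target := by
  have h1 : ContDiffOn ℝ ∞ (fun z => sesqForm (D.hCoef φ z) (D.wCoef φ z) (D.wCoef φ z))
      φ.target :=
    ContDiffOn.sum fun i _ => ContDiffOn.sum fun j _ =>
      ((D.h.smooth φ hφ i j).mul (D.smooth_wCoef hφ i)).mul (smooth_conj (D.smooth_wCoef hφ j))
  refine (((D.smooth_speed φ hφ).pow 2).sub
    (Complex.reCLM.contDiff.comp_contDiffOn h1)).congr fun z hz => ?_
  have h2 : 0 ≤ (sesqForm (D.hCoef φ z) (D.wCoef φ z) (D.wCoef φ z)).re := by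
    by_cases h0 : D.wCoef φ z = 0
    · simp [h0, sesqForm]
    · exact (D.sesqForm_hCoef_pos hφ hz h0).le
  rw [eps, HermitianMetric.norm, ← D.tangentAt_wCoef hφ hz, form_tangentAt, Real.sq_sqrt h2]
  rfl

theorem smooth_eps_complex (hφ : φ ∈ atlas (Cn n) M) :
    ContDiffOn ℝ ∞ (fun z => (D.eps (φ.symm z) : ℂ)) φ.target :=
  Complex.ofRealCLM.contDiff.comp_contDiffOn (D.smooth_eps hφ)

theorem smooth_div_eps (hφ : φ ∈ atlas (Cn n) M) {f : Cn n → ℂ}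
    (hf : ContDiffOn ℝ ∞ f φ.target) :
    ContDiffOn ℝ ∞ (fun z => f z / D.eps (φ.symm z)) φ.target := by
  simp only [div_eq_mul_inv]
  exact hf.mul ((D.smooth_eps_complex hφ).inv fun z _ =>
    Complex.ofReal_ne_zero.2 (D.eps_pos _).ne')

theorem smooth_bCoef (hφ : φ ∈ atlas (Cn n) M) (i : Fin n) :
    ContDiffOn ℝ ∞ (fun z => D.bCoef ϕ φ z i) φ.target := by
  have h1 : ContDiffOn ℝ ∞ (fun z => ∑ j, D.hCoef φ z i j * conj (D.wCoef φ z j)) φ.target :=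
    ContDiffOn.sum fun j _ => (D.h.smooth φ hφ i j).mul (smooth_conj (D.smooth_wCoef hφ j))
  refine ((D.smooth_div_eps hφ h1).neg.mul
      (contDiffOn_const (c := (Real.cos ϕ : ℂ)))).congr fun z hz => ?_
  rw [bCoef, beta, ← D.tangentAt_wCoef hφ hz, form_tangentAt_right]
  rfl

theorem isNavigation (hφ : φ ∈ atlas (Cn n) M) (hW : ∀ x, D.W x ≠ 0) (hϕ : Real.cos ϕ ≠ 0) :
    IsNavigation φ.target (D.aCoef ϕ φ) (D.bCoef ϕ φ) (fun z => D.eps (φ.symm z)) where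
  randers :=
    { herm :=
        { isOpen := φ.open_target
          smooth := fun i j => (D.smooth_div_eps hφ (D.h.smooth φ hφ i j)).add
              ((D.smooth_bCoef ϕ hφ i).mul (smooth_conj (D.smooth_bCoef ϕ hφ j)))
          herm := fun z _ i j => by
            simp only [aCoef, map_add, map_div₀, map_mul, conj_hCoef, Complex.conj_ofReal,
              Complex.conj_conj]
            ring
          pos := fun z hz η hη => by
            rw [sesqForm_aCoef, Complex.add_re, Complex.div_ofReal_re, Complex.mul_conj,
              Complex.ofReal_re]
            have h1 := D.sesqForm_hCoef_pos hφ hz hη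
            have h2 := D.eps_pos (φ.symm z)
            have h3 := Complex.normSq_nonneg (linForm (D.bCoef ϕ φ z) η)
            positivity }
      smooth_b := D.smooth_bCoef ϕ hφ
      -- Evaluating β on W gives -‖W‖²_h cos ϕ / `ε̃`, which is nonzero.
      b_ne := fun z hz h0 => by
        have h1 := D.beta_tangentAt ϕ φ z (D.wCoef φ z)
        rw [h0, D.tangentAt_wCoef hφ hz, beta] at h1
        simp only [linForm, Pi.zero_apply, zero_mul, Finset.sum_const_zero, mul_eq_zero,
          neg_eq_zero, div_eq_zero_iff, Complex.ofReal_eq_zero, hϕ, (D.eps_pos _).ne',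
          or_false] at h1
        have h2 := D.h.pos _ _ (hW (φ.symm z))
        rw [h1, Complex.zero_re] at h2
        exact lt_irrefl _ h2 }
  smooth_e := D.smooth_eps_complex hφ
  e_pos z _ := D.eps_pos _
  cut_pos z hz η hη := by
    have h1 : sesqForm (cutForm (D.aCoef ϕ φ) (D.bCoef ϕ φ) z) η η
        = sesqForm (D.hCoef φ z) η η / D.eps (φ.symm z) := by
      rw [sesqForm_cutForm, sesqForm_aCoef]; ring
    rw [h1, Complex.div_ofReal_re]
    exact div_pos (D.sesqForm_hCoef_pos hφ hz hη) (D.eps_pos _)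

theorem regularAt_solution (hφ : φ ∈ atlas (Cn n) M) (hW : ∀ x, D.W x ≠ 0) (hϕ : Real.cos ϕ < 0)
    {z η : Cn n} (hz : z ∈ φ.target) : RegularAt (localRep (D.solution ϕ) φ) z η
      ↔ (z, η) ∈ randersDomain φ.target (D.bCoef ϕ φ) :=
  (D.isNavigation ϕ hφ hW hϕ.ne).randers.regularAt_iff
    (fun z _ η => D.solution_localRep ϕ φ hϕ.le z η) hz

/-- The local equivalence in each chart. The regular points of F are those with β ≠ 0, and there h
and a are regular because η ≠ 0, so both hypotheses apply at all the points required. -/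
theorem isComplexDouglas_iff (hn : 2 ≤ n) (hW : ∀ x, D.W x ≠ 0) (hϕ : Real.cos ϕ < 0)
    (hBerwald : IsGeneralizedBerwald (D.solution ϕ))
    (hproj : ProjectivelyRelated D.h.norm (D.alpha ϕ)) :
    IsComplexDouglas (D.solution ϕ) ↔ ∀ φ ∈ atlas (Cn n) M, ∀ z ∈ φ.target,
      dzReal (fun z => D.eps (φ.symm z)) z = 0 := by
  obtain ⟨P, hP⟩ := hproj
  refine forall₂_congr fun φ hφ => ?_
  have hN := D.isNavigation ϕ hφ hW hϕ.ne
  rw [← hN.douglas_iff hn (fun z _ η => D.solution_localRep ϕ φ hϕ.le z η)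
    (fun z _ η => D.alpha_localRep ϕ φ z η) (fun z _ η => D.norm_localRep ϕ φ z η)
    (fun z η hp i k => hBerwald φ hφ z hp.1 η ((D.regularAt_solution ϕ hφ hW hϕ hp.1).2 hp) i k)
    (P := localRep P φ) fun z η hp => (hP φ hφ).2 z hp.1 η
      (hN.isHermOn.regularAt (fun z _ η => D.norm_localRep ϕ φ z η) hp.1 (linForm_ne_zero hp.2))
      (hN.randers.herm.regularAt (fun z _ η => D.alpha_localRep ϕ φ z η) hp.1
        (linForm_ne_zero hp.2))]
  constructor
  · intro h z η hp
    exact h z hp.1 η ((D.regularAt_solution ϕ hφ hW hϕ hp.1).2 hp)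
  · intro h z hz η hr
    exact h z η ((D.regularAt_solution ϕ hφ hW hϕ hz).1 hr)

/-- On a ball inside a chart the vanishing of ∂`ε̃` makes the real function `ε̃` constant; a locally
constant function on a connected space is constant. -/
theorem eps_const_iff [ConnectedSpace M] : (∃ c : ℝ, ∀ x : M, D.eps x = c) ↔
    ∀ φ ∈ atlas (Cn n) M, ∀ z ∈ φ.target, dzReal (fun z => D.eps (φ.symm z)) z = 0 := by
  constructor
  · rintro ⟨c, hc⟩ φ - z -
    funext j
    simp [dzReal, hc, wirtinger]
  · intro h
    have hloc : IsLocallyConstant D.eps := by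
      rw [IsLocallyConstant.iff_eventually_eq]
      intro x
      set φ := chartAt (Cn n) x
      have hφ : φ ∈ atlas (Cn n) M := chart_mem_atlas _ x
      have hx : x ∈ φ.source := mem_chart_source _ x
      obtain ⟨r, hr, hball⟩ := Metric.isOpen_iff.1 φ.open_target _ (φ.map_source hx)
      have hd : DifferentiableOn ℝ (fun z => D.eps (φ.symm z)) φ.target :=
        (D.smooth_eps hφ).differentiableOn (by simp)
      have hb := φ.continuousAt hx |>.preimage_mem_nhds (Metric.ball_mem_nhds (φ x) hr)
      filter_upwards [hb, φ.open_source.mem_nhds hx] with y hy hys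
      have := Metric.isOpen_ball.is_const_of_fderiv_eq_zero (𝕜 := ℝ)
        (convex_ball (φ x) r).isPreconnected (hd.mono hball) (fun z hz =>
          fderiv_eq_zero_of_dzReal (hd.differentiableAt (φ.open_target.mem_nhds (hball hz)))
            (h φ hφ z (hball hz))) hy (Metric.mem_ball_self hr)
      simpa only [φ.left_inv hys, φ.left_inv hx] using this
    obtain ⟨x₀⟩ := (inferInstance : Nonempty M)
    exact ⟨D.eps x₀, fun x => hloc.apply_eq_of_preconnectedSpace x x₀⟩

end Smooth

end NavigationData

end ComplexFinsler
end

theorem theorem4p8 {n : ℕ} (hn : 2 ≤ n) {M : Type*} [TopologicalSpace M]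
    [ChartedSpace (Fin n → ℂ) M] [IsManifold (modelWithCornersSelf ℂ (Fin n → ℂ)) ω M]
    [ConnectedSpace M] (D : ComplexFinsler.NavigationData n M) (hW : ∀ x, D.W x ≠ 0)
    (ϕ : ℝ) (hϕ : Real.cos ϕ < 0)
    (hBerwald : ComplexFinsler.IsGeneralizedBerwald (D.solution ϕ))
    (hproj : ComplexFinsler.ProjectivelyRelated D.h.norm (D.alpha ϕ)) :
    ComplexFinsler.IsComplexDouglas (D.solution ϕ) ↔ ∃ c : ℝ, ∀ x : M, D.eps x = c :=
  (D.isComplexDouglas_iff ϕ hn hW hϕ hBerwald hproj).trans D.eps_const_iff.symm
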